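/- Let $P=\mathbb C[z_0,z_1,z_2,z_3]$ and let $P^l\subset P$ be the space of forms of degree $l$. Let $d\ge 2$, let $p,q\ge 0$ be coprime integers with $d=r(p+q)$, $r\in\mathbb Z$, let $\sigma$ be a permutation of $\{1,2,3\}$ and let $[c_1:\dots:c_r]\in\mathbb P^{r-1}(\mathbb C)$. Let $M$ be the space of smooth surfaces $X\subset\mathbb P^3$ of degree $d$ that meet the union of the planes $\{z_j=0\}$, $j=1,2,3$, transversally; it is open in the projective space of lines in $P^d$. For $[F]\in M$ let $\psi:P^d\to T_{[F]}M=P^d/\mathbb C F$ be the canonical map. Let $T=T^{\sigma}_{(p,q)}(\underline c)\subset M$ be the set of the surfaces that have an equation $$F=wA+\prod_{\nu=1}^{r}\bigl(c\,z_{\sigma(1)}^{p+q}-c_\nu z_{\sigma(2)}^{p}z_{\sigma(3)}^{q}\bigr),\qquad w\in P^1,\ A\in P^{d-1},\ c\in\mathbb C^*, \qquad (*)$$ for some homogeneous coordinates $(c_\nu)$ of the given point. For $F\in P^d$ let $$J_F=\Bigl\langle \tfrac{\partial F}{\partial z_0},\,z_1\tfrac{\partial F}{\partial z_1},\,z_2\tfrac{\partial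 F}{\partial z_2},\,z_3\tfrac{\partial F}{\partial z_3}\Bigr\rangle,\quad J_F^l=J_F\cap P^l,\quad R_F=P/J_F,\quad R_F^l=P^l/J_F^l,$$ and for $\lambda\in P^{d-1}$ let $I_\lambda^d=\{x\in P^d:\lambda x=0\text{ in }R_F^{2d-1}\}$. Let $[F]\in T$ and fix an equation $(*)$ of it, with its $w$ and $A$. Put $\omega_F=\frac{\partial F}{\partial z_0}$ and $$\xi_F=\frac{\partial w}{\partial z_0}\Bigl(q z_{\sigma(2)}\frac{\partial A}{\partial z_{\sigma(2)}}-p z_{\sigma(3)}\frac{\partial A}{\partial z_{\sigma(3)}}\Bigr)-\frac{\partial A}{\partial z_0}\Bigl(q z_{\sigma(2)}\frac{\partial w}{\partial z_{\sigma(2)}}-p z_{\sigma(3)}\frac{\partial w}{\partial z_{\sigma(3)}}\Bigr)\in P^{d-1}.$$ For a neighbourhood $N$ of $w$ in $P^1$ let $T_N\subset T$ be the set of the surfaces that have an equation of the form $(*)$ with linear form in $N$. The tangent space $T_{[F]}(S)\subset T_{[F]}M$ of a subset $S\subset M$ at $[F]$ is the Zariski tangent space of its analytic germ: the image under $\psi$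 of the common kernel of the differentials at $F$ of all holomorphic functions defined near $F$ in $P^d$ that vanish near $F$ on the cone over $S$. Then: 1. For all sufficiently small neighbourhoods $N$ of $w$, $\psi^{-1}(T_{[F]}(T_N))=wP^{d-1}+J_F^d$; that is, $wP^{d-1}+J_F^d$ is the preimage of the tangent space of the branch of $T$ at $[F]$ that belongs to the plane $w=0$. If the linear form of every equation of the form $(*)$ of $F$ is a multiple of $w$, then $\psi^{-1}(T_{[F]}(T))=wP^{d-1}+J_F^d$. 2. If $\lambda=a\omega_F+b\xi_F$ with $a,b\in\mathbb C$ and $b\ne 0$, then $I_\lambda^d=wP^{d-1}+J_F^d$. 3. $\omega_F$ and $\xi_F$ are linearly independent, and $$\mathbb C\,\omega_F\oplus\mathbb C\,\xi_F=\{\lambda\in P^{d-1}:\lambda x=0\text{ in }R_F^{2d-1}\text{ for all }x\in wP^{d-1}+J_F^d\}.$$ -/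

import Mathlib

open scoped Topology

noncomputable section

namespace LogNL

/-- The homogeneous coordinate ring `P = ℂ[z₀, z₁, z₂, z₃]` of projective 3-space. -/
abbrev Poly : Type := MvPolynomial (Fin 4) ℂ

/-- The space `P^l` of forms of degree `l`. -/
abbrev Forms (l : ℕ) : Submodule ℂ Poly := MvPolynomial.homogeneousSubmodule (Fin 4) ℂ l

/-- The exponents of the monomials of degree `l` in four variables. -/
abbrev Mon (l : ℕ) : Type := ↥(Finset.finsuppAntidiag (Finset.univ : Finset (Fin 4)) l)

/-- The coefficient vector of a form of degree `l`.  It identifies `P^l` with the finite-dimensional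
normed space `Mon l → ℂ`; the topology and the analytic functions on `P^l` are taken from there. -/
def coeffs (l : ℕ) : Forms l →ₗ[ℂ] (Mon l → ℂ) :=
  LinearMap.pi fun m => (MvPolynomial.lcoeff ℂ m.1).comp (Forms l).subtype

/-- The gradient of `F` at the point `z`. -/
def gradient (F : Poly) (z : Fin 4 → ℂ) : Fin 4 → ℂ :=
  fun i => MvPolynomial.eval z (MvPolynomial.pderiv i F)

/-- `F = 0` is a smooth surface that meets `Y = {z₁ z₂ z₃ = 0}` transversally: at every point `z` of
the surface, `dF` and those `dz_j` (`j = 1, 2, 3`) with `z_j = 0` are linearly independent.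
The set of these `F` is the cone over the moduli space `M`, an open subset of the projective space
of lines in `P^d`. -/
def IsTransverse (F : Poly) : Prop :=
  ∀ z : Fin 4 → ℂ, z ≠ 0 → MvPolynomial.eval z F = 0 →
    LinearIndependent ℂ
      (fun o : Option {j : Fin 3 // z j.succ = 0} =>
        o.elim (gradient F z) (fun j => Pi.single j.1.succ 1))

/-- The product over `ν` of `t z_{σ(1)}^{p+q} - c_ν z_{σ(2)}^p z_{σ(3)}^q`.
The permutation `σ` acts on `Fin 3`; `j : Fin 3` stands for the index `j + 1` of the variable. -/
def binProd (σ : Equiv.Perm (Fin 3)) (p q : ℕ) {r : ℕ} (c : Fin r → ℂ) (t : ℂ) : Poly :=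
  ∏ ν : Fin r,
    (MvPolynomial.C t * MvPolynomial.X (σ 0).succ ^ (p + q)
      - MvPolynomial.C (c ν) * (MvPolynomial.X (σ 1).succ ^ p * MvPolynomial.X (σ 2).succ ^ q))

/-- `F` has an equation `F = w A + ∏ (t z_{σ(1)}^{p+q} - c'_ν z_{σ(2)}^p z_{σ(3)}^q)` with the given
linear form `w`, some form `A` of degree `d - 1`, some `t ≠ 0`, and `c' = s c` some vector of
homogeneous coordinates of the point `[c_1 : ⋯ : c_r]`. -/
def HasPlane (σ : Equiv.Perm (Fin 3)) (p q : ℕ) {r : ℕ} (c : Fin r → ℂ) {d : ℕ}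
    (F : Forms d) (w : Forms 1) : Prop :=
  ∃ A : Forms (d - 1), ∃ t s : ℂ, t ≠ 0 ∧ s ≠ 0 ∧
    (F : Poly) = (w : Poly) * (A : Poly) + binProd σ p q (s • c) t

/-- The cone over the locus `T^σ_{(p,q)}(c)` in `M`. -/
def locus (σ : Equiv.Perm (Fin 3)) (p q : ℕ) {r : ℕ} (c : Fin r → ℂ) (d : ℕ) : Set (Forms d) :=
  {F | IsTransverse (F : Poly) ∧ ∃ w : Forms 1, HasPlane σ p q c F w}

/-- The part of the locus where the linear form `w` can be taken in `N`. -/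
def locusIn (σ : Equiv.Perm (Fin 3)) (p q : ℕ) {r : ℕ} (c : Fin r → ℂ) (d : ℕ)
    (N : Set (Mon 1 → ℂ)) : Set (Forms d) :=
  {F | IsTransverse (F : Poly) ∧ ∃ w : Forms 1, coeffs 1 w ∈ N ∧ HasPlane σ p q c F w}

/-- The (Zariski) tangent space at `F` of the germ at `F` of a subset `S` of `P^d`: the common kernel
of the differentials at `F` of all holomorphic functions defined near `F` that vanish on `S` near
`F`. -/
def coneTangent {d : ℕ} (S : Set (Forms d)) (F : Forms d) : Submodule ℂ (Forms d) where
  carrier := {G | ∀ f : (Mon d → ℂ) → ℂ, AnalyticAt ℂ f (coeffs d F) →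
    (∀ᶠ a in 𝓝 (coeffs d F), ∀ H ∈ S, coeffs d H = a → f a = 0) →
    fderiv ℂ f (coeffs d F) (coeffs d G) = 0}
  add_mem' := by
    intro G H hG hH f hf hS
    rw [map_add, map_add, hG f hf hS, hH f hf hS, add_zero]
  zero_mem' := by
    intro f _ _
    rw [map_zero, map_zero]
  smul_mem' := by
    intro a G hG f hf hS
    rw [map_smul, map_smul, hG f hf hS, smul_zero]

/-- The canonical map `ψ : P^d → T_{[F]} M`.  As `M` is open in the projective space of lines in
`P^d`, its tangent space at `[F]` is `P^d / ℂ F`. -/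
def psi {d : ℕ} (F : Forms d) : Forms d →ₗ[ℂ] (Forms d ⧸ Submodule.span ℂ {F}) :=
  (Submodule.span ℂ {F}).mkQ

/-- The tangent space at `[F]`, inside `T_{[F]} M`, of the set of surfaces whose cone is `S`. -/
def tangentSpaceAt {d : ℕ} (S : Set (Forms d)) (F : Forms d) :
    Submodule ℂ (Forms d ⧸ Submodule.span ℂ {F}) :=
  (coneTangent S F).map (psi F)

/-- The ideal `J_F = ⟨∂F/∂z₀, z₁ ∂F/∂z₁, z₂ ∂F/∂z₂, z₃ ∂F/∂z₃⟩`. -/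
def jacIdeal (F : Poly) : Ideal Poly :=
  Ideal.span (insert (MvPolynomial.pderiv 0 F)
    (Set.range fun j : Fin 3 => MvPolynomial.X j.succ * MvPolynomial.pderiv j.succ F))

/-- The ring `R_F = P / J_F`. -/
abbrev JacRing (F : Poly) : Type := Poly ⧸ jacIdeal F

/-- `J_F^l = J_F ∩ P^l`, as a subspace of `P^l`. -/
def jacForms (F : Poly) (l : ℕ) : Submodule ℂ (Forms l) :=
  ((jacIdeal F).restrictScalars ℂ).comap (Forms l).subtype

/-- `w P^{d-1}`, as a subspace of `P^d`. -/
def multForms (w : Forms 1) (d : ℕ) : Submodule ℂ (Forms d) :=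
  ((Forms (d - 1)).map (LinearMap.mulLeft ℂ (w : Poly))).comap (Forms d).subtype

/-- `I_λ^d = {x ∈ P^d | λ x = 0 in R_F}` (for `λ ∈ P^{d-1}` the product lies in `R_F^{2d-1}`). -/
def annForms (F lam : Poly) (d : ℕ) : Submodule ℂ (Forms d) where
  carrier := {x | (Ideal.Quotient.mk (jacIdeal F) (lam * (x : Poly)) : JacRing F) = 0}
  add_mem' := by
    intro x y hx hy
    change (Ideal.Quotient.mk (jacIdeal F) (lam * ((x + y : Forms d) : Poly)) : JacRing F) = 0
    change (Ideal.Quotient.mk (jacIdeal F) (lam * (x : Poly)) : JacRing F) = 0 at hx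
    change (Ideal.Quotient.mk (jacIdeal F) (lam * (y : Poly)) : JacRing F) = 0 at hy
    rw [Submodule.coe_add, mul_add, map_add, hx, hy, add_zero]
  zero_mem' := by simp
  smul_mem' := by
    intro a x hx
    change (Ideal.Quotient.mk (jacIdeal F) (lam * ((a • x : Forms d) : Poly)) : JacRing F) = 0
    change (Ideal.Quotient.mk (jacIdeal F) (lam * (x : Poly)) : JacRing F) = 0 at hx
    rw [Submodule.coe_smul, mul_smul_comm, MvPolynomial.smul_eq_C_mul, map_mul, hx, mul_zero]

/-- `ω_F = ∂F/∂z₀`. -/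
def omegaF (F : Poly) : Poly := MvPolynomial.pderiv 0 F

/-- The derivation `q z_{σ(2)} ∂/∂z_{σ(2)} - p z_{σ(3)} ∂/∂z_{σ(3)}` applied to `G`. -/
def theta (σ : Equiv.Perm (Fin 3)) (p q : ℕ) (G : Poly) : Poly :=
  (q : Poly) * (MvPolynomial.X (σ 1).succ * MvPolynomial.pderiv (σ 1).succ G)
    - (p : Poly) * (MvPolynomial.X (σ 2).succ * MvPolynomial.pderiv (σ 2).succ G)

/-- The form `ξ_F` attached to the equation `F = w A + ∏ (⋯)`. -/
def xiF (σ : Equiv.Perm (Fin 3)) (p q : ℕ) (w A : Poly) : Poly :=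
  MvPolynomial.pderiv 0 w * theta σ p q A - MvPolynomial.pderiv 0 A * theta σ p q w

end LogNL

end

/-!
Write `J = J_F`, `ω = ∂F/∂z₀`, and let `θ` be the derivation `theta`, which kills the
binomial product.

**Algebra.** By Euler's formula, transversality of `F` says that the four generators of `J` have no
common zero in projective space (`isTransverse_iff`); in particular the plane `w = 0` misses the point
`[1 : 0 : 0 : 0]`. Applying `∂/∂z₀` and `θ` to `F = w A + ∏ (⋯)` shows that `(∂w/∂z₀) θF` equals `w ξ_F`
up to a multiple of `ω`. Hence `J = (w ξ_F, ω, g, h)` with two further forms `g`, `h` of degree `d`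
(`IsTransverseEquation.jacIdeal_eq`), and both `(ξ_F, ω, g, h)` and `(w, ω, g, h)` are systems of
parameters. A system of parameters consisting of forms is a regular sequence in any order
(`OnlyTrivialZero.isRegularTuple`), and its socle lives in the expected degree
(`OnlyTrivialZero.mem_span_of_X_mul_mem`); both are proved by exchanging the members one after the
other for general linear forms, until they are the coordinates up to an automorphism. Regularity gives
`J : ξ_F = (w) + J`, which is the assertion on `I_λ^d`. Conversely, a form `λ` of degree `d - 1` that
kills `w P^{d-1}` modulo `J` kills `w`, as `λ w` lies below the socle degree of `P / J`, and then
regularity and a comparison of degrees give `λ ∈ ℂ ω + ℂ ξ_F`.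

**Tangent spaces.** The branch of the locus is parametrized by
`(L, A, t, s) ↦ (w + L) A + ∏ (t z_{σ(1)}^{p+q} - s c_ν z_{σ(2)}^p z_{σ(3)}^q)` with linear forms `L` in
`z₁, z₂, z₃` (`germMap`). The range of its differential at the given equation is `w P^{d-1} + J^d`, and the
differential is injective, again because `(w, ω, g, h)` is a regular sequence. The image of such an
immersed germ is cut out by analytic equations with the expected differentials
(`exists_analyticAt_vanishing`), so the tangent space is the asserted one as soon as the surfaces of
the locus near `F` lie in the image of an arbitrarily small neighbourhood of the base point. This is a
properness statement, proved by sequences. If surfaces `F_n` with planes `w_n` converge to `F` and `w`,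
then the forms `A_n` and the coefficients of the binomial products are bounded, since
`(A, Γ) ↦ w A + Γ` is injective on pairs where `Γ` does not involve `z₀`; the limit is an equation of `F`
with the plane `w`, hence the given one up to a rescaling of `(t, s)` that fixes the product
(`IsTransverseEquation.eventually_mem_image_germMap`). For the whole locus one also needs that the
planes cannot converge to a plane through `[1 : 0 : 0 : 0]` (`eval_limit_plane_ne_zero`).
-/

noncomputable section

namespace LogNL

open MvPolynomial

/-! ### Non-zero-divisors modulo an ideal -/

/-- `f` is a non-zero-divisor modulo the ideal `I`. -/
def NonZeroDivMod {R : Type*} [CommRing R] (I : Ideal R) (f : R) : Prop :=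
  ∀ u, f * u ∈ I → u ∈ I

section NonZeroDivMod

variable {R : Type*} [CommRing R]

lemma NonZeroDivMod.pow {I : Ideal R} {f : R} (h : NonZeroDivMod I f) (n : ℕ) :
    NonZeroDivMod I (f ^ n) := by
  induction n with
  | zero => intro u hu; simpa using hu
  | succ n ih =>
    intro u hu
    rw [pow_succ, mul_assoc] at hu
    exact h _ (ih _ hu)

lemma NonZeroDivMod.notMem {I : Ideal R} {f : R} (h : NonZeroDivMod I f) (hI : I ≠ ⊤) :
    f ∉ I := fun hf =>
  hI ((Ideal.eq_top_iff_one I).2 (h 1 (by simpa using hf)))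

/-- Two consecutive members of a regular sequence: the first is a non-zero-divisor modulo the
second. -/
lemma NonZeroDivMod.swap {s : Set R} {f b : R} (hf : NonZeroDivMod (Ideal.span (insert b s)) f)
    (hb : NonZeroDivMod (Ideal.span s) b) : NonZeroDivMod (Ideal.span (insert f s)) b := by
  intro u hu
  obtain ⟨c, z, hz, h⟩ := Ideal.mem_span_insert.1 hu
  have hc : c ∈ Ideal.span (insert b s) := by
    apply hf
    rw [show f * c = u * b + (-z) by linear_combination -h]
    exact Ideal.mem_span_insert.2 ⟨u, -z, neg_mem hz, rfl⟩
  obtain ⟨c', z', hz', h'⟩ := Ideal.mem_span_insert.1 hc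
  have : u - c' * f ∈ Ideal.span s := by
    apply hb
    rw [show b * (u - c' * f) = f * z' + z by linear_combination h + f * h']
    exact add_mem (Ideal.mul_mem_left _ _ hz') hz
  exact Ideal.mem_span_insert.2 ⟨c', _, this, by ring⟩

end NonZeroDivMod

/-! ### Homogeneous components -/

section Homogeneous

variable {ι k : Type*} [Field k]

attribute [local instance] MvPolynomial.gradedAlgebra

lemma homogeneousComponent_mul_of_isHomogeneous {g : MvPolynomial ι k} {e : ℕ}
    (hg : g.IsHomogeneous e) (a : MvPolynomial ι k) (n : ℕ) :
    homogeneousComponent n (a * g) =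
      if e ≤ n then homogeneousComponent (n - e) a * g else 0 := by
  have key : ∀ (x : MvPolynomial ι k) m,
      (DirectSum.decompose (homogeneousSubmodule ι k) x m : MvPolynomial ι k) =
        homogeneousComponent m x := decomposition.decompose'_apply
  rw [← key, ← key]
  exact DirectSum.coe_decompose_mul_of_right_mem (homogeneousSubmodule ι k) n hg

lemma isHomogeneous_span {s : Set (MvPolynomial ι k)}
    (hs : ∀ x ∈ s, ∃ n, x.IsHomogeneous n) :
    (Ideal.span s).IsHomogeneous (homogeneousSubmodule ι k) :=
  Ideal.homogeneous_span _ _ fun x hx => hs x hx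

lemma homogeneousComponent_mem_span {s : Set (MvPolynomial ι k)}
    (hs : ∀ x ∈ s, ∃ n, x.IsHomogeneous n) {p : MvPolynomial ι k} (hp : p ∈ Ideal.span s) (n : ℕ) :
    homogeneousComponent n p ∈ Ideal.span s :=
  homogeneousComponent_mem_of_mem (isHomogeneous_span hs) hp n

lemma mem_span_of_homogeneousComponent {s : Set (MvPolynomial ι k)}
    {p : MvPolynomial ι k} (h : ∀ n, homogeneousComponent n p ∈ Ideal.span s) :
    p ∈ Ideal.span s := by
  rw [← sum_homogeneousComponent p]
  exact sum_mem fun n _ => h n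

/-- A form in the ideal of finitely many forms is a combination of them with forms of the expected
degrees as coefficients. -/
lemma exists_isHomogeneous_coeff [Fintype ι] {κ : Type*} [Fintype κ] {g : κ → MvPolynomial ι k}
    {e : κ → ℕ} (hg : ∀ i, (g i).IsHomogeneous (e i)) {x : MvPolynomial ι k} {n : ℕ}
    (hx : x.IsHomogeneous n) (hxg : x ∈ Ideal.span (Set.range g)) :
    ∃ a : κ → MvPolynomial ι k, (∀ i, (a i).IsHomogeneous (n - e i)) ∧
      (∀ i, n < e i → a i = 0) ∧ x = ∑ i, a i * g i := by
  obtain ⟨c, rfl⟩ := Ideal.mem_span_range_iff_exists_fun.1 hxg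
  refine ⟨fun i => if e i ≤ n then homogeneousComponent (n - e i) (c i) else 0,
    fun i => ?_, fun i hi => if_neg (by omega), ?_⟩
  · dsimp only
    split_ifs
    · exact homogeneousComponent_isHomogeneous _ _
    · exact isHomogeneous_zero _ _ _
  · conv_lhs => rw [← homogeneousComponent_eq_self hx, map_sum]
    refine Finset.sum_congr rfl fun i _ => ?_
    rw [homogeneousComponent_mul_of_isHomogeneous (hg i)]
    by_cases h : e i ≤ n <;> simp [h]

/-- Let `b` be a form of positive degree and a non-zero-divisor modulo `s`. Then a non-zero-divisor
modulo `s` and `b` is one modulo `s`: an element that it kills modulo `s` is divisible modulo `s` by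
every power of `b`. -/
lemma NonZeroDivMod.descend {s : Set (MvPolynomial ι k)} (hs : ∀ x ∈ s, ∃ n, x.IsHomogeneous n)
    {f b : MvPolynomial ι k} {e : ℕ} (he : 0 < e) (hbe : b.IsHomogeneous e)
    (hf : NonZeroDivMod (Ideal.span (insert b s)) f) (hb : NonZeroDivMod (Ideal.span s) b) :
    NonZeroDivMod (Ideal.span s) f := by
  intro u hu
  have key : ∀ n : ℕ, ∃ v, f * v ∈ Ideal.span s ∧ u - v * b ^ n ∈ Ideal.span s := by
    intro n
    induction n with
    | zero => exact ⟨u, hu, by simp⟩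
    | succ n ih =>
      obtain ⟨v, hv, huv⟩ := ih
      obtain ⟨c, z, hz, h⟩ := Ideal.mem_span_insert.1
        (hf v (Ideal.span_mono (Set.subset_insert _ _) hv))
      refine ⟨c, hb _ ?_, ?_⟩
      · rw [show b * (f * c) = f * v - f * z by rw [h]; ring]
        exact sub_mem hv (Ideal.mul_mem_left _ _ hz)
      · rw [show u - c * b ^ (n + 1) = (u - v * b ^ n) + b ^ n * z by rw [h]; ring]
        exact add_mem huv (Ideal.mul_mem_left _ _ hz)
  refine mem_span_of_homogeneousComponent fun n => ?_
  obtain ⟨v, -, hv⟩ := key (n + 1)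
  have := homogeneousComponent_mem_span hs hv n
  rwa [map_sub, homogeneousComponent_mul_of_isHomogeneous (hbe.pow (n + 1)), if_neg, sub_zero]
    at this
  nlinarith

end Homogeneous

/-! ### Systems of parameters consisting of forms -/

section RegularTuple

variable {ι k : Type*} [Fintype ι] [DecidableEq ι] [Field k]

/-- The only common zero of the polynomials `g i` is the origin. -/
def OnlyTrivialZero (g : ι → MvPolynomial ι k) : Prop :=
  ∀ z : ι → k, (∀ i, eval z (g i) = 0) → z = 0

/-- The `g i`, taken in any order, form a regular sequence. -/
def IsRegularTuple (g : ι → MvPolynomial ι k) : Prop :=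
  ∀ (S : Finset ι) (i : ι), i ∉ S → NonZeroDivMod (Ideal.span (g '' S)) (g i)

omit [Fintype ι] in
lemma image_update_of_notMem (g : ι → MvPolynomial ι k) {a : ι} (l : MvPolynomial ι k)
    {S : Finset ι} (ha : a ∉ S) : Function.update g a l '' S = g '' S :=
  Set.image_congr fun x (hx : x ∈ S) => Function.update_of_ne (fun h : x = a => ha (h ▸ hx)) _ _

lemma range_eq_insert_image_erase (g : ι → MvPolynomial ι k) (a : ι) :
    Set.range g = insert (g a) (g '' (Finset.univ.erase a : Finset ι)) := by
  rw [← Set.image_insert_eq, ← Finset.coe_insert, Finset.insert_erase (Finset.mem_univ a),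
    Finset.coe_univ, Set.image_univ]

/-- Exchange: a tuple of forms of positive degree is regular if it becomes regular when `g a` is
replaced by some `l`, a power of which lies in the ideal of the tuple. -/
lemma IsRegularTuple.exchange {g : ι → MvPolynomial ι k} {e : ι → ℕ} (he : ∀ i, 0 < e i)
    (hg : ∀ i, (g i).IsHomogeneous (e i)) (a : ι) {l : MvPolynomial ι k}
    (hreg : IsRegularTuple (Function.update g a l)) {N : ℕ}
    (hN : l ^ N ∈ Ideal.span (Set.range g)) : IsRegularTuple g := by
  have hhom : ∀ S : Finset ι, ∀ x ∈ g '' (S : Set ι), ∃ n, x.IsHomogeneous n := by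
    rintro S _ ⟨i, -, rfl⟩
    exact ⟨_, hg i⟩
  have hne : ∀ (S : Finset ι) i, a ∉ S → i ∉ S → i ≠ a →
      NonZeroDivMod (Ideal.span (g '' S)) (g i) := by
    intro S i ha hi hia
    have := hreg S i hi
    rwa [image_update_of_notMem g l ha, Function.update_of_ne hia] at this
  have htop : NonZeroDivMod (Ideal.span (g '' (Finset.univ.erase a : Finset ι))) (g a) := by
    intro u hu
    have hl := hreg (Finset.univ.erase a) a (Finset.notMem_erase _ _)
    rw [image_update_of_notMem g l (Finset.notMem_erase _ _), Function.update_self] at hl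
    apply hl.pow N
    rw [range_eq_insert_image_erase g a] at hN
    obtain ⟨c, z, hz, h⟩ := Ideal.mem_span_insert.1 hN
    rw [h, show (c * g a + z) * u = c * (g a * u) + u * z by ring]
    exact add_mem (Ideal.mul_mem_left _ _ hu) (Ideal.mul_mem_left _ _ hz)
  have hself : ∀ n : ℕ, ∀ S : Finset ι, a ∉ S → (Finset.univ.erase a \ S).card = n →
      NonZeroDivMod (Ideal.span (g '' S)) (g a) := by
    intro n
    induction n with
    | zero =>
      intro S ha hS
      have : Finset.univ.erase a = S := by
        refine Finset.Subset.antisymm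
          (Finset.sdiff_eq_empty_iff_subset.1 (Finset.card_eq_zero.1 hS)) fun x hx => ?_
        exact Finset.mem_erase.2 ⟨fun h => ha (h ▸ hx), Finset.mem_univ _⟩
      rw [← this]
      exact htop
    | succ n ih =>
      intro S ha hS
      obtain ⟨b, hb⟩ := Finset.card_pos.1 (by omega : 0 < (Finset.univ.erase a \ S).card)
      obtain ⟨hb1, hb2⟩ := Finset.mem_sdiff.1 hb
      have hba : b ≠ a := (Finset.mem_erase.1 hb1).1
      have h1 : NonZeroDivMod (Ideal.span (g '' (insert b S : Finset ι))) (g a) := by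
        apply ih _ (by simp [ha, hba.symm])
        rw [Finset.sdiff_insert, Finset.card_erase_of_mem hb, hS]
        rfl
      rw [Finset.coe_insert, Set.image_insert_eq] at h1
      exact h1.descend (hhom S) (he b) (hg b) (hne S b ha hb2 hba)
  intro S i hi
  by_cases hia : i = a
  · subst hia
    exact hself _ S hi rfl
  by_cases ha : a ∈ S
  · have hS : insert a (S.erase a) = S := Finset.insert_erase ha
    have hi' : i ∉ S.erase a := fun h => hi (Finset.mem_of_mem_erase h)
    rw [← hS, Finset.coe_insert, Set.image_insert_eq]
    refine NonZeroDivMod.swap ?_ (hne _ i (Finset.notMem_erase _ _) hi' hia)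
    rw [← Set.image_insert_eq, ← Finset.coe_insert]
    exact hself _ _ (by simp [Ne.symm hia]) rfl
  · exact hne S i ha hi hia

omit [Fintype ι] [DecidableEq ι] in
lemma isRegularTuple_X : IsRegularTuple (X : ι → MvPolynomial ι k) := by
  intro S i hi u hu
  rw [mem_ideal_span_X_image] at hu ⊢
  intro m hm
  obtain ⟨j, hj, hmj⟩ := hu (m + Finsupp.single i 1) (by
    rw [mem_support_iff, mul_comm, coeff_mul_X]
    exact mem_support_iff.1 hm)
  refine ⟨j, hj, ?_⟩
  have : i ≠ j := fun h => hi (h ▸ hj)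
  simpa [Finsupp.single_apply, this] using hmj

/-- As many linear forms as variables, with the origin as only common zero, are the images of the
variables under an automorphism. -/
lemma isRegularTuple_of_linear {g : ι → MvPolynomial ι k} (hg : ∀ i, (g i).IsHomogeneous 1)
    (hz : OnlyTrivialZero g) : IsRegularTuple g := by
  have hlin : ∀ i, ∃ c : ι → k, g i = ∑ j, C (c j) * X j := by
    intro i
    have h : g i ∈ homogeneousSubmodule ι k 1 := hg i
    rw [homogeneousSubmodule_one_eq_span_X] at h
    obtain ⟨c, hc⟩ := (Submodule.mem_span_range_iff_exists_fun k).1 h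
    exact ⟨c, by rw [← hc]; simp [smul_eq_C_mul]⟩
  choose M hM using hlin
  let A : Matrix ι ι k := Matrix.of M
  have hA : IsUnit A.det := by
    rw [← Matrix.isUnit_iff_isUnit_det, ← Matrix.mulVec_injective_iff_isUnit]
    rw [← Matrix.coe_mulVecLin]
    refine (injective_iff_map_eq_zero _).2 fun v hv => hz v fun i => ?_
    have := congrFun hv i
    simpa [hM, Matrix.mulVec, dotProduct, A] using this
  let B : Matrix ι ι k := A⁻¹
  have hAB : A * B = 1 := Matrix.mul_nonsing_inv A hA
  have hBA : B * A = 1 := Matrix.nonsing_inv_mul A hA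
  let φ : MvPolynomial ι k →ₐ[k] MvPolynomial ι k := aeval g
  let h : ι → MvPolynomial ι k := fun i => ∑ j, C (B i j) * X j
  let ψ : MvPolynomial ι k →ₐ[k] MvPolynomial ι k := aeval h
  have comp : ∀ (P Q : Matrix ι ι k), P * Q = 1 → ∀ i,
      ∑ j, C (P i j) * (∑ l, C (Q j l) * X l) = (X i : MvPolynomial ι k) := by
    intro P Q hPQ i
    simp_rw [Finset.mul_sum, ← mul_assoc, ← C_mul]
    rw [Finset.sum_comm]
    simp_rw [← Finset.sum_mul, ← map_sum]
    have : ∀ l, ∑ j, P i j * Q j l = (1 : Matrix ι ι k) i l := fun l => by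
      rw [← hPQ, Matrix.mul_apply]
    simp [this, Matrix.one_apply]
  have hψg : ∀ i, ψ (g i) = X i := by
    intro i
    rw [hM i, map_sum]
    simp only [map_mul, ψ, aeval_X, algHom_C, algebraMap_eq]
    exact comp A B hAB i
  have hφψ : ∀ u, φ (ψ u) = u := by
    intro u
    have : φ.comp ψ = AlgHom.id k _ := by
      refine algHom_ext fun i => ?_
      simp only [AlgHom.comp_apply, ψ, φ, aeval_X, h, map_sum, map_mul, algHom_C, algebraMap_eq, hM,
        AlgHom.id_apply]
      exact comp B A hBA i
    exact DFunLike.congr_fun this u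
  intro S i hi u hu
  have h1 : ψ u ∈ Ideal.span (X '' (S : Set ι)) := by
    apply isRegularTuple_X S i hi
    have := Ideal.mem_map_of_mem ψ hu
    rw [Ideal.map_span, Set.image_image, map_mul, hψg] at this
    simpa only [hψg] using this
  have h2 := Ideal.mem_map_of_mem φ h1
  rw [hφψ, Ideal.map_span, Set.image_image] at h2
  simpa only [φ, aeval_X] using h2

end RegularTuple

/-! ### Systems of parameters are regular sequences; their socles -/

section Nullstellensatz

variable {ι k : Type*} [Fintype ι] [Field k] [IsAlgClosed k]

/-- Nullstellensatz for forms whose only common zero is the origin. -/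
lemma OnlyTrivialZero.exists_pow_mem {g : ι → MvPolynomial ι k} (hz : OnlyTrivialZero g)
    {f : MvPolynomial ι k} (hf : eval 0 f = 0) : ∃ N, f ^ N ∈ Ideal.span (Set.range g) := by
  have : f ∈ (Ideal.span (Set.range g)).radical := by
    rw [← vanishingIdeal_zeroLocus_eq_radical (K := k), mem_vanishingIdeal_iff]
    intro z hzz
    have : z = 0 := hz z fun i => by
      simpa [aeval_eq_eval] using hzz (g i) (Ideal.subset_span ⟨i, rfl⟩)
    rw [this]
    simpa [aeval_eq_eval] using hf
  exact Ideal.mem_radical_iff.1 this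

omit [Fintype ι] [IsAlgClosed k] in
lemma eval_smul_of_isHomogeneous {f : MvPolynomial ι k} {n : ℕ} (hf : f.IsHomogeneous n) (s : k)
    (z : ι → k) : eval (s • z) f = s ^ n * eval z f := by
  rw [eval_eq, eval_eq, Finset.mul_sum]
  refine Finset.sum_congr rfl fun d hd => ?_
  simp only [Pi.smul_apply, smul_eq_mul, mul_pow, Finset.prod_mul_distrib]
  have : ∏ i ∈ d.support, s ^ d i = s ^ n := by
    rw [Finset.prod_pow_eq_pow_sum]
    congr 1
    by_contra h
    exact mem_support_iff.1 hd (hf.coeff_eq_zero h)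
  rw [this]
  ring

omit [Fintype ι] [IsAlgClosed k] in
lemma eval_zero_of_isHomogeneous {f : MvPolynomial ι k} {n : ℕ} (hn : 0 < n)
    (hf : f.IsHomogeneous n) : eval 0 f = 0 := by
  have := hf.coeff_eq_zero (d := 0) (by simpa using hn.ne)
  simpa [← constantCoeff_eq] using this

/-- Forms of large degree lie in the ideal of a system of parameters. -/
lemma OnlyTrivialZero.exists_forall_mem {g : ι → MvPolynomial ι k} (hz : OnlyTrivialZero g) :
    ∃ N, ∀ n ≥ N, ∀ x : MvPolynomial ι k, x.IsHomogeneous n → x ∈ Ideal.span (Set.range g) := by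
  have hle : Ideal.span (Set.range (X : ι → MvPolynomial ι k)) ≤
      (Ideal.span (Set.range g)).radical := by
    rw [Ideal.span_le]
    rintro _ ⟨i, rfl⟩
    exact Ideal.mem_radical_iff.2 (hz.exists_pow_mem (by simp))
  obtain ⟨N, hN⟩ := Ideal.exists_pow_le_of_le_radical_of_fg hle
    (Submodule.fg_span (Set.finite_range _))
  refine ⟨N, fun n hn x hx => hN (Ideal.pow_le_pow_right hn ?_)⟩
  rw [Ideal.mem_span_pow_iff_exists_isHomogeneous]
  refine ⟨map C x, hx.map _, ?_⟩
  rw [eval_map]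
  exact eval₂_eta x

variable [DecidableEq ι]

/-- A system of parameters without its member `g a` has only finitely many common zeros with
`g a = 1`, as the coordinate ring of these is spanned by the forms of bounded degree. -/
lemma OnlyTrivialZero.finite_zeros {g : ι → MvPolynomial ι k} {e : ι → ℕ} (he : ∀ i, 0 < e i)
    (hg : ∀ i, (g i).IsHomogeneous (e i)) (hz : OnlyTrivialZero g) (a : ι) :
    {z : ι → k | (∀ i ≠ a, eval z (g i) = 0) ∧ eval z (g a) = 1}.Finite := by
  let I : Ideal (MvPolynomial ι k) :=
    Ideal.span (insert (g a - 1) (g '' (Finset.univ.erase a : Finset ι)))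
  obtain ⟨N, hN⟩ := hz.exists_forall_mem
  let W : Submodule k (MvPolynomial ι k ⧸ I) :=
    (⨆ n ∈ Finset.range N, homogeneousSubmodule ι k n).map (Ideal.Quotient.mkₐ k I).toLinearMap
  have hW : W.FG :=
    (Submodule.fg_biSup _ _ fun n _ => homogeneousSubmodule_fg ι k n).map _
  have key : ∀ n, ∀ x : MvPolynomial ι k, x.IsHomogeneous n → Ideal.Quotient.mk I x ∈ W := by
    intro n
    induction n using Nat.strong_induction_on with
    | _ n ih =>
      intro x hx
      by_cases hn : n < N
      · exact ⟨x, Submodule.mem_iSup_of_mem n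
          (Submodule.mem_iSup_of_mem (Finset.mem_range.2 hn) hx), rfl⟩
      · obtain ⟨b, hb, hb0, hxb⟩ := exists_isHomogeneous_coeff hg hx (hN n (by omega) x hx)
        have hmk : Ideal.Quotient.mk I x = Ideal.Quotient.mk I (b a) := by
          rw [Ideal.Quotient.eq, hxb, ← Finset.add_sum_erase _ _ (Finset.mem_univ a)]
          rw [add_sub_right_comm, show b a * g a - b a = b a * (g a - 1) by ring]
          refine add_mem (Ideal.mul_mem_left _ _ (Ideal.subset_span (Set.mem_insert _ _)))
            (sum_mem fun i hi => Ideal.mul_mem_left _ _ (Ideal.subset_span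
              (Set.mem_insert_of_mem _ ⟨i, hi, rfl⟩)))
        rw [hmk]
        by_cases hea : n < e a
        · rw [hb0 a hea, map_zero]
          exact zero_mem _
        · exact ih (n - e a) (by have := he a; omega) _ (hb a)
  have htop : W = ⊤ := by
    refine eq_top_iff.2 fun y _ => ?_
    obtain ⟨x, rfl⟩ := Ideal.Quotient.mk_surjective y
    rw [← sum_homogeneousComponent x, map_sum]
    exact sum_mem fun n _ => key n _ (homogeneousComponent_isHomogeneous _ _)
  have : Module.Finite k (MvPolynomial ι k ⧸ I) := ⟨htop ▸ hW⟩
  refine Set.Finite.subset (Set.finite_range fun f : (MvPolynomial ι k ⧸ I) →ₐ[k] k =>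
    fun i => f (Ideal.Quotient.mk I (X i))) ?_
  rintro z ⟨hz0, hz1⟩
  have hI : ∀ x ∈ I, (aeval z : MvPolynomial ι k →ₐ[k] k) x = 0 := by
    have : I ≤ RingHom.ker (aeval z : MvPolynomial ι k →ₐ[k] k) := by
      rw [Ideal.span_le]
      rintro _ (rfl | ⟨i, hi, rfl⟩)
      · simp [aeval_eq_eval, hz1]
      · simpa [aeval_eq_eval] using hz0 i (Finset.ne_of_mem_erase hi)
    exact this
  refine ⟨Ideal.Quotient.liftₐ I (aeval z) hI, funext fun i => ?_⟩
  have := DFunLike.congr_fun (Ideal.Quotient.liftₐ_comp I (aeval z) hI) (X i)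
  rw [aeval_X] at this
  exact this

omit [IsAlgClosed k] [DecidableEq ι] in
/-- Finitely many nonzero points lie off a common hyperplane through the origin. -/
lemma exists_linear_ne_zero [Infinite k] {Z : Set (ι → k)} (hZ : Z.Finite) (h0 : 0 ∉ Z) :
    ∃ l : MvPolynomial ι k, l.IsHomogeneous 1 ∧ ∀ z ∈ Z, eval z l ≠ 0 := by
  let Q : MvPolynomial ι k := ∏ z ∈ hZ.toFinset, ∑ j, C (z j) * X j
  have hQ : Q ≠ 0 := by
    refine Finset.prod_ne_zero_iff.2 fun z hz h => ?_
    apply h0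
    have : z = 0 := by
      classical
      ext i
      have := congrArg (eval (Pi.single i 1)) h
      simpa [Pi.single_apply] using this
    exact this ▸ hZ.mem_toFinset.1 hz
  obtain ⟨c, hc⟩ : ∃ c, eval c Q ≠ 0 := by
    by_contra! h
    exact hQ (MvPolynomial.funext fun x => by rw [h x, map_zero])
  refine ⟨∑ j, C (c j) * X j, IsHomogeneous.sum _ _ _ fun j _ => isHomogeneous_C_mul_X _ _,
    fun z hz h => hc ?_⟩
  rw [map_prod]
  refine Finset.prod_eq_zero (hZ.mem_toFinset.2 hz) ?_
  simpa [mul_comm] using h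

/-- A member of a system of parameters may be replaced by a general linear form. -/
lemma OnlyTrivialZero.exists_update {g : ι → MvPolynomial ι k} {e : ι → ℕ} (he : ∀ i, 0 < e i)
    (hg : ∀ i, (g i).IsHomogeneous (e i)) (hz : OnlyTrivialZero g) (a : ι) :
    ∃ l : MvPolynomial ι k, l.IsHomogeneous 1 ∧ OnlyTrivialZero (Function.update g a l) := by
  have : Infinite k := IsAlgClosed.instInfinite
  obtain ⟨l, hl, hlz⟩ := exists_linear_ne_zero (hz.finite_zeros he hg a) (by
    rintro ⟨-, h⟩
    rw [eval_zero_of_isHomogeneous (he a) (hg a)] at h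
    exact zero_ne_one h)
  refine ⟨l, hl, fun z hzz => ?_⟩
  have h1 : eval z l = 0 := by simpa using hzz a
  have h2 : ∀ i ≠ a, eval z (g i) = 0 := fun i hi => by
    simpa [Function.update_of_ne hi] using hzz i
  by_cases h3 : eval z (g a) = 0
  · exact hz z fun i => by
      by_cases hi : i = a
      · rw [hi, h3]
      · exact h2 i hi
  · -- rescale `z` so that `g a` takes the value `1`
    exfalso
    obtain ⟨s, hs⟩ := IsAlgClosed.exists_pow_nat_eq (eval z (g a))⁻¹ (he a)
    refine hlz (s • z) ⟨fun i hi => ?_, ?_⟩ ?_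
    · rw [eval_smul_of_isHomogeneous (hg i), h2 i hi, mul_zero]
    · rw [eval_smul_of_isHomogeneous (hg a), hs, inv_mul_cancel₀ h3]
    · rw [eval_smul_of_isHomogeneous hl, h1, mul_zero]

omit [Fintype ι] [IsAlgClosed k] in
lemma IsHomogeneous.update {g : ι → MvPolynomial ι k} {e : ι → ℕ}
    (hg : ∀ i, (g i).IsHomogeneous (e i)) (a : ι) {l : MvPolynomial ι k} {n : ℕ}
    (hl : l.IsHomogeneous n) (i : ι) :
    (Function.update g a l i).IsHomogeneous (Function.update e a n i) := by
  by_cases hi : i = a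
  · subst hi; simpa using hl
  · simpa [Function.update_of_ne hi] using hg i

/-- A system of parameters consisting of forms is a regular sequence in any order.  The members are
exchanged one after the other for general linear forms. -/
theorem OnlyTrivialZero.isRegularTuple {g : ι → MvPolynomial ι k} {e : ι → ℕ} (he : ∀ i, 0 < e i)
    (hg : ∀ i, (g i).IsHomogeneous (e i)) (hz : OnlyTrivialZero g) : IsRegularTuple g := by
  have key : ∀ T : Finset ι, ∀ (g : ι → MvPolynomial ι k) (e : ι → ℕ), (∀ i, 0 < e i) →
      (∀ i, (g i).IsHomogeneous (e i)) → OnlyTrivialZero g → (∀ i ∉ T, e i = 1) →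
      IsRegularTuple g := by
    intro T
    induction T using Finset.induction_on with
    | empty =>
      intro g e he hg hz hT
      exact isRegularTuple_of_linear (fun i => hT i (Finset.notMem_empty i) ▸ hg i) hz
    | insert a T ha ih =>
      intro g e he hg hz hT
      obtain ⟨l, hl, hlz⟩ := hz.exists_update he hg a
      have hreg : IsRegularTuple (Function.update g a l) := by
        refine ih _ (Function.update e a 1) (fun i => ?_) (IsHomogeneous.update hg a hl) hlz
          fun i hi => ?_
        · by_cases hi : i = a
          · subst hi; simp
          · simpa [Function.update_of_ne hi] using he i
        · by_cases hia : i = a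
          · subst hia; simp
          · rw [Function.update_of_ne hia]
            exact hT i (by simp [hia, hi])
      obtain ⟨N, hN⟩ := hz.exists_pow_mem (eval_zero_of_isHomogeneous one_pos hl)
      exact hreg.exchange he hg a hN
  exact key Finset.univ g e he hg hz fun i hi => absurd (Finset.mem_univ i) hi

/-- A member of a system of parameters is a non-zero-divisor modulo the other ones. -/
lemma OnlyTrivialZero.nonZeroDivMod {g : ι → MvPolynomial ι k} {e : ι → ℕ} (he : ∀ i, 0 < e i)
    (hg : ∀ i, (g i).IsHomogeneous (e i)) (hz : OnlyTrivialZero g) (a : ι) :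
    NonZeroDivMod (Ideal.span (g '' (Finset.univ.erase a : Finset ι))) (g a) :=
  hz.isRegularTuple he hg _ a (Finset.notMem_erase _ _)

/-- The socle of a complete intersection of forms of degrees `e i` has no elements of degree less
than `∑ (e i - 1)`.  When `g a` is exchanged for a linear form `l`, an element `u` of the socle
turns into the element `v` with `l * u = g a * v` modulo the remaining forms, of degree
`deg u + 1 - e a`. -/
theorem OnlyTrivialZero.mem_span_of_X_mul_mem {g : ι → MvPolynomial ι k} {e : ι → ℕ}
    (he : ∀ i, 0 < e i) (hg : ∀ i, (g i).IsHomogeneous (e i)) (hz : OnlyTrivialZero g)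
    {u : MvPolynomial ι k} {n : ℕ} (hu : u.IsHomogeneous n) (hn : n + Fintype.card ι < ∑ i, e i)
    (hX : ∀ j, X j * u ∈ Ideal.span (Set.range g)) : u ∈ Ideal.span (Set.range g) := by
  have key : ∀ T : Finset ι, ∀ (g : ι → MvPolynomial ι k) (e : ι → ℕ), (∀ i, 0 < e i) →
      (∀ i, (g i).IsHomogeneous (e i)) → OnlyTrivialZero g → (∀ i ∉ T, e i = 1) →
      ∀ (u : MvPolynomial ι k) (n : ℕ), u.IsHomogeneous n → n + Fintype.card ι < ∑ i, e i →
      (∀ j, X j * u ∈ Ideal.span (Set.range g)) → u ∈ Ideal.span (Set.range g) := by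
    intro T
    induction T using Finset.induction_on with
    | empty =>
      intro g e _ _ _ hT u n _ hn
      simp only [hT _ (Finset.notMem_empty _), Finset.sum_const, Finset.card_univ, smul_eq_mul,
        mul_one] at hn
      omega
    | insert a T ha ih =>
      intro g e he hg hz hT u n hu hn hX
      obtain ⟨l, hl, hlz⟩ := hz.exists_update he hg a
      have he' : ∀ i, 0 < Function.update e a 1 i := by
        intro i
        by_cases hi : i = a
        · subst hi; simp
        · simpa [Function.update_of_ne hi] using he i
      set I := Ideal.span (g '' (Finset.univ.erase a : Finset ι)) with hI
      have hga : NonZeroDivMod I (g a) := hz.nonZeroDivMod he hg a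
      have hla : NonZeroDivMod I l := by
        have := hlz.nonZeroDivMod he' (IsHomogeneous.update hg a hl) a
        rwa [image_update_of_notMem g l (Finset.notMem_erase _ _), Function.update_self] at this
      have hrange : ∀ x, x ∈ Ideal.span (Set.range g) ↔ ∃ c, ∃ z ∈ I, x = c * g a + z := by
        intro x
        rw [range_eq_insert_image_erase g a, Ideal.mem_span_insert]
      have hrange' : ∀ x, x ∈ Ideal.span (Set.range (Function.update g a l)) ↔
          ∃ c, ∃ z ∈ I, x = c * l + z := by
        intro x
        rw [range_eq_insert_image_erase _ a, Ideal.mem_span_insert, Function.update_self,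
          image_update_of_notMem g l (Finset.notMem_erase _ _)]
      have hlu : l * u ∈ Ideal.span (Set.range g) := by
        have h : l ∈ homogeneousSubmodule ι k 1 := hl
        rw [homogeneousSubmodule_one_eq_span_X] at h
        obtain ⟨c, rfl⟩ := (Submodule.mem_span_range_iff_exists_fun k).1 h
        rw [Finset.sum_mul]
        refine sum_mem fun j _ => ?_
        rw [smul_eq_C_mul, mul_assoc]
        exact Ideal.mul_mem_left _ _ (hX j)
      obtain ⟨b, hb, hb0, hlub⟩ := exists_isHomogeneous_coeff hg (hl.mul hu) hlu
      have hlub' : l * u - b a * g a ∈ I := by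
        rw [hlub, ← Finset.add_sum_erase _ _ (Finset.mem_univ a), add_sub_cancel_left]
        exact sum_mem fun i hi => Ideal.mul_mem_left _ _ (Ideal.subset_span ⟨i, hi, rfl⟩)
      by_cases hna : 1 + n < e a
      · rw [hb0 a hna, zero_mul, sub_zero] at hlub'
        exact (hrange u).2 ⟨0, u, hla _ hlub', by ring⟩
      · have hv : b a ∈ Ideal.span (Set.range (Function.update g a l)) := by
          refine ih (Function.update g a l) (Function.update e a 1) he'
            (IsHomogeneous.update hg a hl) hlz (fun i hi => ?_) (b a) (1 + n - e a) (hb a) ?_ ?_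
          · by_cases hia : i = a
            · subst hia; simp
            · rw [Function.update_of_ne hia]
              exact hT i (by simp [hia, hi])
          · rw [Finset.sum_update_of_mem (Finset.mem_univ a)]
            rw [← Finset.add_sum_erase _ _ (Finset.mem_univ a), Finset.erase_eq] at hn
            have := he a
            omega
          · intro j
            obtain ⟨y, z, hz', hy⟩ := (hrange _).1 (hX j)
            refine (hrange' _).2 ⟨y, X j * b a - y * l, hga _ ?_, by ring⟩
            rw [show g a * (X j * b a - y * l) = l * z - X j * (l * u - b a * g a) by
              linear_combination l * hy]
            exact sub_mem (Ideal.mul_mem_left _ _ hz') (Ideal.mul_mem_left _ _ hlub')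
        obtain ⟨y, z, hz', hy⟩ := (hrange' _).1 hv
        refine (hrange u).2 ⟨y, u - y * g a, hla _ ?_, by ring⟩
        rw [show l * (u - y * g a) = (l * u - b a * g a) + g a * z by rw [hy]; ring]
        exact add_mem hlub' (Ideal.mul_mem_left _ _ hz')
  exact key Finset.univ g e he hg hz (fun i hi => absurd (Finset.mem_univ i) hi) u n hu hn hX

/-- Iteration of `OnlyTrivialZero.mem_span_of_X_mul_mem`. -/
theorem OnlyTrivialZero.mem_span_of_forall_mul_mem {g : ι → MvPolynomial ι k} {e : ι → ℕ}
    (he : ∀ i, 0 < e i) (hg : ∀ i, (g i).IsHomogeneous (e i)) (hz : OnlyTrivialZero g) (m : ℕ) :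
    ∀ {u : MvPolynomial ι k} {n : ℕ}, u.IsHomogeneous n →
    n + m + Fintype.card ι ≤ ∑ i, e i →
    (∀ x : MvPolynomial ι k, x.IsHomogeneous m → u * x ∈ Ideal.span (Set.range g)) →
    u ∈ Ideal.span (Set.range g) := by
  induction m with
  | zero =>
    intro u n _ _ h
    simpa using h 1 (isHomogeneous_one _ _)
  | succ m ih =>
    intro u n hu hn h
    refine hz.mem_span_of_X_mul_mem he hg hu (by omega) fun j => ?_
    refine ih (n := 1 + n) ((isHomogeneous_X k j).mul hu) (by omega) fun x hx => ?_
    rw [show X j * u * x = u * (x * X j) by ring]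
    exact h _ (hx.mul (isHomogeneous_X k j))

end Nullstellensatz

/-! ### Transversality -/

/-- The generators `∂F/∂z₀, z₁ ∂F/∂z₁, z₂ ∂F/∂z₂, z₃ ∂F/∂z₃` of `J_F`. -/
def logGrad (F : Poly) : Fin 4 → Poly :=
  Fin.cons (pderiv 0 F) fun j : Fin 3 => X j.succ * pderiv j.succ F

@[simp] lemma logGrad_zero (F : Poly) : logGrad F 0 = pderiv 0 F := rfl

@[simp] lemma logGrad_succ (F : Poly) (j : Fin 3) :
    logGrad F j.succ = X j.succ * pderiv j.succ F := rfl

lemma jacIdeal_eq_span_range (F : Poly) : jacIdeal F = Ideal.span (Set.range (logGrad F)) := by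
  rw [logGrad, Fin.range_cons, jacIdeal]

/-- By Euler's formula, transversality says that the generators of `J_F` have no common zero in
projective space. -/
lemma isTransverse_iff {F : Poly} {d : ℕ} (hd : 0 < d) (hF : F.IsHomogeneous d) :
    IsTransverse F ↔ OnlyTrivialZero (logGrad F) := by
  have hspan : ∀ z : Fin 4 → ℂ, gradient F z ∈ Submodule.span ℂ (Set.range
      (fun j : {j : Fin 3 // z j.succ = 0} => (Pi.single j.1.succ 1 : Fin 4 → ℂ))) ↔
      ∀ i, eval z (logGrad F i) = 0 := by
    intro z
    constructor
    · intro h i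
      have h2 : ∀ v ∈ Submodule.span ℂ (Set.range
          (fun j : {j : Fin 3 // z j.succ = 0} => (Pi.single j.1.succ 1 : Fin 4 → ℂ))),
          v 0 = 0 ∧ ∀ j : Fin 3, z j.succ * v j.succ = 0 := by
        intro v hv
        induction hv using Submodule.span_induction with
        | mem x hx =>
          obtain ⟨j, rfl⟩ := hx
          refine ⟨by simp [(Fin.succ_ne_zero j.1).symm], fun l => ?_⟩
          by_cases hl : l = j.1
          · simp [hl, j.2]
          · simp [hl]
        | zero => simp
        | add x y _ _ hx hy =>
          refine ⟨by simp [hx.1, hy.1], fun l => ?_⟩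
          rw [Pi.add_apply, mul_add, hx.2 l, hy.2 l, add_zero]
        | smul a x _ hx =>
          refine ⟨by simp [hx.1], fun l => ?_⟩
          rw [Pi.smul_apply, smul_eq_mul, mul_left_comm, hx.2 l, mul_zero]
      obtain ⟨h0, hj⟩ := h2 _ h
      refine Fin.cases h0 (fun j => ?_) i
      simpa [gradient] using hj j
    · intro h
      have h0 : gradient F z 0 = 0 := h 0
      have hsum : gradient F z = ∑ i, gradient F z i • (Pi.single i 1 : Fin 4 → ℂ) := by
        ext i
        simp [Finset.sum_apply, Pi.single_apply]
      rw [hsum, Fin.sum_univ_succ, h0, zero_smul, zero_add]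
      refine sum_mem fun j _ => ?_
      by_cases hj : z j.succ = 0
      · exact Submodule.smul_mem _ _ (Submodule.subset_span ⟨⟨j, hj⟩, rfl⟩)
      · have := h j.succ
        rw [logGrad_succ, map_mul, eval_X] at this
        have h1 : gradient F z j.succ = 0 := (mul_eq_zero.1 this).resolve_left hj
        rw [h1, zero_smul]
        exact zero_mem _
  constructor
  · intro h z hz
    by_contra hz0
    have hFz : eval z F = 0 := by
      have := congrArg (eval z) hF.sum_X_mul_pderiv
      rw [map_sum, Fin.sum_univ_succ] at this
      have h0 : eval z (X 0 * pderiv 0 F) = 0 := by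
        rw [map_mul, show eval z (pderiv 0 F) = 0 from hz 0, mul_zero]
      have hs : ∀ j : Fin 3, eval z (X j.succ * pderiv j.succ F) = 0 := fun j => hz j.succ
      simp only [h0, hs, Finset.sum_const_zero, add_zero] at this
      rw [nsmul_eq_mul, map_mul, map_natCast] at this
      exact (mul_eq_zero.1 this.symm).resolve_left (by exact_mod_cast hd.ne')
    exact (linearIndependent_option.1 (h z hz0 hFz)).2 ((hspan z).2 hz)
  · intro h z hz0 _
    refine linearIndependent_option.2 ⟨?_, fun hmem => hz0 (h z ((hspan z).1 hmem))⟩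
    have key : LinearIndependent ℂ
        (fun j : {j : Fin 3 // z j.succ = 0} => (Pi.single j.1.succ 1 : Fin 4 → ℂ)) := by
      have := (Pi.basisFun ℂ (Fin 4)).linearIndependent.comp
        (fun j : {j : Fin 3 // z j.succ = 0} => j.1.succ)
        (fun a b hab => Subtype.ext (Fin.succ_injective _ hab))
      simpa [Function.comp_def] using this
    exact key

/-! ### The binomial product -/

/-- The coefficients of `∏ (x - c_ν y)`, a form in `x` and `y`. -/
def binCoeff {r : ℕ} (c : Fin r → ℂ) (k : ℕ) : ℂ :=
  ∑ S ∈ (Finset.univ : Finset (Fin r)).powersetCard k, ∏ ν ∈ Finset.univ \ S, -c ν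

/-- The exponent of `(z_{σ(1)}^{p+q})^k (z_{σ(2)}^p z_{σ(3)}^q)^{r-k}`. -/
def binExp (σ : Equiv.Perm (Fin 3)) (p q r k : ℕ) : Fin 4 →₀ ℕ :=
  Finsupp.single (σ 0).succ ((p + q) * k) + Finsupp.single (σ 1).succ (p * (r - k)) +
    Finsupp.single (σ 2).succ (q * (r - k))

section BinProd

variable (σ : Equiv.Perm (Fin 3)) (p q : ℕ) {r : ℕ} (c : Fin r → ℂ)

lemma binCoeff_self : binCoeff c r = 1 := by
  have := Finset.powersetCard_self (Finset.univ : Finset (Fin r))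
  rw [Finset.card_fin] at this
  simp [binCoeff, this]

lemma binCoeff_zero : binCoeff c 0 = ∏ ν, -c ν := by
  simp [binCoeff]

lemma binProd_eq_sum (t s : ℂ) :
    binProd σ p q (s • c) t = ∑ k ∈ Finset.range (r + 1),
      monomial (binExp σ p q r k) (binCoeff c k * t ^ k * s ^ (r - k)) := by
  unfold binProd
  simp_rw [sub_eq_add_neg]
  rw [Finset.prod_add, Finset.sum_powerset, Finset.card_univ, Fintype.card_fin]
  refine Finset.sum_congr rfl fun k hk => ?_
  rw [binCoeff, Finset.sum_mul, Finset.sum_mul, map_sum]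
  refine Finset.sum_congr rfl fun S hS => ?_
  obtain ⟨-, hcard⟩ := Finset.mem_powersetCard.1 hS
  have h1 : ∀ ν : Fin r, -(C ((s • c) ν) * (X (σ 1).succ ^ p * X (σ 2).succ ^ q) : Poly) =
      C (-c ν) * (C s * (X (σ 1).succ ^ p * X (σ 2).succ ^ q)) := by
    intro ν
    simp only [Pi.smul_apply, smul_eq_mul, map_mul, map_neg]
    ring
  simp_rw [h1]
  rw [Finset.prod_const, Finset.prod_mul_distrib, Finset.prod_const, hcard,
    Finset.card_sdiff_of_subset (Finset.subset_univ S), hcard, Finset.card_univ, Fintype.card_fin,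
    ← map_prod]
  have h2 : (monomial (binExp σ p q r k) 1 : Poly) =
      (X (σ 0).succ ^ (p + q)) ^ k * (X (σ 1).succ ^ p * X (σ 2).succ ^ q) ^ (r - k) := by
    rw [binExp, ← one_mul (1 : ℂ), ← monomial_mul, ← one_mul (1 : ℂ), ← monomial_mul]
    simp only [← X_pow_eq_monomial, mul_one]
    ring
  rw [← mul_one (_ * t ^ k * s ^ (r - k)), ← C_mul_monomial, h2]
  simp only [map_mul, map_pow]
  ring

variable {σ p q}

lemma binExp_apply_zero (k : ℕ) : binExp σ p q r k 0 = 0 := by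
  simp [binExp, Fin.succ_ne_zero]

lemma binExp_apply_sigma_zero (k : ℕ) : binExp σ p q r k (σ 0).succ = (p + q) * k := by
  simp [binExp]

lemma binExp_apply_sigma_one (k : ℕ) : binExp σ p q r k (σ 1).succ = p * (r - k) := by
  simp [binExp]

lemma binExp_apply_sigma_two (k : ℕ) : binExp σ p q r k (σ 2).succ = q * (r - k) := by
  simp [binExp]

lemma degree_binExp {k : ℕ} (hk : k ≤ r) : (binExp σ p q r k).degree = r * (p + q) := by
  rw [binExp, map_add, map_add, Finsupp.degree_single, Finsupp.degree_single,
    Finsupp.degree_single]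
  obtain ⟨l, rfl⟩ := Nat.exists_eq_add_of_le hk
  rw [Nat.add_sub_cancel_left]
  ring

lemma isHomogeneous_binProd (t : ℂ) : (binProd σ p q c t).IsHomogeneous (r * (p + q)) := by
  have := binProd_eq_sum σ p q c t 1
  rw [one_smul] at this
  rw [this]
  exact IsHomogeneous.sum _ _ _ fun k hk => isHomogeneous_monomial _
    (degree_binExp (by simpa [Nat.lt_succ_iff] using hk))

lemma X_mul_pderiv_binProd (i : Fin 4) (t s : ℂ) :
    X i * pderiv i (binProd σ p q (s • c) t) = ∑ k ∈ Finset.range (r + 1),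
      monomial (binExp σ p q r k)
        ((binExp σ p q r k i : ℂ) * (binCoeff c k * t ^ k * s ^ (r - k))) := by
  rw [binProd_eq_sum, map_sum, Finset.mul_sum]
  refine Finset.sum_congr rfl fun k _ => ?_
  rw [X_mul_pderiv_monomial, ← map_nsmul, nsmul_eq_mul]

lemma pderiv_zero_binProd (t : ℂ) : pderiv 0 (binProd σ p q c t) = 0 := by
  have := X_mul_pderiv_binProd (σ := σ) (p := p) (q := q) c 0 t 1
  simp only [binExp_apply_zero, Nat.cast_zero, zero_mul, map_zero, Finset.sum_const_zero,
    one_smul] at this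
  exact (mul_eq_zero.1 this).resolve_left (X_ne_zero 0)

lemma theta_binProd (t : ℂ) : theta σ p q (binProd σ p q c t) = 0 := by
  have h1 := X_mul_pderiv_binProd (σ := σ) (p := p) (q := q) c (σ 1).succ t 1
  have h2 := X_mul_pderiv_binProd (σ := σ) (p := p) (q := q) c (σ 2).succ t 1
  rw [one_smul] at h1 h2
  rw [theta, h1, h2, Finset.mul_sum, Finset.mul_sum, ← Finset.sum_sub_distrib]
  refine Finset.sum_eq_zero fun k _ => ?_
  rw [← map_natCast C q, ← map_natCast C p, C_mul_monomial, C_mul_monomial, ← map_sub,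
    binExp_apply_sigma_one, binExp_apply_sigma_two]
  push_cast
  ring_nf
  simp

end BinProd

/-! ### The ideal `J_F` of a surface in the locus -/

lemma linear_eq_sum {w : Poly} (hw : w.IsHomogeneous 1) :
    w = ∑ j, C (eval (Pi.single j 1) w) * X j := by
  have h : w ∈ homogeneousSubmodule (Fin 4) ℂ 1 := hw
  rw [homogeneousSubmodule_one_eq_span_X] at h
  obtain ⟨c, rfl⟩ := (Submodule.mem_span_range_iff_exists_fun ℂ).1 h
  refine Finset.sum_congr rfl fun j _ => ?_
  simp [smul_eq_C_mul, Pi.single_apply]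

lemma pderiv_linear {w : Poly} (hw : w.IsHomogeneous 1) (i : Fin 4) :
    pderiv i w = C (eval (Pi.single i 1) w) := by
  conv_lhs => rw [linear_eq_sum hw, map_sum]
  rw [Finset.sum_eq_single i]
  · simp
  · intro j _ hj
    simp [Pi.single_eq_of_ne hj]
  · simp

lemma eval_linear {w : Poly} (hw : w.IsHomogeneous 1) (z : Fin 4 → ℂ) :
    eval z w = ∑ j, eval (Pi.single j 1) w * z j := by
  conv_lhs => rw [linear_eq_sum hw]
  simp

/-- The derivation `p z_{σ(2)} ∂/∂z_{σ(2)} + q z_{σ(3)} ∂/∂z_{σ(3)}`, complementary to `theta`,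
applied to `G`. -/
def thetaCompl (σ : Equiv.Perm (Fin 3)) (p q : ℕ) (G : Poly) : Poly :=
  (p : Poly) * (X (σ 1).succ * pderiv (σ 1).succ G)
    + (q : Poly) * (X (σ 2).succ * pderiv (σ 2).succ G)

/-- The hypotheses on a transverse surface `F = w A + ∏ (⋯)` of degree `d`. -/
structure IsTransverseEquation (σ : Equiv.Perm (Fin 3)) (p q : ℕ) {r : ℕ} (c : Fin r → ℂ) (d : ℕ)
    (F w A : Poly) (t : ℂ) : Prop where
  two_le : 2 ≤ d
  coprime : Nat.Coprime p q
  degree_eq : d = r * (p + q)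
  hF : F.IsHomogeneous d
  hw : w.IsHomogeneous 1
  hA : A.IsHomogeneous (d - 1)
  ht : t ≠ 0
  transverse : OnlyTrivialZero (logGrad F)
  equation : F = w * A + binProd σ p q c t

namespace IsTransverseEquation

variable {σ : Equiv.Perm (Fin 3)} {p q r d : ℕ} {c : Fin r → ℂ} {F w A : Poly} {t : ℂ}

lemma pderiv_zero_eq (h : IsTransverseEquation σ p q c d F w A t) :
    pderiv 0 F = w * pderiv 0 A + C (eval (Pi.single 0 1) w) * A := by
  rw [h.equation, map_add, pderiv_zero_binProd, Derivation.leibniz, pderiv_linear h.hw,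
    smul_eq_mul, smul_eq_mul, add_zero, mul_comm A]

/-- The plane `w = 0` does not pass through the point `[1 : 0 : 0 : 0]`. -/
lemma eval_ne_zero (h : IsTransverseEquation σ p q c d F w A t) :
    eval (Pi.single 0 1) w ≠ 0 := by
  intro hw0
  have : (Pi.single 0 1 : Fin 4 → ℂ) = 0 := by
    refine h.transverse _ fun i => ?_
    refine Fin.cases ?_ (fun j => ?_) i
    · rw [logGrad_zero, h.pderiv_zero_eq, map_add, map_mul, map_mul, hw0]
      simp
    · rw [logGrad_succ, map_mul, eval_X, Pi.single_eq_of_ne (Fin.succ_ne_zero j), zero_mul]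
  simpa using congrFun this 0

lemma sq_add_sq_ne_zero (h : IsTransverseEquation σ p q c d F w A t) :
    (p : ℂ) ^ 2 + (q : ℂ) ^ 2 ≠ 0 := by
  have : 0 < p ^ 2 + q ^ 2 := by
    rcases Nat.eq_zero_or_pos p with rfl | hp
    · have : q = 1 := by simpa using h.coprime
      simp [this]
    · positivity
  exact_mod_cast this.ne'

lemma theta_eq (h : IsTransverseEquation σ p q c d F w A t) :
    theta σ p q F = w * theta σ p q A + A * theta σ p q w := by
  have h1 : theta σ p q (w * A) = w * theta σ p q A + A * theta σ p q w := by
    simp only [theta, Derivation.leibniz, smul_eq_mul]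
    ring
  have h2 : theta σ p q F = theta σ p q (w * A) + theta σ p q (binProd σ p q c t) := by
    rw [h.equation]
    simp only [theta, map_add]
    ring
  rw [h2, h1, theta_binProd, add_zero]

/-- `θ F` agrees with `w ξ_F` up to a multiple of `∂F/∂z₀` and a nonzero constant. -/
lemma mul_theta_eq (h : IsTransverseEquation σ p q c d F w A t) :
    C (eval (Pi.single 0 1) w) * theta σ p q F =
      theta σ p q w * pderiv 0 F + w * xiF σ p q w A := by
  rw [h.theta_eq, h.pderiv_zero_eq, xiF, pderiv_linear h.hw]
  ring

/-- The system of parameters consisting of `x`, `∂F/∂z₀`, `z_{σ(1)} ∂F/∂z_{σ(1)}` and `thetaCompl F`.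
It generates `J_F` when `x = w ξ_F`. -/
def params (σ : Equiv.Perm (Fin 3)) (p q : ℕ) (F x : Poly) : Fin 4 → Poly :=
  ![x, pderiv 0 F, X (σ 0).succ * pderiv (σ 0).succ F, thetaCompl σ p q F]

/-- The ideal generated by the last three entries of `params`. -/
def baseIdeal (σ : Equiv.Perm (Fin 3)) (p q : ℕ) (F : Poly) : Ideal Poly :=
  Ideal.span {pderiv 0 F, X (σ 0).succ * pderiv (σ 0).succ F, thetaCompl σ p q F}

lemma range_params (σ : Equiv.Perm (Fin 3)) (p q : ℕ) (F x : Poly) :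
    Set.range (params σ p q F x) =
      {x, pderiv 0 F, X (σ 0).succ * pderiv (σ 0).succ F, thetaCompl σ p q F} := by
  rw [params, Matrix.range_cons, Matrix.range_cons, Matrix.range_cons, Matrix.range_cons,
    Matrix.range_empty, Set.union_empty]
  rfl

lemma mem_span_params_iff {x y : Poly} :
    y ∈ Ideal.span (Set.range (params σ p q F x)) ↔ ∃ a, ∃ z ∈ baseIdeal σ p q F, y = a * x + z := by
  rw [range_params, Ideal.mem_span_insert, baseIdeal]

lemma mem_jacIdeal_of_eq {y : Poly} {i : Fin 4} (hi : logGrad F i = y) : y ∈ jacIdeal F := by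
  rw [jacIdeal_eq_span_range, ← hi]
  exact Ideal.subset_span ⟨i, rfl⟩

lemma X_mul_pderiv_mem_jacIdeal (F : Poly) (j : Fin 3) :
    X j.succ * pderiv j.succ F ∈ jacIdeal F := mem_jacIdeal_of_eq (i := j.succ) rfl

lemma pderiv_zero_mem_jacIdeal (F : Poly) : pderiv 0 F ∈ jacIdeal F :=
  mem_jacIdeal_of_eq (i := 0) rfl

lemma theta_mem_jacIdeal : theta σ p q F ∈ jacIdeal F :=
  sub_mem (Ideal.mul_mem_left _ _ (X_mul_pderiv_mem_jacIdeal F _))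
    (Ideal.mul_mem_left _ _ (X_mul_pderiv_mem_jacIdeal F _))

lemma thetaCompl_mem_jacIdeal : thetaCompl σ p q F ∈ jacIdeal F :=
  add_mem (Ideal.mul_mem_left _ _ (X_mul_pderiv_mem_jacIdeal F _))
    (Ideal.mul_mem_left _ _ (X_mul_pderiv_mem_jacIdeal F _))

lemma baseIdeal_le_jacIdeal : baseIdeal σ p q F ≤ jacIdeal F := by
  rw [baseIdeal, Ideal.span_le]
  rintro _ (rfl | rfl | rfl)
  · exact pderiv_zero_mem_jacIdeal F
  · exact X_mul_pderiv_mem_jacIdeal F _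
  · exact thetaCompl_mem_jacIdeal

lemma C_mul_mem_iff {I : Ideal Poly} {a : ℂ} (ha : a ≠ 0) {y : Poly} : C a * y ∈ I ↔ y ∈ I := by
  refine ⟨fun h => ?_, Ideal.mul_mem_left _ _⟩
  have := Ideal.mul_mem_left I (C a⁻¹) h
  rwa [← mul_assoc, ← C_mul, inv_mul_cancel₀ ha, C_1, one_mul] at this

/-- `J_F` is generated by `w ξ_F` and three further elements. -/
lemma jacIdeal_eq (h : IsTransverseEquation σ p q c d F w A t) :
    jacIdeal F = Ideal.span (Set.range (params σ p q F (w * xiF σ p q w A))) := by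
  apply le_antisymm
  · set I := Ideal.span (Set.range (params σ p q F (w * xiF σ p q w A))) with hI
    have hx : w * xiF σ p q w A ∈ I := Ideal.subset_span ⟨0, rfl⟩
    have h0 : pderiv 0 F ∈ I := Ideal.subset_span ⟨1, rfl⟩
    have h1 : X (σ 0).succ * pderiv (σ 0).succ F ∈ I := Ideal.subset_span ⟨2, rfl⟩
    have hc : thetaCompl σ p q F ∈ I := Ideal.subset_span ⟨3, rfl⟩
    have hθ : theta σ p q F ∈ I := by
      rw [← C_mul_mem_iff h.eval_ne_zero, h.mul_theta_eq]
      exact add_mem (Ideal.mul_mem_left _ _ h0) hx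
    have h2 : X (σ 1).succ * pderiv (σ 1).succ F ∈ I := by
      rw [← C_mul_mem_iff h.sq_add_sq_ne_zero]
      have : C ((p : ℂ) ^ 2 + (q : ℂ) ^ 2) * (X (σ 1).succ * pderiv (σ 1).succ F) =
          (q : Poly) * theta σ p q F + (p : Poly) * thetaCompl σ p q F := by
        simp only [theta, thetaCompl, map_add, map_pow, map_natCast]
        ring
      rw [this]
      exact add_mem (Ideal.mul_mem_left _ _ hθ) (Ideal.mul_mem_left _ _ hc)
    have h3 : X (σ 2).succ * pderiv (σ 2).succ F ∈ I := by
      rw [← C_mul_mem_iff h.sq_add_sq_ne_zero]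
      have : C ((p : ℂ) ^ 2 + (q : ℂ) ^ 2) * (X (σ 2).succ * pderiv (σ 2).succ F) =
          (q : Poly) * thetaCompl σ p q F - (p : Poly) * theta σ p q F := by
        simp only [theta, thetaCompl, map_add, map_pow, map_natCast]
        ring
      rw [this]
      exact sub_mem (Ideal.mul_mem_left _ _ hc) (Ideal.mul_mem_left _ _ hθ)
    rw [jacIdeal, Ideal.span_le, Set.insert_subset_iff]
    refine ⟨h0, ?_⟩
    rintro _ ⟨j, rfl⟩
    obtain ⟨i, rfl⟩ := σ.surjective j
    fin_cases i
    · exact h1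
    · exact h2
    · exact h3
  · intro y hy
    obtain ⟨a, z, hz, rfl⟩ := mem_span_params_iff.1 hy
    refine add_mem (Ideal.mul_mem_left _ _ ?_) (baseIdeal_le_jacIdeal hz)
    rw [show w * xiF σ p q w A = C (eval (Pi.single 0 1) w) * theta σ p q F -
      theta σ p q w * pderiv 0 F by rw [h.mul_theta_eq]; ring]
    exact sub_mem (Ideal.mul_mem_left _ _ theta_mem_jacIdeal)
      (Ideal.mul_mem_left _ _ (pderiv_zero_mem_jacIdeal F))

/-- Each factor of `w ξ_F` completes the remaining three generators of `J_F` to a system of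
parameters. -/
lemma onlyTrivialZero_params (h : IsTransverseEquation σ p q c d F w A t) {x : Poly}
    (hx : x ∣ w * xiF σ p q w A) : OnlyTrivialZero (params σ p q F x) := by
  intro z hz
  refine h.transverse z fun i => ?_
  have hle : jacIdeal F ≤ RingHom.ker (eval z) := by
    rw [h.jacIdeal_eq, Ideal.span_le]
    rintro _ ⟨j, rfl⟩
    obtain ⟨y, hy⟩ := hx
    have h0 : eval z x = 0 := hz 0
    fin_cases j
    · change eval z (w * xiF σ p q w A) = 0
      rw [hy, map_mul, h0, zero_mul]
    · exact hz 1
    · exact hz 2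
    · exact hz 3
  exact hle (mem_jacIdeal_of_eq rfl)

lemma isHomogeneous_X_mul_pderiv {G : Poly} {n : ℕ} (hn : 0 < n) (hG : G.IsHomogeneous n)
    (i : Fin 4) : (X i * pderiv i G).IsHomogeneous n := by
  have := (isHomogeneous_X ℂ i).mul (hG.pderiv (i := i))
  rwa [Nat.add_sub_cancel' hn] at this

lemma isHomogeneous_natCast_mul {G : Poly} {n : ℕ} (hG : G.IsHomogeneous n) (m : ℕ) :
    ((m : Poly) * G).IsHomogeneous n := by
  rw [← map_natCast C m]
  exact hG.C_mul _

lemma isHomogeneous_theta {G : Poly} {n : ℕ} (hn : 0 < n) (hG : G.IsHomogeneous n) :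
    (theta σ p q G).IsHomogeneous n :=
  (isHomogeneous_natCast_mul (isHomogeneous_X_mul_pderiv hn hG _) _).sub
    (isHomogeneous_natCast_mul (isHomogeneous_X_mul_pderiv hn hG _) _)

lemma isHomogeneous_thetaCompl {G : Poly} {n : ℕ} (hn : 0 < n) (hG : G.IsHomogeneous n) :
    (thetaCompl σ p q G).IsHomogeneous n :=
  (isHomogeneous_natCast_mul (isHomogeneous_X_mul_pderiv hn hG _) _).add
    (isHomogeneous_natCast_mul (isHomogeneous_X_mul_pderiv hn hG _) _)

lemma isHomogeneous_xiF (h : IsTransverseEquation σ p q c d F w A t) :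
    (xiF σ p q w A).IsHomogeneous (d - 1) := by
  have hd := h.two_le
  rw [xiF, pderiv_linear h.hw]
  refine ((isHomogeneous_theta (by omega) h.hA).C_mul _).sub ?_
  have := (h.hA.pderiv (i := 0)).mul (isHomogeneous_theta (σ := σ) (p := p) (q := q) one_pos h.hw)
  rwa [show d - 1 - 1 + 1 = d - 1 by omega] at this

lemma isHomogeneous_params (h : IsTransverseEquation σ p q c d F w A t) {x : Poly} {n : ℕ}
    (hx : x.IsHomogeneous n) (i : Fin 4) :
    (params σ p q F x i).IsHomogeneous ((![n, d - 1, d, d] : Fin 4 → ℕ) i) := by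
  have hd : 0 < d := by have := h.two_le; omega
  fin_cases i
  · exact hx
  · exact h.hF.pderiv
  · exact isHomogeneous_X_mul_pderiv hd h.hF _
  · exact isHomogeneous_thetaCompl hd h.hF

lemma degrees_pos (h : IsTransverseEquation σ p q c d F w A t) {n : ℕ} (hn : 0 < n) (i : Fin 4) :
    0 < (![n, d - 1, d, d] : Fin 4 → ℕ) i := by
  have := h.two_le
  fin_cases i <;> simp <;> omega

lemma nonZeroDivMod_baseIdeal (h : IsTransverseEquation σ p q c d F w A t) {x : Poly} {n : ℕ}
    (hn : 0 < n) (hx : x.IsHomogeneous n) (hdvd : x ∣ w * xiF σ p q w A) :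
    NonZeroDivMod (baseIdeal σ p q F) x := by
  have := (h.onlyTrivialZero_params hdvd).nonZeroDivMod (h.degrees_pos hn)
    (h.isHomogeneous_params hx) 0
  convert! this using 2
  have : ((Finset.univ.erase 0 : Finset (Fin 4)) : Set (Fin 4)) = {1, 2, 3} := by
    ext i; fin_cases i <;> simp
  rw [this, Set.image_insert_eq, Set.image_insert_eq, Set.image_singleton]
  rfl

lemma baseIdeal_ne_top (h : IsTransverseEquation σ p q c d F w A t) : baseIdeal σ p q F ≠ ⊤ := by
  have hd := h.two_le
  intro htop
  have hle : baseIdeal σ p q F ≤ RingHom.ker (eval (0 : Fin 4 → ℂ)) := by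
    rw [baseIdeal, Ideal.span_le]
    rintro _ (rfl | rfl | rfl)
    · exact eval_zero_of_isHomogeneous (by omega : 0 < d - 1) h.hF.pderiv
    · exact eval_zero_of_isHomogeneous (by omega) (isHomogeneous_X_mul_pderiv (by omega) h.hF _)
    · exact eval_zero_of_isHomogeneous (by omega) (isHomogeneous_thetaCompl (by omega) h.hF)
  have : (1 : Poly) ∈ RingHom.ker (eval (0 : Fin 4 → ℂ)) := hle (htop ▸ Submodule.mem_top)
  simp [RingHom.mem_ker] at this

lemma xiF_nonZeroDivMod (h : IsTransverseEquation σ p q c d F w A t) :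
    NonZeroDivMod (baseIdeal σ p q F) (xiF σ p q w A) :=
  h.nonZeroDivMod_baseIdeal (by have := h.two_le; omega : 0 < d - 1) h.isHomogeneous_xiF
    (dvd_mul_left _ _)

lemma plane_nonZeroDivMod (h : IsTransverseEquation σ p q c d F w A t) :
    NonZeroDivMod (baseIdeal σ p q F) w :=
  h.nonZeroDivMod_baseIdeal one_pos h.hw (dvd_mul_right _ _)

lemma mul_xiF_mem (h : IsTransverseEquation σ p q c d F w A t) :
    w * xiF σ p q w A ∈ jacIdeal F := by
  rw [h.jacIdeal_eq]
  exact Ideal.subset_span ⟨0, rfl⟩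

/-! ### The annihilator of `ξ_F` and the annihilator of `w` -/

/-- `J_F : ξ_F = (w) + J_F`. -/
lemma xiF_mul_mem_iff (h : IsTransverseEquation σ p q c d F w A t) {x : Poly} :
    xiF σ p q w A * x ∈ jacIdeal F ↔ ∃ a, x - w * a ∈ jacIdeal F := by
  constructor
  · intro hx
    rw [h.jacIdeal_eq] at hx
    obtain ⟨a, z, hz, hxz⟩ := mem_span_params_iff.1 hx
    refine ⟨a, baseIdeal_le_jacIdeal (h.xiF_nonZeroDivMod _ ?_)⟩
    rwa [show xiF σ p q w A * (x - w * a) = z by rw [mul_sub, hxz]; ring]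
  · rintro ⟨a, ha⟩
    rw [show xiF σ p q w A * x =
      xiF σ p q w A * (x - w * a) + a * (w * xiF σ p q w A) by ring]
    exact add_mem (Ideal.mul_mem_left _ _ ha) (Ideal.mul_mem_left _ _ h.mul_xiF_mem)

lemma isHomogeneous_logGrad {d : ℕ} (hd : 0 < d) (hF : F.IsHomogeneous d) (i : Fin 4) :
    ∃ n, (logGrad F i).IsHomogeneous n := by
  refine Fin.cases ⟨_, hF.pderiv⟩ (fun j => ⟨_, isHomogeneous_X_mul_pderiv hd hF _⟩) i

lemma homogeneousComponent_mem_jacIdeal {d : ℕ} (hd : 0 < d) (hF : F.IsHomogeneous d) {x : Poly}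
    (hx : x ∈ jacIdeal F) (n : ℕ) : homogeneousComponent n x ∈ jacIdeal F := by
  rw [jacIdeal_eq_span_range] at hx ⊢
  refine homogeneousComponent_mem_span ?_ hx n
  rintro _ ⟨i, rfl⟩
  exact isHomogeneous_logGrad hd hF i

/-- Membership in `w P^{d-1} + J_F^d`. -/
lemma mem_sup_iff (hd : 0 < d) {F x : Forms d} {w : Forms 1} :
    x ∈ multForms w d ⊔ jacForms F d ↔ ∃ a : Poly, (x : Poly) - w * a ∈ jacIdeal F := by
  constructor
  · intro hx
    obtain ⟨y, ⟨a, -, ha⟩, z, hz, rfl⟩ := Submodule.mem_sup.1 hx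
    refine ⟨a, ?_⟩
    have ha' : (w : Poly) * a = y := ha
    have hz' : (z : Poly) ∈ jacIdeal F := hz
    simpa [ha'] using hz'
  · rintro ⟨a, ha⟩
    have hx : (x : Poly).IsHomogeneous d := x.2
    have hw : (w : Poly).IsHomogeneous 1 := w.2
    have hF : (F : Poly).IsHomogeneous d := F.2
    have hc := homogeneousComponent_mem_jacIdeal hd hF ha d
    rw [map_sub, mul_comm, homogeneousComponent_mul_of_isHomogeneous hw, if_pos (by omega),
      homogeneousComponent_eq_self hx] at hc
    have ha1 := homogeneousComponent_isHomogeneous (d - 1) a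
    have hwa : (w * homogeneousComponent (d - 1) a : Poly).IsHomogeneous d := by
      have := hw.mul ha1
      rwa [Nat.add_sub_cancel' hd] at this
    refine Submodule.mem_sup.2 ⟨⟨_, hwa⟩, ⟨_, ha1, rfl⟩, x - ⟨_, hwa⟩, ?_, by simp⟩
    change (x : Poly) - w * homogeneousComponent (d - 1) a ∈ jacIdeal F
    rwa [mul_comm]

/-- The annihilator of `a ω_F + b ξ_F`, where `b ≠ 0`. -/
lemma annForms_eq {F : Forms d} {w : Forms 1}
    (h : IsTransverseEquation σ p q c d (F : Poly) (w : Poly) A t) {a b : ℂ} (hb : b ≠ 0) :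
    annForms F (a • omegaF F + b • xiF σ p q w A) d = multForms w d ⊔ jacForms F d := by
  ext x
  rw [mem_sup_iff (by have := h.two_le; omega), ← h.xiF_mul_mem_iff]
  change (Ideal.Quotient.mk (jacIdeal F) _ : JacRing F) = 0 ↔ _
  rw [Ideal.Quotient.eq_zero_iff_mem, smul_eq_C_mul, smul_eq_C_mul, add_mul, mul_assoc, mul_assoc]
  have h0 : C a * (omegaF F * (x : Poly)) ∈ jacIdeal (F : Poly) :=
    Ideal.mul_mem_left _ _ (Ideal.mul_mem_right _ _ (pderiv_zero_mem_jacIdeal _))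
  rw [Ideal.add_mem_iff_right _ h0, C_mul_mem_iff hb]

lemma linearIndependent_omegaF_xiF (h : IsTransverseEquation σ p q c d F w A t) :
    LinearIndependent ℂ ![omegaF F, xiF σ p q w A] := by
  have hξ : xiF σ p q w A ∉ baseIdeal σ p q F := h.xiF_nonZeroDivMod.notMem h.baseIdeal_ne_top
  have hω : omegaF F ∈ baseIdeal σ p q F := Ideal.subset_span (Set.mem_insert _ _)
  have hω0 : omegaF F ≠ 0 := by
    intro h0
    have : (Pi.single 0 1 : Fin 4 → ℂ) = 0 := by
      refine h.transverse _ fun i => Fin.cases ?_ (fun j => ?_) i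
      · rw [logGrad_zero, show pderiv 0 F = 0 from h0, map_zero]
      · rw [logGrad_succ, map_mul, eval_X, Pi.single_eq_of_ne (Fin.succ_ne_zero j), zero_mul]
    simpa using congrFun this 0
  rw [LinearIndependent.pair_iff]
  intro a b hab
  have hb : b = 0 := by
    by_contra hb
    apply hξ
    rw [← C_mul_mem_iff hb, ← smul_eq_C_mul, eq_neg_of_add_eq_zero_right hab, smul_eq_C_mul]
    exact neg_mem (Ideal.mul_mem_left _ _ hω)
  rw [hb, zero_smul, add_zero] at hab
  exact ⟨(smul_eq_zero.1 hab).resolve_right hω0, hb⟩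

/-- If `λ` annihilates `w P^{d-1}` modulo `J_F` then, the socle of `R_F` being concentrated in degree
`4 d - 5`, it annihilates `w`. -/
lemma mul_plane_mem (h : IsTransverseEquation σ p q c d F w A t) {lam : Poly}
    (hlam : lam.IsHomogeneous (d - 1))
    (hann : ∀ x : Poly, x.IsHomogeneous (d - 1) → lam * (w * x) ∈ jacIdeal F) :
    lam * w ∈ jacIdeal F := by
  have hd := h.two_le
  have hwξ : (w * xiF σ p q w A).IsHomogeneous d := by
    have := h.hw.mul h.isHomogeneous_xiF
    rwa [Nat.add_sub_cancel' (by omega : 1 ≤ d)] at this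
  have hlw : (lam * w).IsHomogeneous d := by
    have := hlam.mul h.hw
    rwa [Nat.sub_add_cancel (by omega : 1 ≤ d)] at this
  rw [h.jacIdeal_eq] at hann ⊢
  refine (h.onlyTrivialZero_params dvd_rfl).mem_span_of_forall_mul_mem
    (h.degrees_pos (by omega : 0 < d)) (h.isHomogeneous_params hwξ) (d - 1) hlw ?_ fun x hx => ?_
  · simp [Fin.sum_univ_succ]
    omega
  · rw [mul_assoc]
    exact hann x hx

/-- A form of degree `d - 1` in the ideal generated by `∂F/∂z₀` and two forms of degree `d` is a
multiple of `∂F/∂z₀`. -/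
lemma exists_eq_C_mul_of_mem_baseIdeal (h : IsTransverseEquation σ p q c d F w A t) {x : Poly}
    (hx : x.IsHomogeneous (d - 1)) (hmem : x ∈ baseIdeal σ p q F) :
    ∃ a : ℂ, x = C a * omegaF F := by
  have hd := h.two_le
  have hz : (0 : Poly).IsHomogeneous d := isHomogeneous_zero _ _ _
  have hmem' : x ∈ Ideal.span (Set.range (params σ p q F 0)) :=
    mem_span_params_iff.2 ⟨0, x, hmem, by ring⟩
  obtain ⟨b, hb, hb0, hxb⟩ := exists_isHomogeneous_coeff (h.isHomogeneous_params hz) hx hmem'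
  have h2 : b 2 = 0 := hb0 2 (by simp; omega)
  have h3 : b 3 = 0 := hb0 3 (by simp; omega)
  have h1 : (b 1).IsHomogeneous 0 := by simpa using hb 1
  obtain ⟨a, ha⟩ : ∃ a, b 1 = C a := by
    rw [← totalDegree_zero_iff_isHomogeneous, totalDegree_eq_zero_iff_eq_C] at h1
    exact ⟨_, h1⟩
  refine ⟨a, ?_⟩
  rw [hxb, Fin.sum_univ_four, h2, h3, ha]
  simp [params, omegaF]

/-- The annihilator of `w` in degree `d - 1`. -/
lemma mem_span_of_mul_plane_mem (h : IsTransverseEquation σ p q c d F w A t) {lam : Poly}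
    (hlam : lam.IsHomogeneous (d - 1)) (hmem : lam * w ∈ jacIdeal F) :
    lam ∈ Submodule.span ℂ {omegaF F, xiF σ p q w A} := by
  have hd := h.two_le
  have hwξ : (w * xiF σ p q w A).IsHomogeneous d := by
    have := h.hw.mul h.isHomogeneous_xiF
    rwa [Nat.add_sub_cancel' (by omega : 1 ≤ d)] at this
  have hlw : (lam * w).IsHomogeneous d := by
    have := hlam.mul h.hw
    rwa [Nat.sub_add_cancel (by omega : 1 ≤ d)] at this
  rw [h.jacIdeal_eq] at hmem
  obtain ⟨b, hb, -, hxb⟩ := exists_isHomogeneous_coeff (h.isHomogeneous_params hwξ) hlw hmem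
  have h0 : (b 0).IsHomogeneous 0 := by simpa using hb 0
  obtain ⟨β, hβ⟩ : ∃ β, b 0 = C β := by
    rw [← totalDegree_zero_iff_isHomogeneous, totalDegree_eq_zero_iff_eq_C] at h0
    exact ⟨_, h0⟩
  have hbase : lam - C β * xiF σ p q w A ∈ baseIdeal σ p q F := by
    apply h.plane_nonZeroDivMod
    have : w * (lam - C β * xiF σ p q w A) = b 1 * pderiv 0 F +
        b 2 * (X (σ 0).succ * pderiv (σ 0).succ F) + b 3 * thetaCompl σ p q F := by
      rw [Fin.sum_univ_four, hβ] at hxb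
      simp only [params, Matrix.cons_val] at hxb
      linear_combination hxb
    rw [this]
    refine add_mem (add_mem ?_ ?_) ?_ <;>
      exact Ideal.mul_mem_left _ _ (Ideal.subset_span (by simp))
  obtain ⟨a, ha⟩ := h.exists_eq_C_mul_of_mem_baseIdeal
    (hlam.sub (h.isHomogeneous_xiF.C_mul β)) hbase
  refine Submodule.mem_span_pair.2 ⟨a, β, ?_⟩
  rw [smul_eq_C_mul, smul_eq_C_mul, ← ha]
  ring

/-- The annihilator of `w P^{d-1} + J_F^d` in degree `d - 1`. -/
lemma span_omegaF_xiF_eq {F : Forms d} {w : Forms 1}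
    (h : IsTransverseEquation σ p q c d (F : Poly) (w : Poly) A t) :
    (Submodule.span ℂ {omegaF F, xiF σ p q w A} : Set Poly) =
      {lam | lam ∈ Forms (d - 1) ∧ ∀ x ∈ multForms w d ⊔ jacForms F d,
        (Ideal.Quotient.mk (jacIdeal F) (lam * (x : Poly)) : JacRing F) = 0} := by
  have hd := h.two_le
  ext lam
  simp only [SetLike.mem_coe, Set.mem_ofPred_eq, Ideal.Quotient.eq_zero_iff_mem]
  constructor
  · intro hlam
    obtain ⟨a, b, rfl⟩ := Submodule.mem_span_pair.1 hlam
    refine ⟨add_mem (Submodule.smul_mem _ _ h.hF.pderiv)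
      (Submodule.smul_mem _ _ h.isHomogeneous_xiF), fun x hx => ?_⟩
    rw [mem_sup_iff (by omega), ← h.xiF_mul_mem_iff] at hx
    rw [smul_eq_C_mul, smul_eq_C_mul, add_mul, mul_assoc, mul_assoc]
    exact add_mem
      (Ideal.mul_mem_left _ _ (Ideal.mul_mem_right _ _ (pderiv_zero_mem_jacIdeal _)))
      (Ideal.mul_mem_left _ _ hx)
  · rintro ⟨hlam, hann⟩
    refine h.mem_span_of_mul_plane_mem hlam (h.mul_plane_mem hlam fun x hx => ?_)
    have hwx : ((w : Poly) * x).IsHomogeneous d := by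
      have := h.hw.mul hx
      rwa [Nat.add_sub_cancel' (by omega : 1 ≤ d)] at this
    exact hann ⟨_, hwx⟩ (Submodule.mem_sup_left ⟨x, hx, rfl⟩)

end IsTransverseEquation

/-! ### Equations of an immersed analytic germ -/

/-- Let `Φ` be analytic with injective differential `D` at `e₀`.  The image of a neighbourhood of
`e₀` satisfies analytic equations whose differentials cut out the range of `D`.  If `π` is a left
inverse of `D` and `h` a local inverse of `π ∘ Φ`, then `x - Φ (h (π x))` vanishes on the image and
its differential is `1 - D ∘ π`. -/
theorem exists_analyticAt_vanishing {E X : Type*} [NormedAddCommGroup E] [NormedSpace ℂ E]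
    [FiniteDimensional ℂ E] [NormedAddCommGroup X] [NormedSpace ℂ X] [FiniteDimensional ℂ X]
    {Φ : E → X} {e₀ : E} {D : E →L[ℂ] X} (hΦ : AnalyticAt ℂ Φ e₀) (hD : HasFDerivAt Φ D e₀)
    (hinj : Function.Injective D) :
    ∃ f : X → X, AnalyticAt ℂ f (Φ e₀) ∧ (∀ᶠ e in 𝓝 e₀, f (Φ e) = 0) ∧
      ∀ g, fderiv ℂ f (Φ e₀) g = 0 → ∃ e, D e = g := by
  have : CompleteSpace E := FiniteDimensional.complete ℂ E
  have : CompleteSpace X := FiniteDimensional.complete ℂ X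
  obtain ⟨π₀, hπ₀⟩ := LinearMap.exists_leftInverse_of_injective (D : E →ₗ[ℂ] X)
    (LinearMap.ker_eq_bot.2 hinj)
  let π : X →L[ℂ] E := LinearMap.toContinuousLinearMap π₀
  have hπD : ∀ e, π (D e) = e := fun e => DFunLike.congr_fun hπ₀ e
  have hΨ : ContDiffAt ℂ ⊤ (fun e => π (Φ e)) e₀ :=
    (π.contDiff.contDiffAt).comp e₀ hΦ.contDiffAt
  have hΨ' : HasFDerivAt (fun e => π (Φ e)) ((ContinuousLinearEquiv.refl ℂ E : E ≃L[ℂ] E) :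
      E →L[ℂ] E) e₀ := by
    refine (π.hasFDerivAt.comp e₀ hD).congr_fderiv ?_
    ext e
    exact hπD e
  have hst := hΨ.hasStrictFDerivAt' hΨ' (by simp)
  let h : E → E := hst.localInverse _ _ _
  have hh : ContDiffAt ℂ ⊤ h (π (Φ e₀)) := hΨ.to_localInverse hΨ' (by simp)
  have hha : h (π (Φ e₀)) = e₀ := hst.localInverse_apply_image
  have hh' : HasFDerivAt h (ContinuousLinearMap.id ℂ E) (π (Φ e₀)) :=
    hst.to_localInverse.hasFDerivAt
  refine ⟨fun x => x - Φ (h (π x)), ?_, ?_, ?_⟩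
  · have h1 : AnalyticAt ℂ h (π (Φ e₀)) := hh.analyticAt
    have h2 : AnalyticAt ℂ (fun x => h (π x)) (Φ e₀) :=
      h1.fun_comp (π.analyticAt _)
    have h3 : AnalyticAt ℂ (fun x => Φ (h (π x))) (Φ e₀) :=
      AnalyticAt.fun_comp (by simpa only [hha] using hΦ) h2
    exact analyticAt_id.sub h3
  · filter_upwards [hst.eventually_left_inverse] with e he
    have : h (π (Φ e)) = e := he
    rw [this, sub_self]
  · intro g hg
    have h2 : HasFDerivAt (fun x => h (π x)) ((ContinuousLinearMap.id ℂ E).comp π) (Φ e₀) :=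
      hh'.comp (Φ e₀) π.hasFDerivAt
    have h3 : HasFDerivAt (fun x => Φ (h (π x))) (D.comp ((ContinuousLinearMap.id ℂ E).comp π))
        (Φ e₀) := HasFDerivAt.comp (Φ e₀) (by simpa only [hha] using hD) h2
    have h4 := (hasFDerivAt_id (Φ e₀)).sub h3
    have h5 : fderiv ℂ (fun x => x - Φ (h (π x))) (Φ e₀) g = g - D (π g) :=
      DFunLike.congr_fun h4.fderiv g
    exact ⟨π g, (sub_eq_zero.1 (h5.symm.trans hg)).symm⟩

/-! ### The topology of the space of forms -/

lemma mem_Mon_iff {l : ℕ} {m : Fin 4 →₀ ℕ} :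
    m ∈ Finset.finsuppAntidiag (Finset.univ : Finset (Fin 4)) l ↔ m.degree = l := by
  rw [Finset.mem_finsuppAntidiag, Finsupp.degree_eq_sum]
  simp

lemma form_eq_sum {l : ℕ} (H : Forms l) :
    (H : Poly) = ∑ m : Mon l, monomial m.1 (coeffs l H m) := by
  ext m
  rw [coeff_sum]
  by_cases hm : m.degree = l
  · rw [Finset.sum_eq_single (⟨m, mem_Mon_iff.2 hm⟩ : Mon l)]
    · simp [coeffs]
    · intro b _ hb
      rw [coeff_monomial, if_neg fun h => hb (Subtype.ext h)]
    · simp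
  · have hH : (H : Poly).IsHomogeneous l := H.2
    rw [hH.coeff_eq_zero hm]
    refine (Finset.sum_eq_zero fun b _ => ?_).symm
    rw [coeff_monomial, if_neg]
    rintro rfl
    exact hm (mem_Mon_iff.1 b.2)

lemma coeffs_injective (l : ℕ) : Function.Injective (coeffs l) := by
  intro H K h
  apply Subtype.ext
  rw [form_eq_sum H, form_eq_sum K, h]

lemma coeffs_surjective (l : ℕ) : Function.Surjective (coeffs l) := by
  intro a
  refine ⟨⟨∑ m : Mon l, monomial m.1 (a m), IsHomogeneous.sum _ _ _ fun m _ =>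
    isHomogeneous_monomial _ (mem_Mon_iff.1 m.2)⟩, ?_⟩
  ext m
  simp only [coeffs, LinearMap.pi_apply, LinearMap.comp_apply, Submodule.subtype_apply,
    lcoeff_apply, coeff_sum]
  rw [Finset.sum_eq_single m]
  · simp
  · intro b _ hb
    rw [coeff_monomial, if_neg fun h => hb (Subtype.ext h)]
  · simp

/-- The form of degree `l` with a given coefficient vector. -/
def toForm (l : ℕ) : (Mon l → ℂ) ≃ₗ[ℂ] Forms l :=
  (LinearEquiv.ofBijective (coeffs l) ⟨coeffs_injective l, coeffs_surjective l⟩).symm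

@[simp] lemma coeffs_toForm {l : ℕ} (a : Mon l → ℂ) : coeffs l (toForm l a) = a :=
  (toForm l).symm_apply_apply a

@[simp] lemma toForm_coeffs {l : ℕ} (H : Forms l) : toForm l (coeffs l H) = H :=
  (toForm l).apply_symm_apply H

lemma continuous_eval_toForm (l : ℕ) (L : Poly →ₗ[ℂ] Poly) :
    Continuous fun x : (Mon l → ℂ) × (Fin 4 → ℂ) => eval x.2 (L (toForm l x.1 : Poly)) := by
  have : (fun x : (Mon l → ℂ) × (Fin 4 → ℂ) => eval x.2 (L (toForm l x.1 : Poly))) =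
      fun x => ∑ m : Mon l, x.1 m * eval x.2 (L (monomial m.1 1)) := by
    ext x
    conv_lhs => rw [form_eq_sum (toForm l x.1), map_sum, map_sum, coeffs_toForm]
    refine Finset.sum_congr rfl fun m _ => ?_
    rw [← mul_one (x.1 m), ← smul_eq_mul, ← smul_monomial, map_smul, smul_eval,
      smul_eq_mul, mul_one]
  rw [this]
  refine continuous_finsetSum _ fun m _ => ?_
  exact ((continuous_apply m).comp continuous_fst).mul
    ((MvPolynomial.continuous_eval _).comp continuous_snd)

lemma continuous_eval_logGrad (l : ℕ) (i : Fin 4) :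
    Continuous fun x : (Mon l → ℂ) × (Fin 4 → ℂ) => eval x.2 (logGrad (toForm l x.1 : Poly) i) := by
  refine Fin.cases ?_ (fun j => ?_) i
  · exact continuous_eval_toForm l (pderiv 0 : Derivation ℂ Poly Poly).toLinearMap
  · simp only [logGrad_succ, map_mul, eval_X]
    exact ((continuous_apply _).comp continuous_snd).mul
      (continuous_eval_toForm l (pderiv j.succ : Derivation ℂ Poly Poly).toLinearMap)

/-- To be transverse to the three planes is an open condition. -/
lemma eventually_isTransverse {d : ℕ} (hd : 0 < d) {a₀ : Mon d → ℂ}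
    (hF : IsTransverse (toForm d a₀ : Poly)) :
    ∀ᶠ a in 𝓝 a₀, IsTransverse (toForm d a : Poly) := by
  rw [isTransverse_iff hd (toForm d a₀).2] at hF
  have key : ∀ᶠ a in 𝓝 a₀, ∀ z ∈ Metric.sphere (0 : Fin 4 → ℂ) 1,
      ∃ i, eval z (logGrad (toForm d a : Poly) i) ≠ 0 := by
    refine (isCompact_sphere 0 1).eventually_forall_of_forall_eventually fun z hz => ?_
    obtain ⟨i, hi⟩ : ∃ i, eval z (logGrad (toForm d a₀ : Poly) i) ≠ 0 := by
      by_contra! h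
      have := hF z h
      simp [this] at hz
    filter_upwards [(continuous_eval_logGrad d i).continuousAt.eventually_ne
      (x := (a₀, z)) hi] with x hx
    exact ⟨i, hx⟩
  filter_upwards [key] with a ha
  rw [isTransverse_iff hd (toForm d a).2]
  intro z hz
  by_contra hz0
  obtain ⟨i, hi⟩ := ha ((‖z‖⁻¹ : ℂ) • z) (by simp [norm_smul, hz0])
  obtain ⟨n, hn⟩ := IsTransverseEquation.isHomogeneous_logGrad hd (toForm d a).2 i
  rw [eval_smul_of_isHomogeneous hn, hz i, mul_zero] at hi
  exact hi rfl

/-! ### A parametrization of a branch of the locus -/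

/-- The coefficients of degree `l` of a polynomial. -/
def polyCoeffs (l : ℕ) : Poly →ₗ[ℂ] (Mon l → ℂ) :=
  LinearMap.pi fun m => lcoeff ℂ m.1

lemma toForm_polyCoeffs {l : ℕ} {x : Poly} (hx : x.IsHomogeneous l) :
    (toForm l (polyCoeffs l x) : Poly) = x :=
  congrArg Subtype.val (toForm_coeffs (⟨x, hx⟩ : Forms l))

lemma polyCoeffs_toForm {l : ℕ} (a : Mon l → ℂ) : polyCoeffs l (toForm l a : Poly) = a :=
  coeffs_toForm a

/-- Multiplication of linear forms and forms of degree `d - 1` in terms of coefficient vectors. -/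
def mulCoeffs (d : ℕ) : (Mon 1 → ℂ) →ₗ[ℂ] (Mon (d - 1) → ℂ) →ₗ[ℂ] (Mon d → ℂ) :=
  LinearMap.mk₂ ℂ (fun u v => polyCoeffs d ((toForm 1 u : Poly) * (toForm (d - 1) v : Poly)))
    (fun u u' v => by simp [add_mul])
    (fun a u v => by simp)
    (fun u v v' => by simp [mul_add])
    (fun a u v => by simp)

lemma mulCoeffs_apply {d : ℕ} (u : Mon 1 → ℂ) (v : Mon (d - 1) → ℂ) :
    mulCoeffs d u v = polyCoeffs d ((toForm 1 u : Poly) * (toForm (d - 1) v : Poly)) := rfl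

/-- The linear form `L₁ z₁ + L₂ z₂ + L₃ z₃`. -/
def linPoly (L : Fin 3 → ℂ) : Poly := ∑ j, C (L j) * X j.succ

lemma isHomogeneous_linPoly (L : Fin 3 → ℂ) : (linPoly L).IsHomogeneous 1 :=
  IsHomogeneous.sum _ _ _ fun _ _ => isHomogeneous_C_mul_X _ _

lemma linPoly_add (L L' : Fin 3 → ℂ) : linPoly (L + L') = linPoly L + linPoly L' := by
  simp [linPoly, add_mul, Finset.sum_add_distrib]

lemma linPoly_smul (a : ℂ) (L : Fin 3 → ℂ) : linPoly (a • L) = a • linPoly L := by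
  simp [linPoly, Finset.smul_sum, smul_eq_C_mul, mul_assoc]

/-- The coefficient vector of `linPoly L`. -/
def linCoeffs : (Fin 3 → ℂ) →ₗ[ℂ] (Mon 1 → ℂ) where
  toFun L := polyCoeffs 1 (linPoly L)
  map_add' L L' := by rw [linPoly_add, map_add]
  map_smul' a L := by rw [linPoly_smul, map_smul, RingHom.id_apply]

lemma toForm_linCoeffs (L : Fin 3 → ℂ) : (toForm 1 (linCoeffs L) : Poly) = linPoly L :=
  toForm_polyCoeffs (isHomogeneous_linPoly L)

/-- The parameters `(L, A, t, s)` of `(w + L) A + ∏ (t z_{σ(1)}^{p+q} - s c_ν z_{σ(2)}^p z_{σ(3)}^q)`,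
where `L` is a linear form in `z₁, z₂, z₃`. -/
abbrev GermParam (d : ℕ) : Type := (Fin 3 → ℂ) × (Mon (d - 1) → ℂ) × ℂ × ℂ

section Germ

variable (σ : Equiv.Perm (Fin 3)) (p q : ℕ) {r : ℕ} (c : Fin r → ℂ) (d : ℕ)

/-- The coefficient vector of `(w + L) A + ∏ (t z_{σ(1)}^{p+q} - s c_ν z_{σ(2)}^p z_{σ(3)}^q)`.  Only
`L₁ z₁ + L₂ z₂ + L₃ z₃` is added to `w`, in order to normalize the equation of the plane. -/
def germMap (w : Mon 1 → ℂ) (e : GermParam d) : Mon d → ℂ :=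
  mulCoeffs d (w + linCoeffs e.1) e.2.1 + polyCoeffs d (binProd σ p q (e.2.2.2 • c) e.2.2.1)

/-- The partial derivative of the binomial product with respect to `t`, at `s = 1`. -/
def binDerivT (t : ℂ) : Poly := ∑ k ∈ Finset.range (r + 1),
  monomial (binExp σ p q r k) (k * t ^ (k - 1) * binCoeff c k)

/-- The partial derivative of the binomial product with respect to `s`, at `s = 1`. -/
def binDerivS (t : ℂ) : Poly := ∑ k ∈ Finset.range (r + 1),
  monomial (binExp σ p q r k) ((r - k : ℕ) * t ^ k * binCoeff c k)

/-- The derivative of the parametrization in the direction `e`. -/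
def germTangent (w A : Poly) (t : ℂ) (e : GermParam d) : Poly :=
  linPoly e.1 * A + w * (toForm (d - 1) e.2.1 : Poly) + C e.2.2.1 * binDerivT σ p q c t
    + C e.2.2.2 * binDerivS σ p q c t

lemma polyCoeffs_binProd (t s : ℂ) :
    polyCoeffs d (binProd σ p q (s • c) t) = ∑ k ∈ Finset.range (r + 1),
      (t ^ k * s ^ (r - k)) • polyCoeffs d (monomial (binExp σ p q r k) (binCoeff c k)) := by
  rw [binProd_eq_sum, map_sum]
  refine Finset.sum_congr rfl fun k _ => ?_
  rw [← map_smul, smul_monomial, smul_eq_mul]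
  congr 2
  ring

lemma analyticAt_germMap (w : Mon 1 → ℂ) (e : GermParam d) :
    AnalyticAt ℂ (germMap σ p q c d w) e := by
  unfold germMap
  simp_rw [polyCoeffs_binProd]
  have h1 : AnalyticAt ℂ (fun e : GermParam d => w + linCoeffs e.1) e :=
    analyticAt_const.add (((LinearMap.toContinuousLinearMap linCoeffs).analyticAt _).fun_comp
      analyticAt_fst)
  have h2 : AnalyticAt ℂ (fun e : GermParam d => e.2.1) e := analyticAt_fst.fun_comp analyticAt_snd
  have h3 : AnalyticAt ℂ (fun e : GermParam d => e.2.2) e := analyticAt_snd.fun_comp analyticAt_snd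
  have ht : AnalyticAt ℂ (fun e : GermParam d => e.2.2.1) e := analyticAt_fst.fun_comp h3
  have hs : AnalyticAt ℂ (fun e : GermParam d => e.2.2.2) e := analyticAt_snd.fun_comp h3
  have h4 := AnalyticAt.comp₂ ((mulCoeffs d).toContinuousBilinearMap.analyticAt_bilinear
    (w + linCoeffs e.1, e.2.1)) h1 h2
  refine h4.add (Finset.analyticAt_fun_sum _ fun k _ => ?_)
  exact ((ht.pow k).mul (hs.pow (r - k))).smul analyticAt_const

lemma hasFDerivAt_germMap (w : Mon 1 → ℂ) (A : Mon (d - 1) → ℂ) (t : ℂ) :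
    ∃ D : GermParam d →L[ℂ] (Mon d → ℂ),
      HasFDerivAt (germMap σ p q c d w) D (0, A, t, 1) ∧
      ∀ e, D e = polyCoeffs d
        (germTangent σ p q c d (toForm 1 w : Poly) (toForm (d - 1) A : Poly) t e) := by
  let e₀ : GermParam d := (0, A, t, 1)
  let B := (mulCoeffs d).toContinuousBilinearMap
  have h1 : HasFDerivAt (fun e : GermParam d => w + linCoeffs e.1)
      ((LinearMap.toContinuousLinearMap linCoeffs).comp (ContinuousLinearMap.fst ℂ _ _)) e₀ :=
    ((LinearMap.toContinuousLinearMap linCoeffs).hasFDerivAt.comp e₀ hasFDerivAt_fst).const_add w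
  have h2 : HasFDerivAt (fun e : GermParam d => e.2)
      (ContinuousLinearMap.snd ℂ (Fin 3 → ℂ) ((Mon (d - 1) → ℂ) × ℂ × ℂ)) e₀ := hasFDerivAt_snd
  have h3 := h2.fst
  have ht := h2.snd.fst
  have hs := h2.snd.snd
  have h4 := B.hasFDerivAt_of_bilinear h1 h3
  have h5 := HasFDerivAt.fun_sum (u := Finset.range (r + 1)) fun k _ =>
    ((ht.pow k).mul (hs.pow (r - k))).smul_const
      (polyCoeffs d (monomial (binExp σ p q r k) (binCoeff c k)))
  refine ⟨_, (h4.add h5).congr_of_eventuallyEq (Filter.Eventually.of_forall fun e => ?_),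
    fun e => ?_⟩
  · unfold germMap
    rw [polyCoeffs_binProd]
    rfl
  · obtain ⟨L, A', a, b⟩ := e
    simp only [germTangent, map_add, add_apply, e₀, B]
    rw [sum_apply]
    have e1 : polyCoeffs d (linPoly L * (toForm (d - 1) A : Poly)) = mulCoeffs d (linCoeffs L) A := by
      rw [mulCoeffs_apply, toForm_linCoeffs]
    have e2 : polyCoeffs d ((toForm 1 w : Poly) * (toForm (d - 1) A' : Poly)) = mulCoeffs d w A' := rfl
    rw [e1, e2, add_assoc (mulCoeffs d (linCoeffs L) A + _)]
    congr 1
    · simp [add_comm]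
    · rw [← map_add, binDerivT, binDerivS, Finset.mul_sum, Finset.mul_sum,
        ← Finset.sum_add_distrib, map_sum]
      refine Finset.sum_congr rfl fun k _ => ?_
      rw [C_mul_monomial, C_mul_monomial, ← map_add,
        show a * (k * t ^ (k - 1) * binCoeff c k) + b * ((r - k : ℕ) * t ^ k * binCoeff c k) =
          (a * (k * t ^ (k - 1)) + b * ((r - k : ℕ) * t ^ k)) • binCoeff c k by
          rw [smul_eq_mul]; ring, ← smul_monomial, map_smul]
      simp
      congr 1
      ring

end Germ

namespace IsTransverseEquation

variable {σ : Equiv.Perm (Fin 3)} {p q r d : ℕ} {c : Fin r → ℂ} {F w A : Poly} {t : ℂ}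

/-! ### The image of the differential of the parametrization -/

lemma C_mul_binDerivT (c : Fin r → ℂ) (t : ℂ) :
    X (σ 0).succ * pderiv (σ 0).succ (binProd σ p q c t) =
      C ((p + q : ℕ) * t) * binDerivT σ p q c t := by
  have := X_mul_pderiv_binProd (σ := σ) (p := p) (q := q) c (σ 0).succ t 1
  rw [one_smul] at this
  rw [this, binDerivT, Finset.mul_sum]
  refine Finset.sum_congr rfl fun k _ => ?_
  rw [C_mul_monomial, binExp_apply_sigma_zero]
  congr 1
  rcases k with _ | k
  · simp
  · rw [Nat.add_sub_cancel]
    push_cast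
    ring

lemma C_mul_binDerivS_one (c : Fin r → ℂ) (t : ℂ) :
    X (σ 1).succ * pderiv (σ 1).succ (binProd σ p q c t) = C (p : ℂ) * binDerivS σ p q c t := by
  have := X_mul_pderiv_binProd (σ := σ) (p := p) (q := q) c (σ 1).succ t 1
  rw [one_smul] at this
  rw [this, binDerivS, Finset.mul_sum]
  refine Finset.sum_congr rfl fun k _ => ?_
  rw [C_mul_monomial, binExp_apply_sigma_one]
  congr 1
  push_cast
  ring

lemma C_mul_binDerivS_two (c : Fin r → ℂ) (t : ℂ) :
    X (σ 2).succ * pderiv (σ 2).succ (binProd σ p q c t) = C (q : ℂ) * binDerivS σ p q c t := by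
  have := X_mul_pderiv_binProd (σ := σ) (p := p) (q := q) c (σ 2).succ t 1
  rw [one_smul] at this
  rw [this, binDerivS, Finset.mul_sum]
  refine Finset.sum_congr rfl fun k _ => ?_
  rw [C_mul_monomial, binExp_apply_sigma_two]
  congr 1
  push_cast
  ring

lemma thetaCompl_binProd (c : Fin r → ℂ) (t : ℂ) :
    thetaCompl σ p q (binProd σ p q c t) =
      C ((p : ℂ) ^ 2 + (q : ℂ) ^ 2) * binDerivS σ p q c t := by
  rw [thetaCompl, C_mul_binDerivS_one, C_mul_binDerivS_two]
  simp only [map_add, map_pow, map_natCast]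
  ring

lemma X_mul_pderiv_eq (h : IsTransverseEquation σ p q c d F w A t) (i : Fin 4) :
    X i * pderiv i F = w * (X i * pderiv i A) + C (eval (Pi.single i 1) w) * X i * A +
      X i * pderiv i (binProd σ p q c t) := by
  have h1 : pderiv i F = pderiv i (w * A + binProd σ p q c t) := by rw [← h.equation]
  rw [h1, map_add, Derivation.leibniz, pderiv_linear h.hw, smul_eq_mul, smul_eq_mul]
  ring

lemma mul_ne_zero_coeff (h : IsTransverseEquation σ p q c d F w A t) :
    ((p + q : ℕ) : ℂ) * t ≠ 0 := by
  have hd := h.two_le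
  have hpq : p + q ≠ 0 := fun h0 => by
    have := h.degree_eq
    rw [h0, mul_zero] at this
    omega
  exact mul_ne_zero (by exact_mod_cast hpq) h.ht

lemma isHomogeneous_binDerivT (h : IsTransverseEquation σ p q c d F w A t) :
    (binDerivT σ p q c t).IsHomogeneous d :=
  IsHomogeneous.sum _ _ _ fun k hk => isHomogeneous_monomial _ (by
    rw [h.degree_eq]
    exact degree_binExp (by simpa [Nat.lt_succ_iff] using hk))

lemma isHomogeneous_binDerivS (h : IsTransverseEquation σ p q c d F w A t) :
    (binDerivS σ p q c t).IsHomogeneous d :=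
  IsHomogeneous.sum _ _ _ fun k hk => isHomogeneous_monomial _ (by
    rw [h.degree_eq]
    exact degree_binExp (by simpa [Nat.lt_succ_iff] using hk))

lemma isHomogeneous_germTangent (h : IsTransverseEquation σ p q c d F w A t) (e : GermParam d) :
    (germTangent σ p q c d w A t e).IsHomogeneous d := by
  have hd := h.two_le
  have h1 : ∀ x y : Poly, x.IsHomogeneous 1 → y.IsHomogeneous (d - 1) →
      (x * y).IsHomogeneous d := by
    intro x y hx hy
    have := hx.mul hy
    rwa [Nat.add_sub_cancel' (by omega : 1 ≤ d)] at this
  exact (((h1 _ _ (isHomogeneous_linPoly _) h.hA).add (h1 _ _ h.hw (toForm (d - 1) e.2.1).2)).add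
    (h.isHomogeneous_binDerivT.C_mul _)).add (h.isHomogeneous_binDerivS.C_mul _)

/-- Membership in the ideal `(w) + J_F`. -/
lemma mem_span_sup_iff {x : Poly} :
    x ∈ Ideal.span {w} ⊔ jacIdeal F ↔ ∃ a, x - w * a ∈ jacIdeal F := by
  rw [Ideal.mem_span_singleton_sup]
  constructor
  · rintro ⟨a, b, hb, rfl⟩
    exact ⟨a, by rwa [mul_comm w, add_sub_cancel_left]⟩
  · rintro ⟨a, ha⟩
    exact ⟨a, _, ha, by ring⟩

/-- All tangent vectors of the parametrization lie in `(w) + J_F`. -/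
lemma germTangent_mem (h : IsTransverseEquation σ p q c d F w A t) (e : GermParam d) :
    germTangent σ p q c d w A t e ∈ Ideal.span {w} ⊔ jacIdeal F := by
  set K := Ideal.span {w} ⊔ jacIdeal F with hK
  have hw : w ∈ K := Ideal.mem_sup_left (Ideal.subset_span rfl)
  have hJ : jacIdeal F ≤ K := le_sup_right
  have hA : A ∈ K := by
    rw [← C_mul_mem_iff h.eval_ne_zero]
    rw [show C (eval (Pi.single 0 1) w) * A = pderiv 0 F - pderiv 0 A * w by
      rw [h.pderiv_zero_eq]; ring]
    exact sub_mem (hJ (pderiv_zero_mem_jacIdeal F)) (Ideal.mul_mem_left _ _ hw)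
  have hE : ∀ j : Fin 3, X j.succ * pderiv j.succ (binProd σ p q c t) ∈ K := by
    intro j
    rw [show X j.succ * pderiv j.succ (binProd σ p q c t) = X j.succ * pderiv j.succ F -
        (X j.succ * pderiv j.succ A) * w - (C (eval (Pi.single j.succ 1) w) * X j.succ) * A by
      rw [h.X_mul_pderiv_eq]; ring]
    exact sub_mem (sub_mem (hJ (X_mul_pderiv_mem_jacIdeal F j)) (Ideal.mul_mem_left _ _ hw))
      (Ideal.mul_mem_left _ _ hA)
  have hT : binDerivT σ p q c t ∈ K := by
    rw [← C_mul_mem_iff h.mul_ne_zero_coeff, ← C_mul_binDerivT]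
    exact hE _
  have hS : binDerivS σ p q c t ∈ K := by
    rw [← C_mul_mem_iff h.sq_add_sq_ne_zero, ← thetaCompl_binProd]
    exact add_mem (Ideal.mul_mem_left _ _ (hE _)) (Ideal.mul_mem_left _ _ (hE _))
  exact add_mem (add_mem (add_mem (Ideal.mul_mem_left _ _ hA) (Ideal.mul_mem_right _ _ hw))
    (Ideal.mul_mem_left _ _ hT)) (Ideal.mul_mem_left _ _ hS)

lemma eval_linPoly_single_zero (L : Fin 3 → ℂ) :
    eval (Pi.single 0 1 : Fin 4 → ℂ) (linPoly L) = 0 := by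
  simp [linPoly, Fin.succ_ne_zero]

/-- A linear form vanishing at `[1 : 0 : 0 : 0]` does not involve `z₀`. -/
lemma eq_linPoly {l : Poly} (hl : l.IsHomogeneous 1)
    (h0 : eval (Pi.single 0 1 : Fin 4 → ℂ) l = 0) :
    l = linPoly fun j => eval (Pi.single j.succ 1) l := by
  conv_lhs => rw [linear_eq_sum hl, Fin.sum_univ_succ, h0, C_0, zero_mul, zero_add]
  rfl

lemma exists_add_linPoly (h : IsTransverseEquation σ p q c d F w A t) {l : Poly}
    (hl : l.IsHomogeneous 1) : ∃ (a : ℂ) (L : Fin 3 → ℂ), l = C a * w + linPoly L := by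
  set a := eval (Pi.single 0 1) l / eval (Pi.single 0 1) w
  have hL := eq_linPoly (hl.sub (h.hw.C_mul a)) (by
    rw [map_sub, map_mul, eval_C, div_mul_cancel₀ _ h.eval_ne_zero, sub_self])
  exact ⟨a, _, by rw [← hL]; ring⟩

/-- Every form of degree `d` in `(w) + J_F` is a tangent vector of the parametrization. -/
lemma exists_germTangent_eq (h : IsTransverseEquation σ p q c d F w A t) {x : Poly}
    (hx : x.IsHomogeneous d) (hmem : x ∈ Ideal.span {w} ⊔ jacIdeal F) :
    ∃ e, germTangent σ p q c d w A t e = x := by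
  have hd := h.two_le
  let R : Submodule ℂ Poly :=
    { carrier := {y | ∃ e, germTangent σ p q c d w A t e = y}
      add_mem' := by
        rintro _ _ ⟨e, rfl⟩ ⟨e', rfl⟩
        refine ⟨e + e', ?_⟩
        simp only [germTangent, linPoly_add, Prod.fst_add, Prod.snd_add, map_add,
          Submodule.coe_add]
        ring
      zero_mem' := ⟨0, by simp [germTangent, linPoly]⟩
      smul_mem' := by
        rintro a _ ⟨e, rfl⟩
        refine ⟨a • e, ?_⟩
        simp only [germTangent, linPoly_smul, Prod.smul_fst, Prod.smul_snd, map_smul,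
          smul_eq_mul, map_mul, smul_eq_C_mul, Submodule.coe_smul]
        ring }
  have hRw : ∀ y : Poly, y.IsHomogeneous (d - 1) → w * y ∈ R := fun y hy =>
    ⟨(0, polyCoeffs (d - 1) y, 0, 0), by
      simp [germTangent, linPoly, toForm_polyCoeffs hy]⟩
  have hRL : ∀ L, linPoly L * A ∈ R := fun L => ⟨(L, 0, 0, 0), by simp [germTangent]⟩
  have hRT : binDerivT σ p q c t ∈ R := ⟨(0, 0, 1, 0), by simp [germTangent, linPoly]⟩
  have hRS : binDerivS σ p q c t ∈ R := ⟨(0, 0, 0, 1), by simp [germTangent, linPoly]⟩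
  have hRA : ∀ l : Poly, l.IsHomogeneous 1 → l * A ∈ R := by
    intro l hl
    obtain ⟨a, L, rfl⟩ := h.exists_add_linPoly hl
    rw [add_mul, mul_assoc, ← smul_eq_C_mul]
    exact add_mem (R.smul_mem a (hRw A h.hA)) (hRL L)
  have hRC : ∀ (a : ℂ) (y : Poly), y ∈ R → C a * y ∈ R := fun a y hy => by
    rw [← smul_eq_C_mul]
    exact R.smul_mem a hy
  have hRE : ∀ j : Fin 3, X j.succ * pderiv j.succ F ∈ R := by
    intro j
    rw [h.X_mul_pderiv_eq]
    refine add_mem (add_mem (hRw _ ?_) (hRA _ (isHomogeneous_C_mul_X _ _))) ?_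
    · exact isHomogeneous_X_mul_pderiv (by omega) h.hA _
    · obtain ⟨i, rfl⟩ := σ.surjective j
      fin_cases i
      · exact (C_mul_binDerivT (σ := σ) (p := p) (q := q) c t) ▸ hRC _ _ hRT
      · exact (C_mul_binDerivS_one (σ := σ) (p := p) (q := q) c t) ▸ hRC _ _ hRS
      · exact (C_mul_binDerivS_two (σ := σ) (p := p) (q := q) c t) ▸ hRC _ _ hRS
  obtain ⟨a, ha⟩ := mem_span_sup_iff.1 hmem
  have hda : (w * homogeneousComponent (d - 1) a).IsHomogeneous d := by
    have := h.hw.mul (homogeneousComponent_isHomogeneous (d - 1) a)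
    rwa [Nat.add_sub_cancel' (by omega : 1 ≤ d)] at this
  have hz : x - w * homogeneousComponent (d - 1) a ∈ jacIdeal F := by
    have hc := homogeneousComponent_mem_jacIdeal (by omega) h.hF ha d
    rwa [map_sub, mul_comm, homogeneousComponent_mul_of_isHomogeneous h.hw, if_pos (by omega),
      homogeneousComponent_eq_self hx, mul_comm] at hc
  have hlog : ∀ i, (logGrad F i).IsHomogeneous ((Fin.cons (d - 1) fun _ => d : Fin 4 → ℕ) i) :=
    fun i => Fin.cases h.hF.pderiv (fun j => isHomogeneous_X_mul_pderiv (by omega) h.hF _) i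
  rw [jacIdeal_eq_span_range] at hz
  obtain ⟨b, hb, -, hxb⟩ := exists_isHomogeneous_coeff hlog (hx.sub hda) hz
  have hmemR : x ∈ R := by
    rw [← sub_add_cancel x (w * homogeneousComponent (d - 1) a), hxb, Fin.sum_univ_succ]
    refine add_mem (add_mem ?_ (sum_mem fun j _ => ?_))
      (hRw _ (homogeneousComponent_isHomogeneous _ _))
    · have hb0 : (b 0).IsHomogeneous 1 := by
        have := hb 0
        rwa [Fin.cons_zero, show d - (d - 1) = 1 by omega] at this
      rw [logGrad_zero, h.pderiv_zero_eq, show b 0 * (w * pderiv 0 A +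
        C (eval (Pi.single 0 1) w) * A) = w * (b 0 * pderiv 0 A) +
        C (eval (Pi.single 0 1) w) * (b 0 * A) by ring]
      refine add_mem (hRw _ ?_) (hRC _ _ (hRA _ hb0))
      have := hb0.mul (h.hA.pderiv (i := 0))
      rwa [show 1 + (d - 1 - 1) = d - 1 by omega] at this
    · have hbj : (b j.succ).IsHomogeneous 0 := by
        have := hb j.succ
        rwa [Fin.cons_succ, Nat.sub_self] at this
      obtain ⟨β, hβ⟩ : ∃ β, b j.succ = C β := by
        rw [← totalDegree_zero_iff_isHomogeneous, totalDegree_eq_zero_iff_eq_C] at hbj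
        exact ⟨_, hbj⟩
      rw [hβ]
      exact hRC _ _ (hRE j)
  exact hmemR

/-! ### Injectivity of the differential -/

lemma params_notMem (h : IsTransverseEquation σ p q c d F w A t) (i : Fin 4) :
    params σ p q F w i ∉ Ideal.span (params σ p q F w '' (Finset.univ.erase i : Finset (Fin 4))) := by
  have hhom := h.isHomogeneous_params h.hw
  have hpos := h.degrees_pos one_pos
  refine ((h.onlyTrivialZero_params (dvd_mul_right _ _)).nonZeroDivMod hpos hhom i).notMem ?_
  intro htop
  have hle : Ideal.span (params σ p q F w '' (Finset.univ.erase i : Finset (Fin 4))) ≤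
      RingHom.ker (eval (0 : Fin 4 → ℂ)) := by
    rw [Ideal.span_le]
    rintro _ ⟨j, -, rfl⟩
    exact eval_zero_of_isHomogeneous (hpos j) (hhom j)
  have : (1 : Poly) ∈ RingHom.ker (eval (0 : Fin 4 → ℂ)) := hle (htop ▸ Submodule.mem_top)
  simp [RingHom.mem_ker] at this

/-- A relation between the members of the system of parameters `params` with a constant coefficient
at one of them is impossible. -/
lemma coeff_eq_zero (h : IsTransverseEquation σ p q c d F w A t) {x : Fin 4 → Poly}
    (hx : ∑ j, x j * params σ p q F w j = 0) {i : Fin 4} {a : ℂ} (ha : x i = C a) : a = 0 := by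
  by_contra ha0
  apply h.params_notMem i
  rw [← C_mul_mem_iff ha0, ← ha]
  rw [← Finset.add_sum_erase _ _ (Finset.mem_univ i)] at hx
  rw [eq_neg_of_add_eq_zero_left hx]
  exact neg_mem (sum_mem fun j hj => Ideal.mul_mem_left _ _ (Ideal.subset_span ⟨j, hj, rfl⟩))

/-- The differential of the parametrization is injective. -/
lemma eq_zero_of_germTangent_eq_zero (h : IsTransverseEquation σ p q c d F w A t)
    {e : GermParam d} (he : germTangent σ p q c d w A t e = 0) : e = 0 := by
  obtain ⟨L, A', a, b⟩ := e
  set α := eval (Pi.single 0 1 : Fin 4 → ℂ) w with hα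
  have hα0 : α ≠ 0 := h.eval_ne_zero
  set m := ((p + q : ℕ) : ℂ) * t with hm
  set n := (p : ℂ) ^ 2 + (q : ℂ) ^ 2 with hn
  have hm0 : m ≠ 0 := h.mul_ne_zero_coeff
  have hn0 : n ≠ 0 := h.sq_add_sq_ne_zero
  -- `m n` times the relation, rewritten in terms of `F`
  have h1 := h.X_mul_pderiv_eq (σ 0).succ
  rw [C_mul_binDerivT, ← hm] at h1
  have h2 : thetaCompl σ p q F = w * thetaCompl σ p q A + thetaCompl σ p q w * A +
      C n * binDerivS σ p q c t := by
    rw [← thetaCompl_binProd, thetaCompl, h.X_mul_pderiv_eq, h.X_mul_pderiv_eq (σ 2).succ]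
    simp only [thetaCompl, pderiv_linear h.hw]
    ring
  have h0 := h.pderiv_zero_eq
  rw [← hα] at h0
  set l : Poly := linPoly L - C (a / m) * (C (eval (Pi.single (σ 0).succ 1) w) * X (σ 0).succ) -
    C (b / n) * thetaCompl σ p q w with hl
  have hlhom : l.IsHomogeneous 1 := ((isHomogeneous_linPoly L).sub
    ((isHomogeneous_C_mul_X _ _).C_mul _)).sub ((isHomogeneous_thetaCompl one_pos h.hw).C_mul _)
  have hl0 : eval (Pi.single 0 1 : Fin 4 → ℂ) l = 0 := by
    rw [hl, map_sub, map_sub, eval_linPoly_single_zero]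
    simp [thetaCompl, Fin.succ_ne_zero]
  have ham : (C a : Poly) = C (a / m) * C m := by rw [← C_mul, div_mul_cancel₀ _ hm0]
  have hbn : (C b : Poly) = C (b / n) * C n := by rw [← C_mul, div_mul_cancel₀ _ hn0]
  have hrel : w * (C α * (toForm (d - 1) A' : Poly) - l * pderiv 0 A -
        C α * C (a / m) * (X (σ 0).succ * pderiv (σ 0).succ A) -
        C α * C (b / n) * thetaCompl σ p q A) + l * pderiv 0 F +
      C (α * (a / m)) * (X (σ 0).succ * pderiv (σ 0).succ F) +
      C (α * (b / n)) * thetaCompl σ p q F = 0 := by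
    simp only [germTangent] at he
    rw [ham, hbn] at he
    have e1 : (C (α * (a / m)) : Poly) = C α * C (a / m) := C_mul
    have e2 : (C (α * (b / n)) : Poly) = C α * C (b / n) := C_mul
    rw [h1, h2, h0, e1, e2, hl]
    linear_combination C α * he
  have hsum : ∑ j, (![C α * (toForm (d - 1) A' : Poly) - l * pderiv 0 A -
        C α * C (a / m) * (X (σ 0).succ * pderiv (σ 0).succ A) -
        C α * C (b / n) * thetaCompl σ p q A, l, C (α * (a / m)), C (α * (b / n))] :
        Fin 4 → Poly) j * params σ p q F w j = 0 := by
    rw [Fin.sum_univ_four]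
    simp only [params, Matrix.cons_val]
    linear_combination hrel
  have ha : a = 0 := by
    have := h.coeff_eq_zero hsum (i := 2) rfl
    simpa [hα0, hm0] using this
  have hb : b = 0 := by
    have := h.coeff_eq_zero hsum (i := 3) rfl
    simpa [hα0, hn0] using this
  have hll : l = linPoly L := by simp [hl, ha, hb]
  -- `w` divides `l`, as `∂F/∂z₀` is a non-zero-divisor modulo `w`
  have hwl : l ∈ Ideal.span {w} := by
    have := (h.onlyTrivialZero_params (dvd_mul_right _ _)).isRegularTuple (h.degrees_pos one_pos)
      (h.isHomogeneous_params h.hw) {0} 1 (by simp)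
    rw [Finset.coe_singleton, Set.image_singleton] at this
    apply this
    change pderiv 0 F * l ∈ Ideal.span {w}
    rw [ha, hb] at hrel
    simp only [zero_div, mul_zero, C_0, zero_mul, add_zero, sub_zero] at hrel
    rw [mul_comm, eq_neg_of_add_eq_zero_right hrel]
    exact neg_mem (Ideal.mul_mem_right _ _ (Ideal.subset_span rfl))
  have hl00 : l = 0 := by
    have hwl' : l ∈ Ideal.span (Set.range ![w]) := by simpa using hwl
    obtain ⟨y, hy, -, hly⟩ := exists_isHomogeneous_coeff (e := ![1])
      (fun i => by fin_cases i; exact h.hw) hlhom hwl'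
    have hy0 : (y 0).IsHomogeneous 0 := by simpa using hy 0
    rw [← totalDegree_zero_iff_isHomogeneous, totalDegree_eq_zero_iff_eq_C] at hy0
    rw [Fin.sum_univ_one, hy0] at hly
    have := hl0
    rw [hly, map_mul, eval_C] at this
    have h3 := (mul_eq_zero.1 this).resolve_right hα0
    rw [hly, h3, C_0, zero_mul]
  have hL : L = 0 := by
    ext j
    have := congrArg (eval (Pi.single j.succ 1 : Fin 4 → ℂ)) (hll.symm.trans hl00)
    simpa [linPoly, Pi.single_apply] using this
  have hA' : A' = 0 := by
    have hw0 : w ≠ 0 := by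
      intro hw0
      rw [hα, hw0, map_zero] at hα0
      exact hα0 rfl
    have : w * (toForm (d - 1) A' : Poly) = 0 := by
      simpa [germTangent, hL, ha, hb, linPoly] using he
    have h4 := (mul_eq_zero.1 this).resolve_left hw0
    have h5 : toForm (d - 1) A' = 0 := Subtype.ext h4
    exact (map_eq_zero_iff _ (toForm (d - 1)).injective).1 h5
  simp [hL, hA', ha, hb]

end IsTransverseEquation

open Filter

/-! ### Planes through the point `[1 : 0 : 0 : 0]` -/

lemma eval_pderiv_monomial_eq_zero {m : Fin 4 →₀ ℕ} {i j k : Fin 4} (hk : k ≠ i)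
    (hm : 0 < m i ∨ 2 ≤ m j) {x : Fin 4 → ℂ} (hi : x i = 0) (hj : x j = 0) (a : ℂ) :
    eval x (pderiv k (monomial m a)) = 0 := by
  rw [pderiv_monomial, eval_monomial]
  refine mul_eq_zero_of_right _ ?_
  have hz : ∀ l : Fin 4, x l = 0 → (m - Finsupp.single k 1 : Fin 4 →₀ ℕ) l ≠ 0 →
      ((m - Finsupp.single k 1 : Fin 4 →₀ ℕ).prod fun n e => x n ^ e) = 0 := fun l hl hl' =>
    Finset.prod_eq_zero (i := l) (Finsupp.mem_support_iff.2 hl')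
      (by change x l ^ _ = 0; rw [hl, zero_pow hl'])
  rcases hm with hm | hm
  · refine hz i hi ?_
    rw [Finsupp.tsub_apply, Finsupp.single_apply, if_neg hk]
    omega
  · refine hz j hj ?_
    rw [Finsupp.tsub_apply, Finsupp.single_apply]
    split_ifs <;> omega

/-- For at least two of the indices `i`, there is a `j` such that every monomial of the binomial product
involves `z_i` or is divisible by `z_j ^ 2`; then its derivatives along `z_i = 0` vanish on
`z_i = z_j = 0`. One of these indices differs from any given `k`. -/
lemma exists_binExp_pair (σ : Equiv.Perm (Fin 3)) {p q r : ℕ} (hpq : Nat.Coprime p q)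
    (hd : 2 ≤ r * (p + q)) (k : Fin 3) : ∃ i j : Fin 3, i ≠ k ∧ i ≠ j ∧
      ∀ n ≤ r, 0 < binExp σ p q r n i.succ ∨ 2 ≤ binExp σ p q r n j.succ := by
  have hpair : ∀ i₁ j₁ i₂ j₂ : Fin 3, i₁ ≠ j₁ → i₂ ≠ j₂ → i₁ ≠ i₂ →
      (∀ n ≤ r, 0 < binExp σ p q r n (σ i₁).succ ∨ 2 ≤ binExp σ p q r n (σ j₁).succ) →
      (∀ n ≤ r, 0 < binExp σ p q r n (σ i₂).succ ∨ 2 ≤ binExp σ p q r n (σ j₂).succ) →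
      ∃ i j : Fin 3, i ≠ k ∧ i ≠ j ∧
        ∀ n ≤ r, 0 < binExp σ p q r n i.succ ∨ 2 ≤ binExp σ p q r n j.succ := by
    intro i₁ j₁ i₂ j₂ h1 h2 h12 H1 H2
    by_cases hk : σ i₁ = k
    · exact ⟨σ i₂, σ j₂, fun h => h12 (σ.injective (hk.trans h.symm)),
        fun h => h2 (σ.injective h), H2⟩
    · exact ⟨σ i₁, σ j₁, hk, fun h => h1 (σ.injective h), H1⟩
  have h10 : 0 < p → ∀ n ≤ r, 0 < binExp σ p q r n (σ 1).succ ∨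
      2 ≤ binExp σ p q r n (σ 0).succ := by
    intro hp n hn
    rw [binExp_apply_sigma_one, binExp_apply_sigma_zero]
    rcases hn.lt_or_eq with hn | rfl
    · exact Or.inl (Nat.mul_pos hp (by omega))
    · exact Or.inr (by rwa [mul_comm])
  have h20 : 0 < q → ∀ n ≤ r, 0 < binExp σ p q r n (σ 2).succ ∨
      2 ≤ binExp σ p q r n (σ 0).succ := by
    intro hq n hn
    rw [binExp_apply_sigma_two, binExp_apply_sigma_zero]
    rcases hn.lt_or_eq with hn | rfl
    · exact Or.inl (Nat.mul_pos hq (by omega))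
    · exact Or.inr (by rwa [mul_comm])
  rcases Nat.eq_zero_or_pos p with rfl | hp
  · have hq : q = 1 := by simpa using hpq
    subst hq
    refine hpair 2 0 0 2 (by decide) (by decide) (by decide) (h20 one_pos) fun n hn => ?_
    rw [binExp_apply_sigma_two, binExp_apply_sigma_zero]
    omega
  · rcases Nat.eq_zero_or_pos q with rfl | hq
    · have hp1 : p = 1 := by simpa using hpq
      subst hp1
      refine hpair 1 0 0 1 (by decide) (by decide) (by decide) (h10 one_pos) fun n hn => ?_
      rw [binExp_apply_sigma_one, binExp_apply_sigma_zero]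
      omega
    · exact hpair 1 0 2 0 (by decide) (by decide) (by decide) (h10 hp) (h20 hq)

/-- A linear form vanishes at a point of norm `1` on the coordinate line spanned by the points with
indices `0` and `l + 1`. -/
lemma exists_unit_zero {w : Poly} (hw : w.IsHomogeneous 1) (l : Fin 3) :
    ∃ x : Fin 4 → ℂ, x ∈ Metric.sphere (0 : Fin 4 → ℂ) 1 ∧ (∀ m, m ≠ 0 → m ≠ l.succ → x m = 0) ∧
      eval x w = 0 := by
  obtain ⟨y, hy0, hyl, hyw⟩ : ∃ y : Fin 4 → ℂ, y ≠ 0 ∧ (∀ m, m ≠ 0 → m ≠ l.succ → y m = 0) ∧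
      eval y w = 0 := by
    by_cases h : eval (Pi.single 0 1) w = 0
    · exact ⟨Pi.single 0 1, by simp, fun m hm _ => Pi.single_eq_of_ne hm _, h⟩
    · refine ⟨Pi.single 0 (eval (Pi.single l.succ 1) w) -
        Pi.single l.succ (eval (Pi.single 0 1) w), fun h0 => ?_, fun m hm hml => ?_, ?_⟩
      · have := congrFun h0 l.succ
        simp [Fin.succ_ne_zero] at this
        exact h this
      · simp [Pi.single_eq_of_ne hm, Pi.single_eq_of_ne hml]
      · rw [eval_linear hw]
        simp [mul_sub, Finset.sum_sub_distrib, Pi.single_apply]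
        ring
  refine ⟨(‖y‖⁻¹ : ℂ) • y, by simp [norm_smul, hy0], fun m hm hml => ?_, ?_⟩
  · rw [Pi.smul_apply, hyl m hm hml, smul_zero]
  · rw [eval_smul_of_isHomogeneous hw, hyw, mul_zero]

lemma tendsto_eval_toForm {l : ℕ} (L : Poly →ₗ[ℂ] Poly) {a : ℕ → Mon l → ℂ} {a₀ : Mon l → ℂ}
    {x : ℕ → Fin 4 → ℂ} {x₀ : Fin 4 → ℂ} (ha : Tendsto a atTop (𝓝 a₀))
    (hx : Tendsto x atTop (𝓝 x₀)) :
    Tendsto (fun n => eval (x n) (L (toForm l (a n) : Poly))) atTop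
      (𝓝 (eval x₀ (L (toForm l a₀ : Poly)))) := by
  have h1 := (continuous_eval_toForm l L).tendsto (a₀, x₀)
  have h2 : Tendsto (fun n => (a n, x n)) atTop (𝓝 (a₀, x₀)) := ha.prodMk_nhds hx
  have h3 := h1.comp h2
  simp only [Function.comp_def] at h3
  exact h3

/-- A limit of planes belonging to surfaces that converge to a transverse surface does not pass
through the point `[1 : 0 : 0 : 0]`.  Otherwise there are points `x_n` of the planes on a coordinate
line at which the differentials of the surface and of the plane agree up to a multiple of `dz_i`.
In the limit this contradicts transversality. -/
lemma eval_limit_plane_ne_zero {σ : Equiv.Perm (Fin 3)} {p q r d : ℕ} (hpq : Nat.Coprime p q)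
    (hd : 2 ≤ d) (hr : d = r * (p + q)) {a : ℕ → Mon d → ℂ} {a₀ : Mon d → ℂ}
    (ha : Tendsto a atTop (𝓝 a₀)) (htr : OnlyTrivialZero (logGrad (toForm d a₀ : Poly)))
    {w : ℕ → Mon 1 → ℂ} {w₀ : Mon 1 → ℂ} (hw : Tendsto w atTop (𝓝 w₀)) (hw₀ : w₀ ≠ 0)
    {A : ℕ → Poly} {c : ℕ → Fin r → ℂ} {t : ℕ → ℂ}
    (heq : ∀ n, (toForm d (a n) : Poly) = toForm 1 (w n) * A n + binProd σ p q (c n) (t n)) :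
    eval (Pi.single 0 1) (toForm 1 w₀ : Poly) ≠ 0 := by
  intro h0
  have hlin : ∀ u : Mon 1 → ℂ, (toForm 1 u : Poly).IsHomogeneous 1 := fun u => (toForm 1 u).2
  obtain ⟨k, hk⟩ : ∃ k : Fin 3, eval (Pi.single k.succ 1) (toForm 1 w₀ : Poly) ≠ 0 := by
    by_contra! h
    apply hw₀
    have : (toForm 1 w₀ : Poly) = 0 := by
      rw [linear_eq_sum (hlin w₀), Fin.sum_univ_succ, h0]
      simp [h]
    exact (map_eq_zero_iff _ (toForm 1).injective).1 (Subtype.ext this)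
  obtain ⟨i, j, hik, hij, hexp⟩ := exists_binExp_pair σ hpq (hr ▸ hd) k
  have hthird : ∀ i j : Fin 3, ∃ l : Fin 3, l ≠ i ∧ l ≠ j := by decide
  obtain ⟨l, hli, hlj⟩ := hthird i j
  choose x hx hxl hxw using fun n => exists_unit_zero (hlin (w n)) l
  obtain ⟨x₀, hx₀, φ, hφ, hxφ⟩ := (isCompact_sphere (0 : Fin 4 → ℂ) 1).tendsto_subseq hx
  have hcoord : ∀ m, m ≠ 0 → m ≠ l.succ → x₀ m = 0 := fun m hm hml => by
    have h1 : Tendsto (fun n => x (φ n) m) atTop (𝓝 (x₀ m)) :=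
      ((continuous_apply m).tendsto x₀).comp hxφ
    refine tendsto_nhds_unique h1 ?_
    simp [hxl _ m hm hml]
  have haφ := ha.comp hφ.tendsto_atTop
  have hwφ := hw.comp hφ.tendsto_atTop
  have hw0x : eval x₀ (toForm 1 w₀ : Poly) = 0 := by
    refine tendsto_nhds_unique (tendsto_eval_toForm LinearMap.id hwφ hxφ) ?_
    simp [hxw]
  have hcoef : ∀ m : Fin 4, Tendsto (fun n => eval (Pi.single m 1) (toForm 1 (w (φ n)) : Poly)) atTop
      (𝓝 (eval (Pi.single m 1) (toForm 1 w₀ : Poly))) := fun m =>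
    tendsto_eval_toForm LinearMap.id hwφ tendsto_const_nhds
  have hder : ∀ m : Fin 4, Tendsto
      (fun n => eval (x (φ n)) (pderiv m (toForm d (a (φ n)) : Poly))) atTop
      (𝓝 (eval x₀ (pderiv m (toForm d a₀ : Poly)))) := fun m =>
    tendsto_eval_toForm (pderiv m : Derivation ℂ Poly Poly).toLinearMap haφ hxφ
  have hpd : ∀ n, ∀ m : Fin 4, m ≠ i.succ → eval (x n) (pderiv m (toForm d (a n) : Poly)) =
      eval (x n) (A n) * eval (Pi.single m 1) (toForm 1 (w n) : Poly) := by
    intro n m hm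
    have hG : eval (x n) (pderiv m (binProd σ p q (c n) (t n))) = 0 := by
      have := binProd_eq_sum σ p q (c n) (t n) 1
      rw [one_smul] at this
      rw [this, map_sum, map_sum]
      refine Finset.sum_eq_zero fun k' hk' => ?_
      exact eval_pderiv_monomial_eq_zero hm
        (hexp k' (by simpa [Nat.lt_succ_iff] using hk'))
        (hxl n _ (Fin.succ_ne_zero _) fun h => hli (Fin.succ_injective _ h).symm)
        (hxl n _ (Fin.succ_ne_zero _) fun h => hlj (Fin.succ_injective _ h).symm) _
    rw [heq, map_add, map_add, hG, Derivation.leibniz, pderiv_linear (hlin _)]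
    simp [hxw n]
  -- the differentials of the surface and of the plane are proportional along `z_i = 0`
  have hcross : ∀ m : Fin 4, m ≠ i.succ →
      eval x₀ (pderiv m (toForm d a₀ : Poly)) * eval (Pi.single k.succ 1) (toForm 1 w₀ : Poly) =
      eval x₀ (pderiv k.succ (toForm d a₀ : Poly)) *
        eval (Pi.single m 1) (toForm 1 w₀ : Poly) := by
    intro m hm
    refine tendsto_nhds_unique ((hder m).mul (hcoef k.succ)) ?_
    refine ((hder k.succ).mul (hcoef m)).congr fun n => ?_
    rw [hpd _ m hm, hpd _ k.succ fun h => hik (Fin.succ_injective _ h).symm]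
    ring
  have hzero : x₀ = 0 := by
    refine htr x₀ fun m => Fin.cases ?_ (fun m => ?_) m
    · have := hcross 0 (Fin.succ_ne_zero i).symm
      rw [h0, mul_zero] at this
      exact (mul_eq_zero.1 this).resolve_right hk
    · rw [logGrad_succ, map_mul, eval_X]
      by_cases hm : m = l
      · subst hm
        have h1 := hcross m.succ fun h => hli (Fin.succ_injective _ h)
        have h2 : eval (Pi.single m.succ 1) (toForm 1 w₀ : Poly) * x₀ m.succ = 0 := by
          rw [eval_linear (hlin w₀), Fin.sum_univ_succ, h0, zero_mul, zero_add,
            Finset.sum_eq_single m] at hw0x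
          · exact hw0x
          · intro b _ hb
            rw [hcoord _ (Fin.succ_ne_zero _) fun h => hb (Fin.succ_injective _ h), mul_zero]
          · simp
        refine (mul_eq_zero.1 (?_ : _ * eval (Pi.single k.succ 1) (toForm 1 w₀ : Poly) = 0)).resolve_right hk
        linear_combination x₀ m.succ * h1 + eval x₀ (pderiv k.succ (toForm d a₀ : Poly)) * h2
      · rw [hcoord _ (Fin.succ_ne_zero _) fun h => hm (Fin.succ_injective _ h), zero_mul]
  rw [hzero] at hx₀
  simp at hx₀

/-! ### Degenerate binomial products -/

/-- The curve `F = z_j = 0` of a transverse surface is reduced, so it is not the union of the line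
`w = z_j = 0` and another curve. -/
lemma not_X_dvd_of_transverse {d : ℕ} (hd : 2 ≤ d) {F w A G : Poly}
    (htr : OnlyTrivialZero (logGrad F)) (hw : w.IsHomogeneous 1) (hA : A.IsHomogeneous (d - 1))
    (heq : F = w * A + G) (j : Fin 3) : ¬ X j.succ ∣ G := by
  rintro ⟨G', hG'⟩
  let g : Fin 4 → Poly := ![0, X j.succ, w, A]
  have hg : ∀ i, (g i).IsHomogeneous ((![1, 1, 1, d - 1] : Fin 4 → ℕ) i) := by
    intro i
    fin_cases i
    · exact isHomogeneous_zero _ _ _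
    · exact isHomogeneous_X _ _
    · exact hw
    · exact hA
  have he : ∀ i, 0 < (![1, 1, 1, d - 1] : Fin 4 → ℕ) i := by
    intro i
    fin_cases i <;> simp
    omega
  have hz : OnlyTrivialZero g := by
    intro x hx
    have h1 : x j.succ = 0 := by simpa [g] using hx 1
    have h2 : eval x w = 0 := hx 2
    have h3 : eval x A = 0 := hx 3
    refine htr x fun i => ?_
    have hder : ∀ m, m ≠ j.succ → eval x (pderiv m F) = 0 := by
      intro m hm
      rw [heq, hG']
      simp [h1, h2, h3, pderiv_X_of_ne hm.symm]
    refine Fin.cases (hder 0 (Fin.succ_ne_zero j).symm) (fun m => ?_) i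
    rw [logGrad_succ, map_mul, eval_X]
    by_cases hm : m = j
    · rw [hm, h1, zero_mul]
    · rw [hder _ fun h => hm (Fin.succ_injective _ h), mul_zero]
  -- four forms, one of them zero, have a nontrivial common zero
  have hreg := hz.nonZeroDivMod he hg 0
  have h1 : (1 : Poly) ∈ Ideal.span (g '' (Finset.univ.erase 0 : Finset (Fin 4))) :=
    hreg 1 (by simp [g])
  have hle : Ideal.span (g '' (Finset.univ.erase 0 : Finset (Fin 4))) ≤
      RingHom.ker (eval (0 : Fin 4 → ℂ)) := by
    rw [Ideal.span_le]
    rintro _ ⟨i, -, rfl⟩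
    exact eval_zero_of_isHomogeneous (he i) (hg i)
  have := hle h1
  simp [RingHom.mem_ker] at this

/-- On a transverse surface the binomial product does not degenerate. -/
lemma binProd_nondegenerate {σ : Equiv.Perm (Fin 3)} {p q r d : ℕ} (hd : 2 ≤ d)
    (hr : d = r * (p + q)) {F w A : Poly} (htr : OnlyTrivialZero (logGrad F))
    (hw : w.IsHomogeneous 1) (hA : A.IsHomogeneous (d - 1)) {c : Fin r → ℂ} {t : ℂ}
    (heq : F = w * A + binProd σ p q c t) : t ≠ 0 ∧ ∀ ν, c ν ≠ 0 := by
  have hndvd := not_X_dvd_of_transverse hd htr hw hA heq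
  have hpq : p + q ≠ 0 := fun h => by rw [h, mul_zero] at hr; omega
  have hr0 : 0 < r := Nat.pos_of_ne_zero fun h => by rw [h, zero_mul] at hr; omega
  constructor
  · rintro rfl
    have hdvd : ∀ j : Fin 3, X j.succ ∣ (X (σ 1).succ ^ p * X (σ 2).succ ^ q : Poly) → False := by
      intro j hj
      refine hndvd j (Dvd.dvd.trans ?_ (Finset.dvd_prod_of_mem _ (Finset.mem_univ ⟨0, hr0⟩)))
      rw [C_0, zero_mul, zero_sub, dvd_neg]
      exact hj.mul_left _
    rcases Nat.eq_zero_or_pos p with rfl | hp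
    · exact hdvd (σ 2) (Dvd.dvd.mul_left (dvd_pow_self _ (by omega)) _)
    · exact hdvd (σ 1) (Dvd.dvd.mul_right (dvd_pow_self _ hp.ne') _)
  · intro ν hν
    refine hndvd (σ 0) (Dvd.dvd.trans ?_ (Finset.dvd_prod_of_mem _ (Finset.mem_univ ν)))
    rw [hν, C_0, zero_mul, sub_zero]
    exact Dvd.dvd.mul_left (dvd_pow_self _ hpq) _

/-! ### Limits of equations -/

section Limits

variable {σ : Equiv.Perm (Fin 3)} {p q r d : ℕ} {c : Fin r → ℂ}

lemma binExp_injective (hpq : p + q ≠ 0) : Function.Injective (binExp σ p q r) := fun k k' h => by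
  have h1 := DFunLike.congr_fun h (σ 0).succ
  rw [binExp_apply_sigma_zero, binExp_apply_sigma_zero] at h1
  exact Nat.eq_of_mul_eq_mul_left (Nat.pos_of_ne_zero hpq) h1

/-- A binomial sum that is divisible by a linear form involving `z₀` is zero, since it does not
involve `z₀`. -/
lemma eq_zero_of_mul_add_sum_eq_zero (hpq : p + q ≠ 0) {w A : Poly} (hw : w.IsHomogeneous 1)
    (hw0 : eval (Pi.single 0 1) w ≠ 0) {γ : ℕ → ℂ}
    (h : w * A + ∑ k ∈ Finset.range (r + 1), monomial (binExp σ p q r k) (γ k) = 0) :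
    A = 0 ∧ ∀ k ≤ r, γ k = 0 := by
  set G : Poly := ∑ k ∈ Finset.range (r + 1), monomial (binExp σ p q r k) (γ k) with hG
  have hupd : ∀ (z : Fin 4 → ℂ) (a : ℂ), eval (Function.update z 0 a) G = eval z G := by
    intro z a
    simp only [hG, map_sum, eval_monomial]
    refine Finset.sum_congr rfl fun k _ => ?_
    congr 1
    refine Finset.prod_congr rfl fun i hi => ?_
    have hi0 : i ≠ 0 := by
      rintro rfl
      rw [Finsupp.mem_support_iff, binExp_apply_zero] at hi
      exact hi rfl
    change Function.update z 0 a i ^ _ = z i ^ _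
    rw [Function.update_of_ne hi0]
  have hG0 : G = 0 := by
    refine MvPolynomial.funext fun z => ?_
    set a : ℂ := -(∑ j : Fin 3, eval (Pi.single j.succ 1) w * z j.succ) /
      eval (Pi.single 0 1) w
    have hwz : eval (Function.update z 0 a) w = 0 := by
      rw [eval_linear hw, Fin.sum_univ_succ, Function.update_self]
      simp only [Function.update_of_ne (Fin.succ_ne_zero _)]
      rw [mul_div_cancel₀ _ hw0]
      ring
    have h1 := congrArg (eval (Function.update z 0 a)) h
    rw [map_add, map_mul, hwz, zero_mul, zero_add, hupd] at h1
    exact h1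
  refine ⟨?_, fun k hk => ?_⟩
  · rw [hG0, add_zero] at h
    refine (mul_eq_zero.1 h).resolve_left ?_
    rintro rfl
    simp at hw0
  · have h1 := congrArg (coeff (binExp σ p q r k)) hG0
    rw [hG, coeff_sum, Finset.sum_eq_single k] at h1
    · simpa using h1
    · intro k' _ hk'
      rw [coeff_monomial, if_neg fun h' => hk' (binExp_injective hpq h')]
    · intro hk'
      exact absurd (Finset.mem_range.2 (Nat.lt_succ_of_le hk)) hk'

/-- The form `A` and the coefficients of the binomial product are determined by the surface and the
plane. -/
lemma equation_unique (hpq : p + q ≠ 0) {w A A' : Poly} (hw : w.IsHomogeneous 1)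
    (hw0 : eval (Pi.single 0 1) w ≠ 0) {t s t' s' : ℂ}
    (h : w * A + binProd σ p q (s • c) t = w * A' + binProd σ p q (s' • c) t') :
    A = A' ∧ ∀ k ≤ r, binCoeff c k * t ^ k * s ^ (r - k) =
      binCoeff c k * t' ^ k * s' ^ (r - k) := by
  rw [binProd_eq_sum, binProd_eq_sum] at h
  have := eq_zero_of_mul_add_sum_eq_zero (σ := σ) (r := r) (A := A - A')
    (γ := fun k => binCoeff c k * t ^ k * s ^ (r - k) - binCoeff c k * t' ^ k * s' ^ (r - k))
    hpq hw hw0 (by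
      simp only [map_sub, Finset.sum_sub_distrib]
      linear_combination h)
  exact ⟨sub_eq_zero.1 this.1, fun k hk => sub_eq_zero.1 (this.2 k hk)⟩

/-- If `(t₀, s₀)` and `(t, 1)` give the same binomial product, then so do `(a t₀, b s₀)` and `(a t, b)`
for all `a`, `b`. -/
lemma binProd_rescale {t₀ s₀ t : ℂ} (ht₀ : t₀ ≠ 0) (hs₀ : s₀ ≠ 0)
    (h : ∀ k ≤ r, binCoeff c k * t₀ ^ k * s₀ ^ (r - k) = binCoeff c k * t ^ k) (t' s' : ℂ) :
    binProd σ p q (s' • c) t' = binProd σ p q ((s' / s₀) • c) (t' * t / t₀) := by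
  rw [binProd_eq_sum, binProd_eq_sum]
  refine Finset.sum_congr rfl fun k hk => ?_
  have hk' := h k (by simpa [Nat.lt_succ_iff] using hk)
  congr 1
  rw [div_pow, div_pow, mul_pow]
  field_simp
  linear_combination (t' ^ k * s' ^ (r - k)) * hk'

/-- Equations `F_n = w_n A_n + ∏ (⋯)` of convergent surfaces whose planes converge to a plane not
through `[1 : 0 : 0 : 0]` have a convergent subsequence. -/
lemma exists_subseq_tendsto_equation (hd : 0 < d) (hr : d = r * (p + q)) (hc : ∀ ν, c ν ≠ 0)
    {a : ℕ → Mon d → ℂ} {a₀ : Mon d → ℂ} (ha : Tendsto a atTop (𝓝 a₀))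
    {w : ℕ → Mon 1 → ℂ} {w₀ : Mon 1 → ℂ} (hw : Tendsto w atTop (𝓝 w₀))
    (hw0 : eval (Pi.single 0 1) (toForm 1 w₀ : Poly) ≠ 0)
    {A : ℕ → Mon (d - 1) → ℂ} {t s : ℕ → ℂ}
    (heq : ∀ n, (toForm d (a n) : Poly) =
      toForm 1 (w n) * toForm (d - 1) (A n) + binProd σ p q (s n • c) (t n)) :
    ∃ (A₀ : Mon (d - 1) → ℂ) (t₀ s₀ : ℂ) (φ : ℕ → ℕ), StrictMono φ ∧
      Tendsto (fun n => A (φ n)) atTop (𝓝 A₀) ∧ Tendsto (fun n => t (φ n)) atTop (𝓝 t₀) ∧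
      Tendsto (fun n => s (φ n)) atTop (𝓝 s₀) ∧
      (toForm d a₀ : Poly) = toForm 1 w₀ * toForm (d - 1) A₀ + binProd σ p q (s₀ • c) t₀ := by
  have hpq : p + q ≠ 0 := fun h => by rw [h, mul_zero] at hr; omega
  have hr0 : r ≠ 0 := fun h => by rw [h, zero_mul] at hr; omega
  have hlin : (toForm 1 w₀ : Poly).IsHomogeneous 1 := (toForm 1 w₀).2
  have hcoef : ∀ n, a n = mulCoeffs d (w n) (A n) + ∑ k ∈ Finset.range (r + 1),
      (binCoeff c k * t n ^ k * s n ^ (r - k)) • polyCoeffs d (monomial (binExp σ p q r k) 1) := by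
    intro n
    have := congrArg (polyCoeffs d) (heq n)
    rw [polyCoeffs_toForm, map_add, ← mulCoeffs_apply, binProd_eq_sum, map_sum] at this
    rw [this]
    congr 1
    refine Finset.sum_congr rfl fun k _ => ?_
    rw [← map_smul, smul_monomial, smul_eq_mul, mul_one]
  -- `(A, γ) ↦ w₀ A + ∑ γ_k m_k` is injective, so it is bounded below
  let B : ((Mon (d - 1) → ℂ) × (Fin (r + 1) → ℂ)) →ₗ[ℂ] (Mon d → ℂ) :=
    (mulCoeffs d w₀).coprod (Fintype.linearCombination ℂ
      fun k : Fin (r + 1) => polyCoeffs d (monomial (binExp σ p q r k) 1))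
  have hBapp : ∀ A γ, B (A, γ) = mulCoeffs d w₀ A + ∑ k : Fin (r + 1),
      γ k • polyCoeffs d (monomial (binExp σ p q r k) 1) := fun A γ => by
    simp [B, Fintype.linearCombination_apply]
  have hB : LinearMap.ker B = ⊥ := by
    rw [LinearMap.ker_eq_bot']
    rintro ⟨A', γ⟩ h0
    rw [hBapp] at h0
    have hform : ((toForm 1 w₀ : Poly) * toForm (d - 1) A' + ∑ k ∈ Finset.range (r + 1),
        monomial (binExp σ p q r k) (if hk : k < r + 1 then γ ⟨k, hk⟩ else 0)) = 0 := by
      have hsum : ∑ k ∈ Finset.range (r + 1),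
          monomial (binExp σ p q r k) (if hk : k < r + 1 then γ ⟨k, hk⟩ else 0) =
          ∑ k : Fin (r + 1), γ k • (monomial (binExp σ p q r k) 1 : Poly) := by
        rw [Finset.sum_range]
        refine Finset.sum_congr rfl fun k _ => ?_
        rw [dif_pos k.2, smul_monomial, smul_eq_mul, mul_one]
      rw [hsum]
      have hhom : ((toForm 1 w₀ : Poly) * toForm (d - 1) A' + ∑ k : Fin (r + 1),
          γ k • (monomial (binExp σ p q r k) 1 : Poly)).IsHomogeneous d := by
        refine IsHomogeneous.add ?_ (IsHomogeneous.sum _ _ _ fun k _ => ?_)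
        · have := hlin.mul (toForm (d - 1) A').2
          rwa [Nat.add_sub_cancel' hd] at this
        · rw [smul_monomial]
          refine isHomogeneous_monomial _ ?_
          rw [degree_binExp (Nat.lt_succ_iff.1 k.2), hr]
      rw [← toForm_polyCoeffs hhom, map_add, map_sum]
      simp only [map_smul]
      rw [← mulCoeffs_apply, h0, map_zero]
      rfl
    obtain ⟨h1, h2⟩ := eq_zero_of_mul_add_sum_eq_zero hpq hlin hw0 hform
    have hA' : A' = 0 := (map_eq_zero_iff _ (toForm (d - 1)).injective).1 (Subtype.ext h1)
    have hγ : γ = 0 := by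
      ext k
      have := h2 k (Nat.lt_succ_iff.1 k.2)
      rwa [dif_pos k.2] at this
    rw [hA', hγ]
    rfl
  obtain ⟨K, -, hK⟩ := LinearMap.exists_antilipschitzWith B hB
  let M := (mulCoeffs d).toContinuousBilinearMap
  have hM : ∀ u v, ‖mulCoeffs d u v‖ ≤ ‖M‖ * ‖u‖ * ‖v‖ := fun u v => M.le_opNorm₂ u v
  set γ : ℕ → Fin (r + 1) → ℂ := fun n k => binCoeff c k * t n ^ (k : ℕ) * s n ^ (r - k) with hγ
  -- the bound persists for `w` near `w₀`
  have hbd : ∀ᶠ n in atTop, ‖(A n, γ n)‖ ≤ 2 * (K * (‖a₀‖ + 1)) := by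
    have hsmall : Tendsto (fun n => (K : ℝ) * (‖M‖ * ‖w n - w₀‖)) atTop (𝓝 0) := by
      have h1 : Tendsto (fun n => ‖w n - w₀‖) atTop (𝓝 0) := by
        have := (hw.sub_const w₀).norm
        rwa [sub_self, norm_zero] at this
      simpa using (h1.const_mul ‖M‖).const_mul (K : ℝ)
    filter_upwards [hsmall.eventually (ge_mem_nhds (show (0 : ℝ) < 1 / 2 by norm_num)),
      ha.norm.eventually (ge_mem_nhds (lt_add_one ‖a₀‖))] with n hn1 hn2
    have h1 : B (A n, γ n) = a n - mulCoeffs d (w n - w₀) (A n) := by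
      rw [hBapp, hcoef n, Finset.sum_range, map_sub, LinearMap.sub_apply]
      simp only [hγ]
      abel
    have h2 : ‖(A n, γ n)‖ ≤ K * ‖B (A n, γ n)‖ := by
      simpa using hK.le_mul_dist (A n, γ n) 0
    have h3 : ‖B (A n, γ n)‖ ≤ ‖a n‖ + ‖M‖ * ‖w n - w₀‖ * ‖(A n, γ n)‖ := by
      rw [h1]
      refine (norm_sub_le _ _).trans (add_le_add_right ((hM _ _).trans ?_) _)
      exact mul_le_mul_of_nonneg_left (norm_fst_le (A n, γ n)) (by positivity)
    have h4 : ‖(A n, γ n)‖ ≤ K * ‖a n‖ + K * (‖M‖ * ‖w n - w₀‖) * ‖(A n, γ n)‖ := by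
      refine h2.trans ((mul_le_mul_of_nonneg_left h3 K.2).trans (le_of_eq ?_))
      change (K : ℝ) * _ = _
      ring
    have h5 : (K : ℝ) * (‖M‖ * ‖w n - w₀‖) * ‖(A n, γ n)‖ ≤ 1 / 2 * ‖(A n, γ n)‖ :=
      mul_le_mul_of_nonneg_right hn1 (norm_nonneg _)
    have h6 : (K : ℝ) * ‖a n‖ ≤ K * (‖a₀‖ + 1) := mul_le_mul_of_nonneg_left hn2 K.2
    linarith
  set R := 2 * (K * (‖a₀‖ + 1)) with hR
  have hpow : ∀ (z : ℂ) (R' : ℝ), ‖z‖ ^ r ≤ R' → ‖z‖ ≤ max 1 R' := by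
    intro z R' hz
    rcases le_or_gt ‖z‖ 1 with h | h
    · exact h.trans (le_max_left _ _)
    · exact ((le_self_pow₀ h.le hr0).trans hz).trans (le_max_right _ _)
  have hc0 : binCoeff c 0 ≠ 0 := by
    rw [binCoeff_zero]
    exact Finset.prod_ne_zero_iff.2 fun ν _ => neg_ne_zero.2 (hc ν)
  have hbd' : ∀ᶠ n in atTop, (A n, t n, s n) ∈
      Metric.closedBall (0 : (Mon (d - 1) → ℂ) × ℂ × ℂ) (max R (max (max 1 R)
        (max 1 (R / ‖binCoeff c 0‖)))) := by
    filter_upwards [hbd] with n hn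
    have hγn : ∀ k, ‖γ n k‖ ≤ R := fun k =>
      (norm_le_pi_norm (γ n) k).trans ((norm_snd_le (A n, γ n)).trans hn)
    have ht : ‖t n‖ ≤ max 1 R := hpow _ _ (by
      simpa [hγ, binCoeff_self] using hγn (Fin.last r))
    have hs : ‖s n‖ ≤ max 1 (R / ‖binCoeff c 0‖) := hpow _ _ (by
      rw [le_div_iff₀ (norm_pos_iff.2 hc0), mul_comm]
      simpa [hγ] using hγn 0)
    rw [mem_closedBall_zero_iff, Prod.norm_def, Prod.norm_def]
    refine max_le_max ((norm_fst_le (A n, γ n)).trans hn) (max_le_max ht hs)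
  obtain ⟨⟨A₀, t₀, s₀⟩, -, φ, hφ, hlim⟩ :=
    tendsto_subseq_of_frequently_bounded Metric.isBounded_closedBall hbd'.frequently
  have hlA : Tendsto (fun n => A (φ n)) atTop (𝓝 A₀) := (continuous_fst.tendsto _).comp hlim
  have hl2 : Tendsto (fun n => (t (φ n), s (φ n))) atTop (𝓝 (t₀, s₀)) :=
    (continuous_snd.tendsto _).comp hlim
  have hlt : Tendsto (fun n => t (φ n)) atTop (𝓝 t₀) := (continuous_fst.tendsto _).comp hl2
  have hls : Tendsto (fun n => s (φ n)) atTop (𝓝 s₀) := (continuous_snd.tendsto _).comp hl2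
  refine ⟨A₀, t₀, s₀, φ, hφ, hlA, hlt, hls, ?_⟩
  refine MvPolynomial.funext fun z => ?_
  have hev : ∀ {l : ℕ} {b : ℕ → Mon l → ℂ} {b₀ : Mon l → ℂ}, Tendsto b atTop (𝓝 b₀) →
      Tendsto (fun n => eval z (toForm l (b n) : Poly)) atTop
        (𝓝 (eval z (toForm l b₀ : Poly))) := fun hb =>
    tendsto_eval_toForm LinearMap.id hb tendsto_const_nhds
  have h1 := hev (ha.comp hφ.tendsto_atTop)
  have h2 := (hev (hw.comp hφ.tendsto_atTop)).mul (hev hlA)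
  have h3 : Tendsto (fun n => eval z (binProd σ p q (s (φ n) • c) (t (φ n)))) atTop
      (𝓝 (eval z (binProd σ p q (s₀ • c) t₀))) := by
    simp only [binProd, map_prod, map_sub, map_mul, eval_C, Pi.smul_apply, smul_eq_mul]
    exact tendsto_finsetProd _ fun ν _ => (hlt.mul_const _).sub ((hls.mul_const _).mul_const _)
  rw [map_add, map_mul]
  refine tendsto_nhds_unique h1 ((h2.add h3).congr fun n => ?_)
  simp only [Function.comp_apply]
  rw [heq, map_add, map_mul]

end Limits

/-! ### The locus near a surface is the image of the parametrization -/

section Germ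

variable {σ : Equiv.Perm (Fin 3)} {p q r d : ℕ} {c : Fin r → ℂ}

lemma toForm_germMap (hd : 0 < d) (hr : d = r * (p + q)) (w : Mon 1 → ℂ) (e : GermParam d) :
    (toForm d (germMap σ p q c d w e) : Poly) =
      toForm 1 (w + linCoeffs e.1) * toForm (d - 1) e.2.1 + binProd σ p q (e.2.2.2 • c) e.2.2.1 := by
  rw [germMap, mulCoeffs_apply, ← map_add, toForm_polyCoeffs]
  refine IsHomogeneous.add ?_ ?_
  · have := IsHomogeneous.mul (toForm 1 (w + linCoeffs e.1)).2 (toForm (d - 1) e.2.1).2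
    rwa [Nat.add_sub_cancel' hd] at this
  · have := isHomogeneous_binProd (σ := σ) (p := p) (q := q) (e.2.2.2 • c) e.2.2.1
    rwa [← hr] at this

lemma germMap_eq_of_equation (hd : 0 < d) (hr : d = r * (p + q)) {w : Mon 1 → ℂ} {e : GermParam d}
    {a : Mon d → ℂ} (h : (toForm d a : Poly) =
      toForm 1 (w + linCoeffs e.1) * toForm (d - 1) e.2.1 + binProd σ p q (e.2.2.2 • c) e.2.2.1) :
    germMap σ p q c d w e = a := by
  rw [← toForm_germMap hd hr] at h
  exact ((toForm d).injective (Subtype.ext h)).symm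

namespace IsTransverseEquation

variable {a₀ : Mon d → ℂ} {w₀ : Mon 1 → ℂ} {A₀ : Mon (d - 1) → ℂ} {t : ℂ}

lemma coeff_ne_zero {F w A : Poly} (h : IsTransverseEquation σ p q c d F w A t) (ν : Fin r) :
    c ν ≠ 0 :=
  (binProd_nondegenerate h.two_le h.degree_eq h.transverse h.hw h.hA h.equation).2 ν

/-- Surfaces near `F` with an equation whose plane is near `w` lie in the image of any given
neighbourhood of the base point of the parametrization.  Otherwise there is a sequence of
counterexamples; after normalizing the planes, the parameters have a limit, which by uniqueness of
the equation differs from the base point only by a rescaling that fixes the binomial product. -/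
lemma eventually_mem_image_germMap
    (h : IsTransverseEquation σ p q c d (toForm d a₀) (toForm 1 w₀) (toForm (d - 1) A₀) t)
    {U : Set (GermParam d)} (hU : U ∈ 𝓝 ((0, A₀, t, 1) : GermParam d)) :
    ∀ᶠ x in 𝓝 (a₀, w₀), ∀ (A' : Mon (d - 1) → ℂ) (t' s' : ℂ),
      (toForm d x.1 : Poly) = toForm 1 x.2 * toForm (d - 1) A' + binProd σ p q (s' • c) t' →
        x.1 ∈ germMap σ p q c d w₀ '' U := by
  have hd : 0 < d := by have := h.two_le; omega
  have hr := h.degree_eq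
  have hpq : p + q ≠ 0 := fun h0 => by rw [h0, mul_zero] at hr; omega
  have hr0 : r ≠ 0 := fun h0 => by rw [h0, zero_mul] at hr; omega
  by_contra hcon
  rw [Filter.not_eventually] at hcon
  have hev : ∀ᶠ x : (Mon d → ℂ) × (Mon 1 → ℂ) in 𝓝 (a₀, w₀),
      eval (Pi.single 0 1) (toForm 1 x.2 : Poly) ≠ 0 := by
    have hcont : Continuous fun x : (Mon d → ℂ) × (Mon 1 → ℂ) =>
        eval (Pi.single 0 1) (toForm 1 x.2 : Poly) := by
      have h1 := (continuous_eval_toForm 1 LinearMap.id).comp (continuous_snd.prodMk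
        (continuous_const (y := Pi.single 0 1)) : Continuous
          fun x : (Mon d → ℂ) × (Mon 1 → ℂ) => (x.2, (Pi.single 0 1 : Fin 4 → ℂ)))
      simpa only [Function.comp_def, LinearMap.id_apply] using h1
    exact hcont.continuousAt.eventually_ne (x := (a₀, w₀)) h.eval_ne_zero
  obtain ⟨x, hx, hxn⟩ := Filter.exists_seq_forall_of_frequently (hcon.and_eventually hev)
  choose hx1 hα using hxn
  push Not at hx1
  choose A t' s' heq hnot using hx1
  have ha : Tendsto (fun n => (x n).1) atTop (𝓝 a₀) := (continuous_fst.tendsto _).comp hx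
  have hw : Tendsto (fun n => (x n).2) atTop (𝓝 w₀) := (continuous_snd.tendsto _).comp hx
  have hcoef : ∀ (m : Fin 4) {v : ℕ → Mon 1 → ℂ} {v₀ : Mon 1 → ℂ}, Tendsto v atTop (𝓝 v₀) →
      Tendsto (fun n => eval (Pi.single m 1) (toForm 1 (v n) : Poly)) atTop
        (𝓝 (eval (Pi.single m 1) (toForm 1 v₀ : Poly))) := fun m _ _ hv =>
    tendsto_eval_toForm LinearMap.id hv tendsto_const_nhds
  -- rescale the plane so that its coefficient of `z₀` agrees with that of `w₀`
  set u : ℕ → ℂ := fun n => eval (Pi.single 0 1) (toForm 1 w₀ : Poly) /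
    eval (Pi.single 0 1) (toForm 1 (x n).2 : Poly) with hu
  have hu0 : ∀ n, u n ≠ 0 := fun n => div_ne_zero h.eval_ne_zero (hα n)
  have hu1 : Tendsto u atTop (𝓝 1) := by
    have := (tendsto_const_nhds (x := eval (Pi.single 0 1) (toForm 1 w₀ : Poly))).div (hcoef 0 hw)
      h.eval_ne_zero
    rwa [div_self h.eval_ne_zero] at this
  have hW : Tendsto (fun n => u n • (x n).2) atTop (𝓝 w₀) := by
    simpa using hu1.smul hw
  set L : ℕ → Fin 3 → ℂ := fun n j =>
    eval (Pi.single j.succ 1) (toForm 1 (u n • (x n).2 - w₀) : Poly) with hL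
  have hwL : ∀ n, w₀ + linCoeffs (L n) = u n • (x n).2 := by
    intro n
    have h1 := eq_linPoly (l := (toForm 1 (u n • (x n).2 - w₀) : Poly))
      (toForm 1 (u n • (x n).2 - w₀)).2 (by
        rw [map_sub, map_smul, Submodule.coe_sub, Submodule.coe_smul, map_sub, smul_eval, hu,
          div_mul_cancel₀ _ (hα n), sub_self])
    have h2 := congrArg (polyCoeffs 1) h1
    rw [polyCoeffs_toForm] at h2
    rw [← sub_add_cancel (u n • (x n).2) w₀, h2, add_comm]
    rfl
  have hL0 : Tendsto L atTop (𝓝 0) := by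
    refine tendsto_pi_nhds.2 fun j => ?_
    have := hcoef j.succ (hW.sub_const w₀)
    rw [sub_self, map_zero, Submodule.coe_zero, map_zero] at this
    exact this
  have heq' : ∀ n, (toForm d (x n).1 : Poly) = toForm 1 (u n • (x n).2) *
      toForm (d - 1) ((u n)⁻¹ • A n) + binProd σ p q (s' n • c) (t' n) := by
    intro n
    rw [heq n, map_smul, map_smul, Submodule.coe_smul, Submodule.coe_smul, smul_mul_smul_comm,
      mul_inv_cancel₀ (hu0 n), one_smul]
  obtain ⟨A₁, t₁, s₁, φ, hφ, hlA, hlt, hls, hlim⟩ :=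
    exists_subseq_tendsto_equation hd hr h.coeff_ne_zero ha hW h.eval_ne_zero heq'
  have h0 := h.equation
  rw [← one_smul ℂ c] at h0
  obtain ⟨hA, hcf⟩ := equation_unique hpq h.hw h.eval_ne_zero (hlim.symm.trans h0)
  have hAA : A₁ = A₀ := (toForm (d - 1)).injective (Subtype.ext hA)
  have hcf' : ∀ k ≤ r, binCoeff c k * t₁ ^ k * s₁ ^ (r - k) = binCoeff c k * t ^ k := by
    intro k hk
    rw [hcf k hk, one_pow, mul_one]
  obtain ⟨ht₁, hs₁⟩ := binProd_nondegenerate h.two_le hr h.transverse h.hw (toForm (d - 1) A₁).2 hlim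
  have hs₁ : s₁ ≠ 0 := fun hs => hs₁ ⟨0, Nat.pos_of_ne_zero hr0⟩ (by simp [hs])
  set e : ℕ → GermParam d := fun n => (L (φ n), (u (φ n))⁻¹ • A (φ n), t' (φ n) * t / t₁,
    s' (φ n) / s₁) with he
  have hlim_e : Tendsto e atTop (𝓝 (0, A₀, t, 1)) := by
    refine (hL0.comp hφ.tendsto_atTop).prodMk_nhds (Tendsto.prodMk_nhds (hAA ▸ hlA)
      (Tendsto.prodMk_nhds ?_ ?_))
    · have := (hlt.mul_const t).div_const t₁
      rwa [mul_div_cancel_left₀ _ ht₁] at this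
    · have := hls.div_const s₁
      rwa [div_self hs₁] at this
  obtain ⟨n, hn⟩ := (hlim_e.eventually hU).exists
  refine hnot (φ n) ⟨e n, hn, germMap_eq_of_equation hd hr ?_⟩
  rw [heq' (φ n), binProd_rescale ht₁ hs₁ hcf', ← hwL]

/-- If `w` is the only plane belonging to `F`, then all surfaces of the locus near `F` lie in the
image of the parametrization: by compactness the planes of a sequence of surfaces converging to `F`
accumulate at a plane belonging to `F`. -/
lemma eventually_mem_image_germMap_of_unique
    (h : IsTransverseEquation σ p q c d (toForm d a₀) (toForm 1 w₀) (toForm (d - 1) A₀) t)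
    (huniq : ∀ w' : Forms 1, HasPlane σ p q c (toForm d a₀) w' → ∃ u : ℂ, w' = u • toForm 1 w₀)
    {U : Set (GermParam d)} (hU : U ∈ 𝓝 ((0, A₀, t, 1) : GermParam d)) :
    ∀ᶠ a in 𝓝 a₀, ∀ (w' : Mon 1 → ℂ) (A' : Mon (d - 1) → ℂ) (t' s' : ℂ),
      (toForm d a : Poly) = toForm 1 w' * toForm (d - 1) A' + binProd σ p q (s' • c) t' →
        a ∈ germMap σ p q c d w₀ '' U := by
  have hd : 0 < d := by have := h.two_le; omega
  have hr := h.degree_eq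
  have hr0 : r ≠ 0 := fun h0 => by rw [h0, zero_mul] at hr; omega
  by_contra hcon
  rw [Filter.not_eventually] at hcon
  obtain ⟨a, ha, han⟩ := Filter.exists_seq_forall_of_frequently hcon
  push Not at han
  choose w A t' s' heq hnot using han
  have hw₀ : w₀ ≠ 0 := by
    intro hw
    have := h.eval_ne_zero
    rw [hw] at this
    simp at this
  -- the planes can be taken of norm `1`
  have hunit : ∀ n, ∃ v ∈ Metric.sphere (0 : Mon 1 → ℂ) 1, ∃ A' : Mon (d - 1) → ℂ,
      (toForm d (a n) : Poly) = toForm 1 v * toForm (d - 1) A' +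
        binProd σ p q (s' n • c) (t' n) := by
    intro n
    by_cases hwn : w n = 0
    · refine ⟨(‖w₀‖⁻¹ : ℂ) • w₀, by simp [norm_smul, hw₀], 0, ?_⟩
      rw [heq n, hwn]
      simp
    · have hnorm : (‖w n‖ : ℂ) ≠ 0 := by simpa using hwn
      refine ⟨(‖w n‖⁻¹ : ℂ) • w n, by simp [norm_smul, hwn], (‖w n‖ : ℂ) • A n, ?_⟩
      rw [heq n, map_smul, map_smul, Submodule.coe_smul, Submodule.coe_smul, smul_mul_smul_comm,
        inv_mul_cancel₀ hnorm, one_smul]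
  choose v hv B hB using hunit
  obtain ⟨v₀, hv₀, φ, hφ, hvφ⟩ := (isCompact_sphere (0 : Mon 1 → ℂ) 1).tendsto_subseq hv
  have hv₀0 : v₀ ≠ 0 := by
    rintro rfl
    simp at hv₀
  have haφ : Tendsto (fun n => a (φ n)) atTop (𝓝 a₀) := ha.comp hφ.tendsto_atTop
  have hα := eval_limit_plane_ne_zero h.coprime h.two_le hr haφ h.transverse hvφ hv₀0
    (A := fun n => toForm (d - 1) (B (φ n))) (c := fun n => s' (φ n) • c) (t := fun n => t' (φ n))
    fun n => hB (φ n)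
  obtain ⟨A₁, t₁, s₁, -, -, -, -, -, hlim⟩ := exists_subseq_tendsto_equation hd hr h.coeff_ne_zero
    haφ hvφ hα fun n => hB (φ n)
  obtain ⟨ht₁, hs₁⟩ := binProd_nondegenerate h.two_le hr h.transverse (toForm 1 v₀).2
    (toForm (d - 1) A₁).2 hlim
  have hs₁ : s₁ ≠ 0 := fun hs => hs₁ ⟨0, Nat.pos_of_ne_zero hr0⟩ (by simp [hs])
  obtain ⟨u, hu⟩ := huniq (toForm 1 v₀) ⟨toForm (d - 1) A₁, t₁, s₁, ht₁, hs₁, hlim⟩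
  rw [← map_smul] at hu
  have hvu : v₀ = u • w₀ := (toForm 1).injective hu
  have hu0 : u ≠ 0 := by
    rintro rfl
    exact hv₀0 (by rw [hvu, zero_smul])
  have hlimw : Tendsto (fun n => u⁻¹ • v (φ n)) atTop (𝓝 w₀) := by
    have := hvφ.const_smul u⁻¹
    rwa [hvu, smul_smul, inv_mul_cancel₀ hu0, one_smul] at this
  obtain ⟨n, hn⟩ := ((haφ.prodMk_nhds hlimw).eventually (h.eventually_mem_image_germMap hU)).exists
  refine hnot (φ n) (hn (u • B (φ n)) (t' (φ n)) (s' (φ n)) ?_)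
  rw [hB (φ n), map_smul, map_smul, Submodule.coe_smul, Submodule.coe_smul, smul_mul_smul_comm,
    inv_mul_cancel₀ hu0, one_smul]

/-! ### The tangent space of the locus -/

lemma germMap_base
    (h : IsTransverseEquation σ p q c d (toForm d a₀) (toForm 1 w₀) (toForm (d - 1) A₀) t) :
    germMap σ p q c d w₀ (0, A₀, t, 1) = a₀ := by
  have hd := h.two_le
  refine germMap_eq_of_equation (by omega) h.degree_eq ?_
  rw [map_zero, add_zero, one_smul]
  exact h.equation

/-- A subset of the cone which near `F` lies between the image of the germ of the parametrization
and the image of a suitable neighbourhood has the tangent space `w P^{d-1} + J_F^d` at `F`. -/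
lemma exists_coneTangent_eq
    (h : IsTransverseEquation σ p q c d (toForm d a₀) (toForm 1 w₀) (toForm (d - 1) A₀) t) :
    ∃ U ∈ 𝓝 ((0, A₀, t, 1) : GermParam d), ∀ S : Set (Forms d),
      (∀ᶠ a in 𝓝 a₀, ∀ H ∈ S, coeffs d H = a → a ∈ germMap σ p q c d w₀ '' U) →
      (∀ᶠ e in 𝓝 ((0, A₀, t, 1) : GermParam d), toForm d (germMap σ p q c d w₀ e) ∈ S) →
      coneTangent S (toForm d a₀) =
        multForms (toForm 1 w₀) d ⊔ jacForms (toForm d a₀) d := by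
  have hd : 0 < d := by have := h.two_le; omega
  obtain ⟨D, hD, hDe⟩ := hasFDerivAt_germMap σ p q c d w₀ A₀ t
  have hΦ := analyticAt_germMap σ p q c d w₀ (0, A₀, t, 1)
  have hDform : ∀ e (G : Forms d), D e = coeffs d G →
      germTangent σ p q c d (toForm 1 w₀) (toForm (d - 1) A₀) t e = G := by
    intro e G he
    rw [hDe] at he
    have h1 := congrArg (fun b => (toForm d b : Poly)) he
    simpa only [toForm_polyCoeffs (h.isHomogeneous_germTangent e), toForm_coeffs] using h1
  have hinj : Function.Injective D := by
    refine (injective_iff_map_eq_zero D).2 fun e he => h.eq_zero_of_germTangent_eq_zero ?_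
    exact hDform e 0 (by rw [he, map_zero])
  have hmem : ∀ G : Forms d, G ∈ multForms (toForm 1 w₀) d ⊔ jacForms (toForm d a₀) d ↔
      (G : Poly) ∈ Ideal.span {(toForm 1 w₀ : Poly)} ⊔ jacIdeal (toForm d a₀ : Poly) := by
    intro G
    rw [mem_span_sup_iff]
    exact mem_sup_iff hd
  have hbase := h.germMap_base
  obtain ⟨f, hf, hfΦ, hfD⟩ := exists_analyticAt_vanishing hΦ hD hinj
  rw [hbase] at hf hfD
  refine ⟨{e | f (germMap σ p q c d w₀ e) = 0}, hfΦ, fun S hsub hsup => le_antisymm ?_ ?_⟩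
  · intro G hG
    have hzero : fderiv ℂ f a₀ (coeffs d G) = 0 := by
      ext m
      have hfm : AnalyticAt ℂ (fun a => f a m) (coeffs d (toForm d a₀)) := by
        rw [coeffs_toForm]
        exact ((ContinuousLinearMap.proj (R := ℂ) (φ := fun _ : Mon d => ℂ) m).analyticAt _).fun_comp
          hf
      have h1 := hG (fun a => f a m) hfm (by
        rw [coeffs_toForm]
        filter_upwards [hsub] with a ha H hH hHa
        obtain ⟨e, he, rfl⟩ := ha H hH hHa
        exact congrFun he m)
      rw [coeffs_toForm] at h1
      have h2 := hasFDerivAt_pi'.1 hf.differentiableAt.hasFDerivAt m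
      rw [h2.fderiv] at h1
      exact h1
    obtain ⟨e, he⟩ := hfD _ hzero
    rw [hmem, ← hDform e G he]
    exact h.germTangent_mem e
  · intro G hG g hg hgS
    rw [coeffs_toForm] at hg hgS ⊢
    obtain ⟨e, he⟩ := h.exists_germTangent_eq G.2 ((hmem G).1 hG)
    have hcoef : coeffs d G = D e := by
      rw [hDe, he]
      rfl
    have hcomp : HasFDerivAt (fun e => g (germMap σ p q c d w₀ e))
        ((fderiv ℂ g a₀).comp D) (0, A₀, t, 1) := by
      refine HasFDerivAt.comp (0, A₀, t, 1) ?_ hD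
      rw [hbase]
      exact hg.differentiableAt.hasFDerivAt
    have hcont : Tendsto (germMap σ p q c d w₀) (𝓝 (0, A₀, t, 1)) (𝓝 a₀) := by
      have := hΦ.continuousAt.tendsto
      rwa [hbase] at this
    have hzero : (fun e => g (germMap σ p q c d w₀ e)) =ᶠ[𝓝 (0, A₀, t, 1)] fun _ => 0 := by
      filter_upwards [hsup, hcont.eventually hgS] with e he1 he2
      exact he2 _ he1 (coeffs_toForm _)
    have := hcomp.unique ((hasFDerivAt_const (0 : ℂ) _).congr_of_eventuallyEq hzero)
    rw [hcoef]
    exact DFunLike.congr_fun this e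

/-- Near its base point the parametrization takes values in the locus, with planes near `w`. -/
lemma eventually_germMap_mem_locusIn
    (h : IsTransverseEquation σ p q c d (toForm d a₀) (toForm 1 w₀) (toForm (d - 1) A₀) t)
    {N : Set (Mon 1 → ℂ)} (hN : N ∈ 𝓝 w₀) :
    ∀ᶠ e in 𝓝 ((0, A₀, t, 1) : GermParam d),
      toForm d (germMap σ p q c d w₀ e) ∈ locusIn σ p q c d N := by
  have hd : 0 < d := by have := h.two_le; omega
  have hcont : Tendsto (germMap σ p q c d w₀) (𝓝 (0, A₀, t, 1)) (𝓝 a₀) := by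
    have := (analyticAt_germMap σ p q c d w₀ (0, A₀, t, 1)).continuousAt.tendsto
    rwa [h.germMap_base] at this
  have htr : ∀ᶠ a in 𝓝 a₀, IsTransverse (toForm d a : Poly) :=
    eventually_isTransverse hd ((isTransverse_iff hd (toForm d a₀).2).2 h.transverse)
  have hplane : ∀ᶠ e in 𝓝 ((0, A₀, t, 1) : GermParam d), w₀ + linCoeffs e.1 ∈ N := by
    have hc : Continuous fun e : GermParam d => w₀ + linCoeffs e.1 :=
      continuous_const.add (linCoeffs.continuous_of_finiteDimensional.comp continuous_fst)
    have := hc.tendsto (0, A₀, t, 1)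
    rw [map_zero, add_zero] at this
    exact this hN
  have ht : ∀ᶠ e in 𝓝 ((0, A₀, t, 1) : GermParam d), e.2.2.1 ≠ 0 :=
    (continuous_fst.comp (continuous_snd.comp continuous_snd)).continuousAt.eventually_ne h.ht
  have hs : ∀ᶠ e in 𝓝 ((0, A₀, t, 1) : GermParam d), e.2.2.2 ≠ 0 :=
    (continuous_snd.comp (continuous_snd.comp continuous_snd)).continuousAt.eventually_ne one_ne_zero
  filter_upwards [hcont.eventually htr, hplane, ht, hs] with e he1 he2 he3 he4
  refine ⟨he1, toForm 1 (w₀ + linCoeffs e.1), by rwa [coeffs_toForm], toForm (d - 1) e.2.1,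
    e.2.2.1, e.2.2.2, he3, he4, toForm_germMap hd h.degree_eq _ _⟩

end IsTransverseEquation

/-- Euler's formula. -/
lemma mem_jacIdeal_self {d : ℕ} (hd : 0 < d) {F : Poly} (hF : F.IsHomogeneous d) :
    F ∈ jacIdeal F := by
  have h1 := hF.sum_X_mul_pderiv
  have h2 : C (d : ℂ) * F ∈ jacIdeal F := by
    rw [map_natCast, ← nsmul_eq_mul, ← h1, Fin.sum_univ_succ]
    exact add_mem (Ideal.mul_mem_left _ _ (IsTransverseEquation.pderiv_zero_mem_jacIdeal F))
      (sum_mem fun j _ => IsTransverseEquation.X_mul_pderiv_mem_jacIdeal F j)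
  exact (IsTransverseEquation.C_mul_mem_iff (Nat.cast_ne_zero.2 hd.ne')).1 h2

/-- By Euler's formula `F` lies in `J_F`, so passing to the tangent space of `M` loses nothing. -/
lemma comap_tangentSpaceAt (hd : 0 < d) {S : Set (Forms d)} {F : Forms d} {w : Forms 1}
    (h : coneTangent S F = multForms w d ⊔ jacForms F d) :
    (tangentSpaceAt S F).comap (psi F) = multForms w d ⊔ jacForms F d := by
  rw [tangentSpaceAt, Submodule.comap_map_eq, h, psi, Submodule.ker_mkQ, sup_eq_left,
    Submodule.span_singleton_le_iff_mem]
  exact Submodule.mem_sup_right (mem_jacIdeal_self hd F.2)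

end Germ

end LogNL

end

theorem mainTheorem5
    (d p q r : ℕ) (hd : 2 ≤ d) (hpq : Nat.Coprime p q) (hr : d = r * (p + q))
    (σ : Equiv.Perm (Fin 3)) (c : Fin r → ℂ) (hc : c ≠ 0)
    (F : LogNL.Forms d) (hM : LogNL.IsTransverse (F : LogNL.Poly))
    (w : LogNL.Forms 1) (A : LogNL.Forms (d - 1)) (t : ℂ) (ht : t ≠ 0)
    (hF : (F : LogNL.Poly) =
      (w : LogNL.Poly) * (A : LogNL.Poly) + LogNL.binProd σ p q c t) :
    -- (1) the tangent space of the branch of the locus at `F` that belongs to the plane `w = 0`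
    (∃ N₀ ∈ 𝓝 (LogNL.coeffs 1 w), ∀ N ∈ 𝓝 (LogNL.coeffs 1 w), N ⊆ N₀ →
      (LogNL.tangentSpaceAt (LogNL.locusIn σ p q c d N) F).comap (LogNL.psi F) =
        LogNL.multForms w d ⊔ LogNL.jacForms F d) ∧
    -- (1) the tangent space of the whole locus, when no other plane gives such an equation of `F`
    ((∀ w' : LogNL.Forms 1, LogNL.HasPlane σ p q c F w' → ∃ u : ℂ, w' = u • w) →
      (LogNL.tangentSpaceAt (LogNL.locus σ p q c d) F).comap (LogNL.psi F) =
        LogNL.multForms w d ⊔ LogNL.jacForms F d) ∧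
    -- (2)
    (∀ a b : ℂ, b ≠ 0 →
      LogNL.annForms F (a • LogNL.omegaF F + b • LogNL.xiF σ p q w A) d =
        LogNL.multForms w d ⊔ LogNL.jacForms F d) ∧
    -- (3)
    (LinearIndependent ℂ ![LogNL.omegaF F, LogNL.xiF σ p q w A] ∧
      (Submodule.span ℂ {LogNL.omegaF F, LogNL.xiF σ p q w A} : Set LogNL.Poly) =
        {lam | lam ∈ LogNL.Forms (d - 1) ∧
          ∀ x ∈ LogNL.multForms w d ⊔ LogNL.jacForms F d,
            (Ideal.Quotient.mk (LogNL.jacIdeal F) (lam * (x : LogNL.Poly)) :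
              LogNL.JacRing F) = 0}) := by
  have hd0 : 0 < d := by omega
  have h : LogNL.IsTransverseEquation σ p q c d F w A t :=
    ⟨hd, hpq, hr, F.2, w.2, A.2, ht, (LogNL.isTransverse_iff hd0 F.2).1 hM, hF⟩
  have h' : LogNL.IsTransverseEquation σ p q c d (LogNL.toForm d (LogNL.coeffs d F))
      (LogNL.toForm 1 (LogNL.coeffs 1 w)) (LogNL.toForm (d - 1) (LogNL.coeffs (d - 1) A)) t := by
    simpa only [LogNL.toForm_coeffs] using h
  obtain ⟨U, hU, htangent⟩ := h'.exists_coneTangent_eq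
  simp only [LogNL.toForm_coeffs] at htangent
  refine ⟨?_, fun huniq => ?_, fun a b hb => h.annForms_eq hb, h.linearIndependent_omegaF_xiF,
    h.span_omegaF_xiF_eq⟩
  · have hX := h'.eventually_mem_image_germMap hU
    rw [nhds_prod_eq, Filter.eventually_prod_iff] at hX
    obtain ⟨P₁, hP₁, P₂, hP₂, hP⟩ := hX
    refine ⟨{v | P₂ v}, hP₂, fun N hN hNN => LogNL.comap_tangentSpaceAt hd0 (htangent _ ?_
      (h'.eventually_germMap_mem_locusIn hN))⟩
    filter_upwards [hP₁] with a ha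
    rintro H ⟨-, w', hw', A', t', s', -, -, hH⟩ rfl
    refine hP ha (hNN hw') (LogNL.coeffs (d - 1) A') t' s' ?_
    simpa only [LogNL.toForm_coeffs] using hH
  · refine LogNL.comap_tangentSpaceAt hd0 (htangent _ ?_ ?_)
    · filter_upwards [h'.eventually_mem_image_germMap_of_unique
        (by simpa only [LogNL.toForm_coeffs] using huniq) hU] with a ha
      rintro H ⟨-, w', A', t', s', -, -, hH⟩ rfl
      refine ha (LogNL.coeffs 1 w') (LogNL.coeffs (d - 1) A') t' s' ?_
      simpa only [LogNL.toForm_coeffs] using hH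
    · filter_upwards [h'.eventually_germMap_mem_locusIn Filter.univ_mem] with e he
      obtain ⟨h1, w', -, h2⟩ := he
      exact ⟨h1, w', h2⟩
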